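/- **Setting.** For each $n$ let $s_1,\dots,s_n\in\mathbb R^2$ (possibly depending on $n$) be distinct sites, and put $\delta_{j,n}=\min_{k\ne j}\|s_k-s_j\|$, $\Delta_{j,n}=\max_{k\neq j}\|s_k-s_j\|$, $\delta_n=\max_j\delta_{j,n}$, $\Delta_n=\min_j\Delta_{j,n}$. Assume $\delta_n\to0$, $\Delta_n\to\infty$, and that all nearest-neighbour distances are of the same order: there is $c>0$ with $\delta_{j,n}\ge c\,\delta_n$ for all $j\le n$ and all large $n$. Observe $(X(s_j),Y(s_j))$, $j\le n$, where $$Y(s)=\mu(X(s))+\sigma(X(s))V(s),$$ $X=\{X(s)\}_{s\in\mathbb R^2}$ and $V=\{V(s)\}_{s\in\mathbb R^2}$ are real random fields on one probability space, and $\mu:\mathbb R\to\mathbb R$, $\sigma:\mathbb R\to[0,\infty)$ are measurable. Let $b_n,h_n>0$ be bandwidths and $K$ a kernel. Fix $\kappa>0$ and $\gamma>\max\{1,2\kappa/(2+\kappa)\}$. (A1) (i) $X$ is strictly stationary, and there are a nonincreasing $\varphi:[0,\infty)\to[0,\infty)$ with $\varphi(t)\to0$ as $t\to\infty$ and a symmetric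 $\psi:\mathbb N^2\to[0,\infty)$, nondecreasing in each argument, such that for all nonempty finite $S,T\subset\mathbb R^2$, all $A\in\sigma(X(s):s\in S)$ and all $B\in\sigma(X(s):s\in T)$, $$|P(A\cap B)-P(A)P(B)|\le\psi(|S|,|T|)\,\varphi(d(S,T)),\qquad d(S,T)=\min_{u\in S,v\in T}\|u-v\|.$$ (ii) $\limsup_{m\to\infty}m^{4+3\gamma}\sum_{j\ge m}j\,\varphi(j)^{\kappa/(2+\kappa)}<\infty$. (iii) $n\,\psi(1,n)\,\varphi(c_n)\to0$, where $c_n=\{\delta_n^2h_n^{\kappa/(2+\kappa)}\}^{-1/\gamma}$. (A2) $b_n,h_n\to0$, with $b_n$ and $h_n$ of the same order ($b_n=O(h_n)$ and $h_n=O(b_n)$); $n(b_n+h_n)\to\infty$; $\liminf_n n(b_n^2+h_n^2)>0$; $nb_n^5\to0$, $nh_n^5\to0$; and $\delta_n^{-(2+2/\gamma)}(b_n+h_n)^{1-2\kappa/\{(2+\kappa)\gamma\}}\to0$. (A3) $K:\mathbb R\to\mathbb R$ is measurable, continuous almost everywhere, bounded and symmetric, has bounded support, and $\int K=1$. (A4)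 $X(s)$ has a density $f$; for $d=2,3,4$ and $d$ distinct sites the vector $(X(s_{j_1}),\dots,X(s_{j_d}))$ has a density; and all these densities are bounded, uniformly in the sites and in $n$. For some compact $I\subset\mathbb R$ and $\epsilon>0$, with $I^\epsilon=\{x:|x-y|<\epsilon\text{ for some }y\in I\}$: $\inf_{I^\epsilon}f>0$, $\inf_{I^\epsilon}\sigma>0$, $\mu\in C^4(I^\epsilon)$, $\sigma\in C^2(I^\epsilon)$ and $f\in C^1(I^\epsilon)$, where $C^p(S)$ is the set of $p$ times continuously differentiable functions on $S$ whose derivatives of orders $0,\dots,p$ are bounded. For each $n$ the variables $V(s_1),\dots,V(s_n)$ are independent, and each has a common law $\nu$ not depending on $n$, the law of a variable $V$ with $E[V]=0$, $E[V^2]=1$, $E|V|^{8+4\kappa}<\infty$. The fields $X$ and $V$ are independent. **Estimators.** With $\widehat f_b(x)=\frac1{nb}\sum_{j=1}^nK\big(\frac{x-X(s_j)}b\big)$ let $$\widehat\mu_b(x)=\frac1{nb\,\widehat f_b(x)}\sum_{j=1}^nY(s_j)K\Big(\frac{x-X(s_j)}b\Big),\qquad \widehat\mu^*_b(x)=2\widehat\mu_b(x)-\widehat\mu_{\sqrt2\,b}(x),$$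 $$\widehat\sigma^2_{h_n}(x)=\frac1{nh_n\widehat f_{h_n}(x)}\sum_{j=1}^n\{Y(s_j)-\widehat\mu^*_{b_n}(X(s_j))\}^2K\Big(\frac{x-X(s_j)}{h_n}\Big).$$ **Theorem.** Assume all of the above and $E[V^4]>1$, and put $V_4=E[V^4]-1$, $\|K\|_{L^2}^2=\int K^2$. Then for every $N$ and all $x_1<\dots<x_N$ in $I$, $$\sqrt{\frac{nh_n}{V_4\|K\|_{L^2}^2}}\left(\frac{\sqrt{f(x_i)}\,\big(\widehat\sigma^2_{h_n}(x_i)-\sigma^2(x_i)\big)}{\sqrt{\sigma^4(x_i)}}\right)_{i=1}^{N}\ \xrightarrow{d}\ N(0,I_N)\qquad(n\to\infty),$$ where $I_N$ is the $N\times N$ identity matrix. -/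

import Mathlib

open MeasureTheory ProbabilityTheory Filter Set
open scoped Topology

noncomputable section

namespace SpatialReg

/-- The plane `ℝ²` with the Euclidean norm, in which the sampling sites lie. -/
abbrev Plane : Type := EuclideanSpace ℝ (Fin 2)

/-! ### Sampling sites -/

/-- Distance from the `j`-th site to its nearest other site, `min {‖s_k - s_j‖ : k ≠ j}`. -/
def nearest {n : ℕ} (s : Fin n → Plane) (j : Fin n) : ℝ :=
  ⨅ k : {k : Fin n // k ≠ j}, ‖s k - s j‖

/-- Distance from the `j`-th site to its farthest other site, `max {‖s_k - s_j‖ : k ≠ j}`. -/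
def farthest {n : ℕ} (s : Fin n → Plane) (j : Fin n) : ℝ :=
  ⨆ k : {k : Fin n // k ≠ j}, ‖s k - s j‖

/-- `δ_n`, the largest nearest-neighbour distance. -/
def infillGap {n : ℕ} (s : Fin n → Plane) : ℝ := ⨆ j : Fin n, nearest s j

/-- `Δ_n`, the smallest farthest-neighbour distance. -/
def domainSize {n : ℕ} (s : Fin n → Plane) : ℝ := ⨅ j : Fin n, farthest s j

/-- Domain-expanding and infill sampling: for each `n` there are `n` distinct sites, `δ_n → 0` and
`Δ_n → ∞`, and all nearest-neighbour distances are of the common order `δ_n`. -/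
structure DEISampling (s : (n : ℕ) → Fin n → Plane) : Prop where
  distinct : ∀ n, Function.Injective (s n)
  infill : Tendsto (fun n => infillGap (s n)) atTop (𝓝 0)
  expanding : Tendsto (fun n => domainSize (s n)) atTop atTop
  spacing : ∃ c : ℝ, 0 < c ∧ ∀ᶠ n in atTop, ∀ j, c * infillGap (s n) ≤ nearest (s n) j

/-! ### The covariate field -/

section Field

variable {Ω : Type*} [MeasurableSpace Ω]

/-- Strict stationarity: finite-dimensional distributions are translation invariant. -/
def StrictlyStationary (X : Plane → Ω → ℝ) (P : Measure Ω) : Prop :=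
  ∀ (d : ℕ) (t : Fin d → Plane) (u : Plane),
    P.map (fun ω i => X (t i + u) ω) = P.map (fun ω i => X (t i) ω)

/-- The σ-algebra generated by the variables `X(s)`, `s ∈ S`. -/
@[reducible]
def fieldSigma (X : Plane → Ω → ℝ) (S : Finset Plane) : MeasurableSpace Ω :=
  ⨆ s ∈ S, MeasurableSpace.comap (X s) inferInstance

/-- The distance `min {‖u - v‖ : u ∈ S, v ∈ T}` between finite sets of sites. -/
def setDist (S T : Finset Plane) : ℝ :=
  ⨅ p : {u // u ∈ S} × {v // v ∈ T}, ‖(p.1 : Plane) - (p.2 : Plane)‖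

/-- The bound `α(𝓑(S), 𝓑(T)) ≤ ψ(card S, card T) φ(d(S, T))` on the strong mixing coefficient
(a supremum over pairs of events) for all nonempty finite sets of sites `S`, `T`. -/
def MixingBound (X : Plane → Ω → ℝ) (P : Measure Ω) (φ : ℝ → ℝ) (ψ : ℕ → ℕ → ℝ) : Prop :=
  ∀ S T : Finset Plane, S.Nonempty → T.Nonempty →
    ∀ A B : Set Ω, MeasurableSet[fieldSigma X S] A → MeasurableSet[fieldSigma X T] B →
      |P.real (A ∩ B) - P.real A * P.real B| ≤ ψ S.card T.card * φ (setDist S T)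

/-- The radius `c_n = (δ_n² h_n^{κ/(2+κ)})^{-1/γ}`, as a function of `δ_n` and `h_n`. -/
def mixRadius (γ κ δ h : ℝ) : ℝ := (δ ^ 2 * h ^ (κ / (2 + κ))) ^ (-(1 / γ))

/-- Assumption on the spatial process: strict stationarity and mixing. -/
structure ProcessAssumption (P : Measure Ω) (X : Plane → Ω → ℝ) (s : (n : ℕ) → Fin n → Plane)
    (h : ℕ → ℝ) (φ : ℝ → ℝ) (ψ : ℕ → ℕ → ℝ) (γ κ : ℝ) : Prop where
  measurable : ∀ u, Measurable (X u)
  stationary : StrictlyStationary X P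
  rate_antitone : AntitoneOn φ (Ici 0)
  rate_tendsto : Tendsto φ atTop (𝓝 0)
  card_nonneg : ∀ i j, 0 ≤ ψ i j
  card_symm : ∀ i j, ψ i j = ψ j i
  card_mono : ∀ j, Monotone fun i => ψ i j
  mixing : MixingBound X P φ ψ
  kappa_pos : 0 < κ
  gamma_gt : max 1 (2 * κ / (2 + κ)) < γ
  tail_summable : Summable fun j : ℕ => (j : ℝ) * φ j ^ (κ / (2 + κ))
  -- the `limsup` over `m` of `m ^ (4 + 3γ) * ∑_{j ≥ m} j φ(j) ^ (κ / (2 + κ))` is finite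
  tail_bounded : IsBoundedUnder (· ≤ ·) atTop fun m : ℕ =>
    (m : ℝ) ^ (4 + 3 * γ) * ∑' j : ℕ, ((j + m : ℕ) : ℝ) * φ ((j + m : ℕ) : ℝ) ^ (κ / (2 + κ))
  far_mixing : Tendsto
    (fun n : ℕ => (n : ℝ) * ψ 1 n * φ (mixRadius γ κ (infillGap (s n)) (h n))) atTop (𝓝 0)

end Field

/-- Assumption on the bandwidths and the sampling scheme. -/
structure BandwidthAssumption (s : (n : ℕ) → Fin n → Plane) (b h : ℕ → ℝ) (γ κ : ℝ) : Prop where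
  b_pos : ∀ n, 0 < b n
  h_pos : ∀ n, 0 < h n
  b_tendsto : Tendsto b atTop (𝓝 0)
  h_tendsto : Tendsto h atTop (𝓝 0)
  same_order : b =Θ[atTop] h
  linear : Tendsto (fun n : ℕ => (n : ℝ) * (b n + h n)) atTop atTop
  -- the `liminf` of `n (b_n² + h_n²)` is positive (possibly infinite)
  quadratic : ∃ c : ℝ, 0 < c ∧ ∀ᶠ n : ℕ in atTop, c ≤ (n : ℝ) * (b n ^ 2 + h n ^ 2)
  b_fifth : Tendsto (fun n : ℕ => (n : ℝ) * b n ^ 5) atTop (𝓝 0)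
  h_fifth : Tendsto (fun n : ℕ => (n : ℝ) * h n ^ 5) atTop (𝓝 0)
  gap : Tendsto (fun n : ℕ => infillGap (s n) ^ (-(2 + 2 / γ)) *
    (b n + h n) ^ (1 - 2 * κ / ((2 + κ) * γ))) atTop (𝓝 0)

/-- Assumption on the kernel function. -/
structure KernelAssumption (K : ℝ → ℝ) : Prop where
  measurable : Measurable K
  ae_continuous : ∀ᵐ z, ContinuousAt K z
  bounded : ∃ C : ℝ, ∀ z, |K z| ≤ C
  symmetric : ∀ z, K (-z) = K z
  bounded_support : Bornology.IsBounded (Function.support K)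
  integral_one : ∫ z, K z = 1

/-- `g ∈ C^p(S)`: `g` is `p` times continuously differentiable on `S`, and its derivatives of
order `0, …, p` are bounded on `S`. -/
def BddContDiffOn (p : ℕ) (g : ℝ → ℝ) (S : Set ℝ) : Prop :=
  ContDiffOn ℝ (p : WithTop ℕ∞) g S ∧
    ∀ k ≤ p, ∃ C : ℝ, ∀ x ∈ S, |iteratedDerivWithin k g S x| ≤ C

/-- The measure `ρ` on `ℝ^d` has a Lebesgue density that is bounded by `M`. -/
def HasDensityBoundedBy {d : ℕ} (ρ : Measure (Fin d → ℝ)) (M : NNReal) : Prop :=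
  ∃ g : (Fin d → ℝ) → ENNReal, Measurable g ∧ (∀ z, g z ≤ M) ∧ ρ = volume.withDensity g

/-- Assumption on the regression model: `f` is the density of `X(s)`, `m` and `σ` are the mean and
scale functions, `ν` is the common law of the errors, and `I` is the compact set of design points
with its open `ε`-enlargement `Metric.thickening ε I`. -/
structure ModelAssumption {Ω : Type*} [MeasurableSpace Ω] (P : Measure Ω)
    (X V : Plane → Ω → ℝ) (s : (n : ℕ) → Fin n → Plane) (m σ f : ℝ → ℝ) (ν : Measure ℝ)
    (I : Set ℝ) (ε κ : ℝ) : Prop where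
  -- marginal density
  f_measurable : Measurable f
  f_nonneg : ∀ x, 0 ≤ f x
  f_density : ∀ u, P.map (X u) = volume.withDensity fun x => ENNReal.ofReal (f x)
  f_bounded : ∃ M : ℝ, ∀ x, f x ≤ M
  -- joint densities at 2, 3 or 4 distinct sites, bounded uniformly
  joint_density : ∃ M : NNReal, ∀ n d : ℕ, 2 ≤ d → d ≤ 4 →
    ∀ τ : Fin d → Fin n, Function.Injective τ →
      HasDensityBoundedBy (P.map fun ω i => X (s n (τ i)) ω) M
  -- positivity and smoothness near the compact set `I`
  compact : IsCompact I
  eps_pos : 0 < ε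
  f_pos : ∃ c : ℝ, 0 < c ∧ ∀ x ∈ Metric.thickening ε I, c ≤ f x
  σ_pos : ∃ c : ℝ, 0 < c ∧ ∀ x ∈ Metric.thickening ε I, c ≤ σ x
  f_smooth : BddContDiffOn 1 f (Metric.thickening ε I)
  m_measurable : Measurable m
  m_smooth : BddContDiffOn 4 m (Metric.thickening ε I)
  σ_measurable : Measurable σ
  σ_nonneg : ∀ x, 0 ≤ σ x
  σ_smooth : BddContDiffOn 2 σ (Metric.thickening ε I)
  -- the errors at the sites are independent and identically distributed with law `ν`
  V_measurable : ∀ u, Measurable (V u)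
  V_indep : ∀ n, iIndepFun (fun j : Fin n => V (s n j)) P
  V_law : ∀ n (j : Fin n), P.map (V (s n j)) = ν
  V_mean : ∫ v, v ∂ν = 0
  V_second : ∫ v, v ^ 2 ∂ν = 1
  V_moment : Integrable (fun v => |v| ^ (8 + 4 * κ)) ν
  -- the covariate field and the error field are independent
  fields_indep : IndepFun (fun ω u => X u ω) (fun ω u => V u ω) P

/-! ### The estimators, as functions of the sample `(X_j, Y_j)`, `j = 1, …, n` -/

/-- Kernel density estimator `(n b)⁻¹ ∑ K((x - X_j) / b)`. -/
def densityEst (K : ℝ → ℝ) {n : ℕ} (Xs : Fin n → ℝ) (b x : ℝ) : ℝ :=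
  1 / (n * b) * ∑ j, K ((x - Xs j) / b)

/-- Kernel estimator `μ̂_b(x)` of the mean function. -/
def meanEst (K : ℝ → ℝ) {n : ℕ} (Xs Ys : Fin n → ℝ) (b x : ℝ) : ℝ :=
  1 / (n * b * densityEst K Xs b x) * ∑ j, Ys j * K ((x - Xs j) / b)

/-- Jackknife estimator `2 μ̂_b(x) - μ̂_{√2 b}(x)` of the mean function. -/
def jackknifeMeanEst (K : ℝ → ℝ) {n : ℕ} (Xs Ys : Fin n → ℝ) (b x : ℝ) : ℝ :=
  2 * meanEst K Xs Ys b x - meanEst K Xs Ys (√2 * b) x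

/-- Kernel estimator `σ̂²_h(x)` of the variance function, built from the squared residuals of the
jackknife mean estimator with bandwidth `b`. -/
def varianceEst (K : ℝ → ℝ) {n : ℕ} (Xs Ys : Fin n → ℝ) (b h x : ℝ) : ℝ :=
  1 / (n * h * densityEst K Xs h x) *
    ∑ j, (Ys j - jackknifeMeanEst K Xs Ys b (Xs j)) ^ 2 * K ((x - Xs j) / h)

/-- The response field `Y(u) = m(X(u)) + σ(X(u)) V(u)`. -/
def response {Ω : Type*} (m σ : ℝ → ℝ) (X V : Plane → Ω → ℝ) (u : Plane) (ω : Ω) : ℝ :=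
  m (X u ω) + σ (X u ω) * V u ω

end SpatialReg

end

/-! Put A = Σ K((x - X_j)/h). Then √(nh) (σ̂²(x) - σ²(x)) is √(nh)/A times the sum of three terms:
the centred squared errors Σ K σ²(X_j)(V_j² - 1), the smoothing bias Σ K (σ²(X_j) - σ²(x)), and the
effect of using residuals in place of errors. The last two vanish in probability after scaling
(`tendsto_varianceEst_sub_leading`).

Given the covariates, the first term is a weighted sum of independent variables, so its conditional
characteristic function is a product of values of `sqCharFun`
(`ModelAssumption.integral_exp_weighted`). The weights are uniformly small and the sum of their
squares has a deterministic limit, so the product tends in probability to a Gaussian characteristic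
function (`tendsto_prod_sqCharFun`). It is bounded by one, so its expectation converges too. Weights
at distinct design points eventually have disjoint supports, which makes the limit covariance
diagonal.

Spatial dependence thus enters only through local averages of the covariates, and the key estimate
is `exists_variance_sum_le`. The covariance at two sites is O(β²) because joint densities are
bounded, and O(φ(d)) by mixing. Interpolating with θ = κ/((2+κ)γ) gives β^(2-2θ) (1+d)^(-3). Packing
sums this over the sites to β^(2-2θ) δ⁻², and the condition linking gap and bandwidth reduces that
to O(β). Hence a local sum has variance O(nβ).

For the smoothing bias, the linear Taylor term is a local sum with a centred kernel, by symmetry of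
K, and the quadratic remainder is of order √(n h⁵). For the residuals, the jackknife is a local
linear smoother whose weights sum to one and are at most of order 1/(nh). Its bias O(b) appears
either squared or multiplied by centred errors, and its noise gives quadratic forms of bounded size,
so all of this is negligible against √(nh) (`lintegral_residualEffect_le`). The denominators of the
smoother must be bounded below simultaneously at all points near x; `eventually_kernel_sum_ge` does
this with a lower envelope of K. -/

namespace SpatialReg

/-! ### Convergence in probability as a filter. -/

section Whp

variable {Ω : Type*} [MeasurableSpace Ω]

/-- The filter on `ℕ × Ω` of sequences of events whose probabilities tend to one. Convergence along
it is convergence in probability. -/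
def whp (P : Measure Ω) : Filter (ℕ × Ω) where
  sets := {S | Tendsto (fun n => P {ω | (n, ω) ∉ S}) atTop (𝓝 0)}
  univ_sets := by simp
  sets_of_superset := by
    intro S T hS hST
    exact tendsto_of_tendsto_of_tendsto_of_le_of_le tendsto_const_nhds hS (fun _ => zero_le)
      fun n => measure_mono fun ω hω h => hω (hST h)
  inter_sets := by
    intro S T hS hT
    have h := Tendsto.add hS hT
    rw [add_zero] at h
    refine tendsto_of_tendsto_of_tendsto_of_le_of_le tendsto_const_nhds h (fun _ => zero_le)
      fun n => (measure_mono ?_).trans (measure_union_le _ _)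
    intro ω hω
    simp only [mem_inter_iff, mem_ofPred_eq, mem_union] at *
    tauto

theorem eventually_whp {P : Measure Ω} {p : ℕ × Ω → Prop} :
    (∀ᶠ x in whp P, p x) ↔ Tendsto (fun n => P {ω | ¬ p (n, ω)}) atTop (𝓝 0) := Iff.rfl

theorem tendsto_fst_whp (P : Measure Ω) : Tendsto Prod.fst (whp P) atTop := by
  refine tendsto_atTop.2 fun N => eventually_whp.2 ?_
  refine tendsto_const_nhds.congr' ?_
  filter_upwards [eventually_ge_atTop N] with n hn
  simp [hn]

theorem tendstoInMeasure_of_whp {E : Type*} [SeminormedAddCommGroup E] {P : Measure Ω}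
    {Z : ℕ → Ω → E} (hZ : Tendsto (fun p : ℕ × Ω => Z p.1 p.2) (whp P) (𝓝 0)) :
    TendstoInMeasure P Z atTop 0 := by
  rw [tendstoInMeasure_iff_norm]
  intro ε hε
  have := eventually_whp.1 ((Metric.tendsto_nhds.1 hZ) ε hε)
  simpa using this

/-- Bounded convergence along `whp`. -/
theorem tendsto_integral_of_whp {E : Type*} [NormedAddCommGroup E] [NormedSpace ℝ E]
    {P : Measure Ω} [IsProbabilityMeasure P] {Z : ℕ → Ω → E} {z : E} {C : ℝ}
    (hm : ∀ n, AEStronglyMeasurable (Z n) P) (hC : ∀ n ω, ‖Z n ω‖ ≤ C)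
    (hZ : Tendsto (fun p : ℕ × Ω => Z p.1 p.2) (whp P) (𝓝 z)) :
    Tendsto (fun n => ∫ ω, Z n ω ∂P) atTop (𝓝 (∫ _, z ∂P)) := by
  -- Convergence in measure gives almost sure convergence only along subsequences, so every
  -- subsequence is thinned once more before dominated convergence applies.
  refine tendsto_of_subseq_tendsto fun ns hns => ?_
  have h0 : TendstoInMeasure P Z atTop (fun _ => z) := by
    rw [tendstoInMeasure_iff_dist]
    intro ε hε
    have := eventually_whp.1 ((Metric.tendsto_nhds.1 hZ) ε hε)
    simpa using this
  obtain ⟨ms, -, hae⟩ := (h0.comp hns).exists_seq_tendsto_ae'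
  exact ⟨ms, tendsto_integral_of_dominated_convergence (fun _ => C) (fun k => hm _)
    (integrable_const _) (fun k => ae_of_all _ (hC _)) hae⟩

/-- Chebyshev: if the second moments of `Z n - c n` tend to zero and `c n → z`, then `Z n → z`
in probability. -/
theorem tendsto_whp_of_variance {P : Measure Ω} [IsProbabilityMeasure P] {Z : ℕ → Ω → ℝ} {z : ℝ}
    (hm : ∀ n, MemLp (Z n) 2 P) (hmean : Tendsto (fun n => ∫ ω, Z n ω ∂P) atTop (𝓝 z))
    (hvar : Tendsto (fun n => Var[Z n; P]) atTop (𝓝 0)) :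
    Tendsto (fun p : ℕ × Ω => Z p.1 p.2) (whp P) (𝓝 z) := by
  have h1 : Tendsto (fun p : ℕ × Ω => Z p.1 p.2 - ∫ ω, Z p.1 ω ∂P) (whp P) (𝓝 0) := by
    refine Metric.tendsto_nhds.2 fun ε hε => eventually_whp.2 ?_
    have h2 : Tendsto (fun n => ENNReal.ofReal (Var[Z n; P] / ε ^ 2)) atTop (𝓝 0) := by
      have := ENNReal.tendsto_ofReal (hvar.div_const (ε ^ 2))
      simpa using this
    refine tendsto_of_tendsto_of_tendsto_of_le_of_le tendsto_const_nhds h2 (fun _ => zero_le)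
      fun n => ?_
    have := meas_ge_le_variance_div_sq (hm n) hε
    simpa [not_lt] using this
  have h2 := h1.add (hmean.comp (tendsto_fst_whp P))
  simpa using h2

/-- Conditional Markov inequality along `whp`: if the conditional first absolute moment tends to
zero in probability, then so does the variable. -/
theorem tendsto_whp_of_conditional {P : Measure Ω} [IsProbabilityMeasure P]
    {A B : ℕ → Type*} [∀ n, MeasurableSpace (A n)] [∀ n, MeasurableSpace (B n)]
    {U : (n : ℕ) → Ω → A n} {W : (n : ℕ) → Ω → B n} (ρ : (n : ℕ) → Measure (B n))
    [∀ n, IsProbabilityMeasure (ρ n)]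
    (hU : ∀ n, Measurable (U n)) (hW : ∀ n, Measurable (W n))
    (hlaw : ∀ n, P.map (fun ω => (U n ω, W n ω)) = (P.map (U n)).prod (ρ n))
    {F : (n : ℕ) → A n × B n → ℝ} (hF : ∀ n, Measurable (F n))
    {r : ℕ → ℝ} (hr : Tendsto r atTop (𝓝 0))
    (hbd : ∀ᶠ p in whp P, ∫⁻ w, ‖F p.1 (U p.1 p.2, w)‖ₑ ∂(ρ p.1) ≤ ENNReal.ofReal (r p.1)) :
    Tendsto (fun p : ℕ × Ω => F p.1 (U p.1 p.2, W p.1 p.2)) (whp P) (𝓝 0) := by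
  refine Metric.tendsto_nhds.2 fun ε hε => eventually_whp.2 ?_
  have h2 : Tendsto (fun n => ENNReal.ofReal (r n) / ENNReal.ofReal ε) atTop (𝓝 0) := by
    have := ENNReal.tendsto_ofReal hr
    have h3 := ENNReal.Tendsto.div_const (b := ENNReal.ofReal ε) this
      (Or.inr (by simpa using hε))
    simpa using h3
  have h3 := (eventually_whp.1 hbd).add h2
  rw [add_zero] at h3
  refine tendsto_of_tendsto_of_tendsto_of_le_of_le tendsto_const_nhds h3 (fun _ => zero_le)
    fun n => ?_
  set q : A n → ENNReal := fun a => ∫⁻ w, ‖F n (a, w)‖ₑ ∂(ρ n) with hq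
  have hqm : Measurable q := Measurable.lintegral_prod_right' (f := fun z => ‖F n z‖ₑ)
    (hF n).enorm
  set G : Set (A n) := {a | q a ≤ ENNReal.ofReal (r n)} with hG
  have hGm : MeasurableSet G := measurableSet_le hqm measurable_const
  set S : Set (A n × B n) := {z | ENNReal.ofReal ε ≤ ‖F n z‖ₑ} with hS
  have hSm : MeasurableSet S := measurableSet_le measurable_const (hF n).enorm
  -- Either the conditional moment bound fails, which has vanishing probability, or it holds and
  -- Markov's inequality applies in the second coordinate with the first one frozen.
  have hsub : {ω | ¬ dist (F n (U n ω, W n ω)) 0 < ε} ⊆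
      {ω | ¬ q (U n ω) ≤ ENNReal.ofReal (r n)} ∪
      (fun ω => (U n ω, W n ω)) ⁻¹' ((G ×ˢ univ) ∩ S) := by
    intro ω hω
    by_cases hg : q (U n ω) ≤ ENNReal.ofReal (r n)
    · right
      simp only [dist_zero_right, not_lt, mem_ofPred_eq] at hω
      refine ⟨⟨hg, mem_univ _⟩, ?_⟩
      simp only [hS, mem_ofPred_eq]
      rw [← ofReal_norm]
      exact ENNReal.ofReal_le_ofReal hω
    · left; exact hg
  refine (measure_mono hsub).trans ((measure_union_le _ _).trans (add_le_add_right ?_ _))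
  have hTm : MeasurableSet ((G ×ˢ (univ : Set (B n))) ∩ S) :=
    (hGm.prod MeasurableSet.univ).inter hSm
  rw [← Measure.map_apply ((hU n).prodMk (hW n)) hTm, hlaw n, Measure.prod_apply hTm]
  have : IsProbabilityMeasure (P.map (U n)) := Measure.isProbabilityMeasure_map (hU n).aemeasurable
  calc ∫⁻ a, ρ n (Prod.mk a ⁻¹' ((G ×ˢ univ) ∩ S)) ∂(P.map (U n))
      ≤ ∫⁻ _, ENNReal.ofReal (r n) / ENNReal.ofReal ε ∂(P.map (U n)) := by
        refine lintegral_mono fun a => ?_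
        by_cases ha : a ∈ G
        · have hle : ρ n (Prod.mk a ⁻¹' ((G ×ˢ univ) ∩ S)) ≤
              ρ n {w | ENNReal.ofReal ε ≤ ‖F n (a, w)‖ₑ} :=
            measure_mono fun w hw => hw.2
          refine hle.trans ?_
          have := meas_ge_le_lintegral_div (μ := ρ n) (f := fun w => ‖F n (a, w)‖ₑ)
            ((hF n).enorm.comp measurable_prodMk_left).aemeasurable
            (ε := ENNReal.ofReal ε) (by simpa using hε) (by simp)
          exact this.trans (ENNReal.div_le_div_right ha _)
        · have : Prod.mk a ⁻¹' ((G ×ˢ (univ : Set (B n))) ∩ S) = ∅ := by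
            ext w; simp [ha]
          simp [this]
    _ = _ := by simp

end Whp

/-! ### Packing of separated points in the plane. -/

section Geometry

/-- Packing bound: for points at mutual distance at least `2ρ`, `ρ ≤ 1`. -/
theorem exists_sum_one_add_norm_le :
    ∃ C : ℝ, 0 < C ∧ ∀ (n : ℕ) (s : Fin n → Plane) (ρ : ℝ), 0 < ρ → ρ ≤ 1 →
      (∀ j k, j ≠ k → 2 * ρ ≤ ‖s k - s j‖) → ∀ y : Plane,
        ∑ k, (1 + ‖s k - y‖) ^ (-3 : ℝ) ≤ C * ρ ^ (-2 : ℝ) := by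
  set F : Plane → ℝ := fun z => (1 + ‖z‖) ^ (-3 : ℝ) with hF
  -- Integrability holds because the exponent 3 exceeds the dimension 2.
  have hFint : Integrable F := integrable_one_add_norm (by simp; norm_num)
  have hF0 : ∀ z, 0 ≤ F z := fun z => by simp only [hF]; positivity
  set c0 : ℝ := volume.real (Metric.ball (0 : Plane) 1) with hc0
  have hc0pos : 0 < c0 := by
    rw [hc0, measureReal_def]
    exact ENNReal.toReal_pos (Metric.measure_ball_pos _ _ one_pos).ne' measure_ball_lt_top.ne
  refine ⟨8 * (∫ z, F z) / c0 + 1, ?_, ?_⟩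
  · have : 0 ≤ ∫ z, F z := integral_nonneg hF0
    positivity
  intro n s ρ hρ hρ1 hsep y
  have hvol : ∀ k, volume.real (Metric.ball (s k) ρ) = ρ ^ 2 * c0 := by
    intro k
    rw [measureReal_def, Measure.addHaar_ball _ _ hρ.le, ENNReal.toReal_mul,
      ENNReal.toReal_ofReal (by positivity)]
    simp [hc0, measureReal_def]
  have hdisj : Pairwise (Function.onFun Disjoint fun k => Metric.ball (s k) ρ) := by
    intro j k hjk
    refine Metric.ball_disjoint_ball ?_
    rw [dist_comm, dist_eq_norm]
    linarith [hsep j k hjk]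
  have hGint : Integrable (fun z => F (z - y)) := hFint.comp_sub_right y
  -- Each term is compared with an integral over its own ball. As `ρ ≤ 1`, the quantity 1 + ‖z - y‖
  -- at most doubles on that ball, which costs 2³ = 8.
  have hk : ∀ k, (1 + ‖s k - y‖) ^ (-3 : ℝ) * (ρ ^ 2 * c0) ≤
      8 * ∫ z in Metric.ball (s k) ρ, F (z - y) := by
    intro k
    rw [← hvol k, ← integral_const_mul, mul_comm, ← smul_eq_mul, ← setIntegral_const]
    refine setIntegral_mono_on (integrableOn_const measure_ball_lt_top.ne)
      (hGint.const_mul 8).integrableOn measurableSet_ball fun z hz => ?_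
    have h1 : ‖z - y‖ ≤ ‖z - s k‖ + ‖s k - y‖ := norm_sub_le_norm_sub_add_norm_sub _ _ _
    rw [Metric.mem_ball, dist_eq_norm] at hz
    have h2 : 1 + ‖z - y‖ ≤ 2 * (1 + ‖s k - y‖) := by
      have := norm_nonneg (s k - y); linarith
    have h3 := Real.rpow_le_rpow_of_nonpos (z := -3) (by positivity) h2 (by norm_num)
    rw [Real.mul_rpow (by norm_num) (by positivity)] at h3
    have h4 : (2 : ℝ) ^ (-3 : ℝ) = 1 / 8 := by
      rw [Real.rpow_neg (by norm_num)]; norm_num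
    rw [h4] at h3
    simp only [hF]; linarith
  have hsum : (∑ k, (1 + ‖s k - y‖) ^ (-3 : ℝ)) * (ρ ^ 2 * c0) ≤ 8 * ∫ z, F z := by
    rw [Finset.sum_mul]
    refine (Finset.sum_le_sum fun k _ => hk k).trans ?_
    rw [← Finset.mul_sum, ← integral_iUnion_fintype (fun k => measurableSet_ball) hdisj
      (fun k => hGint.integrableOn), ← integral_sub_right_eq_self F y]
    gcongr
    · exact ae_of_all _ fun z => hF0 _
    · exact Measure.restrict_le_self
  have hρ2 : ρ ^ (-2 : ℝ) = (ρ ^ 2)⁻¹ := by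
    rw [Real.rpow_neg hρ.le]; norm_num
  rw [hρ2, ← div_eq_mul_inv, le_div_iff₀ (by positivity)]
  have : (∑ k, (1 + ‖s k - y‖) ^ (-3 : ℝ)) * ρ ^ 2 ≤ 8 * (∫ z, F z) / c0 := by
    rw [le_div_iff₀ hc0pos]; linarith
  linarith

end Geometry

/-! ### Covariance inequalities and the mixing rate. -/

section Mixing

/-- If the integrals of `Z` over the events of `m` are at most `α`, then so are, up to the factor
`2 M`, its integrals against `m`-measurable functions bounded by `M`. -/
theorem abs_integral_mul_le_of_setIntegral_le {Ω : Type*} {m : MeasurableSpace Ω}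
    [m0 : MeasurableSpace Ω] {P : Measure Ω} [IsProbabilityMeasure P] (hm : m ≤ m0)
    {ξ Z : Ω → ℝ} {M α : ℝ}
    (hξ : StronglyMeasurable[m] ξ) (hM : ∀ ω, |ξ ω| ≤ M) (hZ : Integrable Z P)
    (hα : ∀ A, MeasurableSet[m] A → |∫ ω in A, Z ω ∂P| ≤ α) :
    |∫ ω, ξ ω * Z ω ∂P| ≤ 2 * M * α := by
  have hM0 : 0 ≤ M := by
    obtain ⟨ω⟩ : Nonempty Ω := P.nonempty_of_neZero
    exact (abs_nonneg _).trans (hM ω)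
  set E : Ω → ℝ := P[Z|m] with hE
  have hEint : Integrable E P := integrable_condExp
  have hEm : StronglyMeasurable[m] E := stronglyMeasurable_condExp
  have h1 : ∫ ω, ξ ω * Z ω ∂P = ∫ ω, ξ ω * E ω ∂P := by
    have h := condExp_stronglyMeasurable_mul_of_bound hm hξ hZ M (ae_of_all P hM)
    have h2 := integral_congr_ae h
    rw [integral_condExp hm] at h2
    exact h2
  have h2 : |∫ ω, ξ ω * E ω ∂P| ≤ M * ∫ ω, |E ω| ∂P := by
    rw [← integral_const_mul]
    refine (abs_integral_le_integral_abs).trans (integral_mono_of_nonneg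
      (ae_of_all _ fun ω => abs_nonneg _) (hEint.abs.const_mul M) (ae_of_all _ fun ω => ?_))
    simp only [abs_mul]
    exact mul_le_mul_of_nonneg_right (hM ω) (abs_nonneg _)
  -- Splitting by the sign of the conditional expectation writes its L¹ norm as a difference of two
  -- integrals of `Z` over events of `m`.
  set A : Set Ω := {ω | 0 ≤ E ω} with hA
  have hAm : MeasurableSet[m] A := @measurableSet_le _ _ _ _ _ m _ _ _ _ _
    measurable_const hEm.measurable
  have h3 : ∫ ω, |E ω| ∂P = ∫ ω in A, Z ω ∂P - ∫ ω in Aᶜ, Z ω ∂P := by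
    rw [← setIntegral_condExp hm hZ hAm, ← setIntegral_condExp hm hZ hAm.compl,
      ← integral_add_compl (hm _ hAm) hEint.abs, sub_eq_add_neg, ← integral_neg]
    congr 1
    · exact setIntegral_congr_fun (hm _ hAm) fun ω hω => abs_of_nonneg hω
    · refine setIntegral_congr_fun (hm _ hAm.compl) fun ω hω => abs_of_neg ?_
      simpa [hA] using hω
  have h4 : ∫ ω, |E ω| ∂P ≤ 2 * α := by
    rw [h3]
    have ha := (abs_le.1 (hα A hAm)).2
    have hb := (abs_le.1 (hα Aᶜ hAm.compl)).1
    linarith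
  rw [h1]
  nlinarith [mul_le_mul_of_nonneg_left h4 hM0]

/-- Covariance inequality for bounded variables under strong mixing. -/
theorem abs_covariance_le_of_mixing {Ω : Type*} {m₁ m₂ : MeasurableSpace Ω}
    [m0 : MeasurableSpace Ω] {P : Measure Ω} [IsProbabilityMeasure P] (h₁ : m₁ ≤ m0)
    (h₂ : m₂ ≤ m0) {ξ η : Ω → ℝ} {M α : ℝ}
    (hξ : StronglyMeasurable[m₁] ξ) (hη : StronglyMeasurable[m₂] η)
    (hMξ : ∀ ω, |ξ ω| ≤ M) (hMη : ∀ ω, |η ω| ≤ M)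
    (hα : ∀ A B, MeasurableSet[m₁] A → MeasurableSet[m₂] B →
      |P.real (A ∩ B) - P.real A * P.real B| ≤ α) :
    |cov[ξ, η; P]| ≤ 4 * M ^ 2 * α := by
  have hξ' : Integrable ξ P := Integrable.of_bound (hξ.mono h₁).aestronglyMeasurable M
    (ae_of_all P hMξ)
  have hη' : Integrable η P := Integrable.of_bound (hη.mono h₂).aestronglyMeasurable M
    (ae_of_all P hMη)
  -- The previous lemma is used twice: here against ξ with the centred indicator of `B`, and
  -- afterwards against η with ξ centred.
  have hB : ∀ B, MeasurableSet[m₂] B → |∫ ω in B, (ξ ω - ∫ ω', ξ ω' ∂P) ∂P| ≤ 2 * M * α := by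
    intro B hB
    have hBm := h₂ _ hB
    set Z : Ω → ℝ := fun ω => B.indicator (fun _ => (1 : ℝ)) ω - P.real B with hZ
    have hind : Integrable (B.indicator fun _ => (1 : ℝ)) P :=
      (integrable_const 1).indicator hBm
    have hZi : Integrable Z P := hind.sub (integrable_const _)
    have h := abs_integral_mul_le_of_setIntegral_le h₁ hξ hMξ hZi (α := α) ?_
    · have hξB : Integrable (fun ω => ξ ω * B.indicator (fun _ => (1 : ℝ)) ω) P :=
        (hξ'.indicator hBm).congr (ae_of_all _ fun ω => by
          by_cases hω : ω ∈ B <;> simp [hω])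
      convert h using 2
      rw [integral_sub hξ'.integrableOn (integrable_const _).integrableOn]
      have e1 : ∫ ω, ξ ω * Z ω ∂P =
          ∫ ω, ξ ω * B.indicator (fun _ => (1 : ℝ)) ω ∂P - (∫ ω, ξ ω ∂P) * P.real B := by
        simp only [hZ, mul_sub]
        rw [integral_sub hξB (hξ'.mul_const _), integral_mul_const]
      rw [e1, ← integral_indicator hBm, setIntegral_const, smul_eq_mul]
      congr 1
      · refine integral_congr_ae (ae_of_all _ fun ω => ?_)
        by_cases hω : ω ∈ B <;> simp [hω]
      · ring
    · intro A hA
      have := hα A B hA hB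
      convert this using 2
      simp only [hZ]
      rw [integral_sub hind.integrableOn (integrable_const _).integrableOn,
        setIntegral_indicator hBm, setIntegral_const, setIntegral_const]
      simp
  have h := abs_integral_mul_le_of_setIntegral_le h₂ hη hMη
    (hξ'.sub (integrable_const (∫ ω', ξ ω' ∂P))) (α := 2 * M * α) hB
  have e : cov[ξ, η; P] = ∫ ω, η ω * (ξ ω - ∫ ω', ξ ω' ∂P) ∂P := by
    have hint : Integrable (fun ω => ξ ω - ∫ ω', ξ ω' ∂P) P := hξ'.sub (integrable_const _)
    have hprod : Integrable (fun ω => η ω * (ξ ω - ∫ ω', ξ ω' ∂P)) P :=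
      hint.bdd_mul (hη.mono h₂).aestronglyMeasurable (ae_of_all _ hMη)
    rw [covariance]
    have : ∀ ω, (ξ ω - ∫ ω', ξ ω' ∂P) * (η ω - ∫ ω', η ω' ∂P) =
        η ω * (ξ ω - ∫ ω', ξ ω' ∂P) - (∫ ω', η ω' ∂P) * (ξ ω - ∫ ω', ξ ω' ∂P) := fun ω => by ring
    simp_rw [this]
    rw [integral_sub hprod (hint.const_mul _), integral_const_mul,
      integral_sub hξ' (integrable_const _)]
    simp
  rw [e]
  refine h.trans (le_of_eq (by ring))

variable {Ω : Type*} [MeasurableSpace Ω] {P : Measure Ω} {X : Plane → Ω → ℝ}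
  {s : (n : ℕ) → Fin n → Plane}
  {h : ℕ → ℝ} {φ : ℝ → ℝ} {ψ : ℕ → ℕ → ℝ} {γ κ : ℝ}

theorem ProcessAssumption.rate_nonneg (hA : ProcessAssumption P X s h φ ψ γ κ) {t : ℝ}
    (ht : 0 ≤ t) : 0 ≤ φ t := by
  refine le_of_tendsto hA.rate_tendsto ?_
  filter_upwards [eventually_ge_atTop t] with u hu
  exact hA.rate_antitone ht (ht.trans hu) hu

theorem ProcessAssumption.exponent_pos (hA : ProcessAssumption P X s h φ ψ γ κ) :
    0 < κ / (2 + κ) := by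
  have := hA.kappa_pos
  positivity

theorem ProcessAssumption.gamma_pos (hA : ProcessAssumption P X s h φ ψ γ κ) : 1 < γ :=
  (le_max_left _ _).trans_lt hA.gamma_gt

/-- Keeps 1 - 2θ positive for θ = κ/((2+κ)γ); this is the power of the bandwidth left over after
interpolating covariances. -/
theorem ProcessAssumption.two_exponent_lt (hA : ProcessAssumption P X s h φ ψ γ κ) :
    2 * (κ / (2 + κ) / γ) < 1 := by
  have h1 := (le_max_right _ _).trans_lt hA.gamma_gt
  have h2 := hA.gamma_pos
  have : 2 * (κ / (2 + κ) / γ) = (2 * κ / (2 + κ)) / γ := by ring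
  rw [this, div_lt_one (by linarith)]
  exact h1

/-- Polynomial decay of the mixing rate. -/
theorem ProcessAssumption.rate_le (hA : ProcessAssumption P X s h φ ψ γ κ) :
    ∃ C : ℝ, 0 ≤ C ∧ ∀ t : ℝ, 0 ≤ t → φ t ^ (κ / (2 + κ) / γ) ≤ C * (1 + t) ^ (-3 : ℝ) := by
  set p := κ / (2 + κ) with hp
  have hp0 : 0 < p := hA.exponent_pos
  have hγ := hA.gamma_pos
  have hγ0 : 0 < γ := by linarith
  obtain ⟨B, hB⟩ := hA.tail_bounded
  rw [eventually_map] at hB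
  obtain ⟨m1, hm1⟩ := eventually_atTop.1 hB
  set B' := max B 0
  -- Of the tail sum only its first term is kept. Powers of `m` beyond 3γ are dropped; the root of
  -- order γ taken below turns the rest into the power -3.
  have key : ∀ m : ℕ, m1 ≤ m → 1 ≤ m → φ m ^ p ≤ B' * (m : ℝ) ^ (-(3 * γ)) := by
    intro m hm hm'
    have hmpos : (0 : ℝ) < m := by exact_mod_cast hm'
    have hm1' : (1 : ℝ) ≤ m := by exact_mod_cast hm'
    have hsum : Summable fun j : ℕ => ((j + m : ℕ) : ℝ) * φ ((j + m : ℕ) : ℝ) ^ p :=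
      (summable_nat_add_iff m).2 hA.tail_summable
    have hle := hsum.le_tsum 0 (fun j _ => mul_nonneg (Nat.cast_nonneg _)
      (Real.rpow_nonneg (hA.rate_nonneg (Nat.cast_nonneg _)) _))
    rw [zero_add] at hle
    have hφ0 : 0 ≤ φ m ^ p := Real.rpow_nonneg (hA.rate_nonneg hmpos.le) _
    have h1 : φ m ^ p ≤ m * φ m ^ p := by nlinarith
    have h2 := hm1 m hm
    have h3 : (m : ℝ) ^ (4 + 3 * γ) * φ m ^ p ≤ B' :=
      ((mul_le_mul_of_nonneg_left (h1.trans hle) (by positivity)).trans h2).trans (le_max_left _ _)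
    have h4 : (m : ℝ) ^ (3 * γ) * φ m ^ p ≤ B' := by
      refine le_trans (mul_le_mul_of_nonneg_right ?_ hφ0) h3
      exact Real.rpow_le_rpow_of_exponent_le hm1' (by linarith)
    rw [Real.rpow_neg hmpos.le, ← div_eq_mul_inv, le_div_iff₀ (by positivity)]
    linarith
  set T : ℝ := m1 + 1 with hT
  have hT0 : 0 ≤ T := by positivity
  set C1 := φ 0 ^ (p / γ) * (1 + T) ^ (3 : ℝ)
  set C2 := B' ^ (1 / γ) * (1 / 3 : ℝ) ^ (-3 : ℝ)
  have hφ00 := hA.rate_nonneg le_rfl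
  have hB'0 : 0 ≤ B' := le_max_right _ _
  have hC1 : 0 ≤ C1 := by positivity
  have hC2 : 0 ≤ C2 := by positivity
  refine ⟨C1 + C2, by positivity, fun t ht => ?_⟩
  have ht3 : 0 < (1 + t) ^ (-3 : ℝ) := by positivity
  rcases le_or_gt T t with hTt | hTt
  · suffices φ t ^ (p / γ) ≤ C2 * (1 + t) ^ (-3 : ℝ) by nlinarith
    -- The integer part satisfies 1 + t ≤ m + 2 ≤ 3m, whence the factor 1/3 in `C2`.
    set m := ⌊t⌋₊ with hmdef
    have hmt : (m : ℝ) ≤ t := Nat.floor_le ht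
    have htm : t < m + 1 := Nat.lt_floor_add_one t
    have hm1m : m1 + 1 ≤ m := Nat.le_floor (by push_cast; linarith)
    have hm_one : (1 : ℝ) ≤ m := by exact_mod_cast (by omega : 1 ≤ m)
    have h1 : φ t ≤ φ m := hA.rate_antitone (mem_Ici.2 (Nat.cast_nonneg m)) ht hmt
    have h2 := key m (by omega) (by omega)
    have hφt := hA.rate_nonneg ht
    have hφm := hA.rate_nonneg (Nat.cast_nonneg (α := ℝ) m)
    calc φ t ^ (p / γ) ≤ φ m ^ (p / γ) := Real.rpow_le_rpow hφt h1 (by positivity)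
      _ = (φ m ^ p) ^ (1 / γ) := by rw [← Real.rpow_mul hφm]; congr 1; ring
      _ ≤ (B' * (m : ℝ) ^ (-(3 * γ))) ^ (1 / γ) :=
        Real.rpow_le_rpow (Real.rpow_nonneg hφm _) h2 (by positivity)
      _ = B' ^ (1 / γ) * (m : ℝ) ^ (-3 : ℝ) := by
        rw [Real.mul_rpow hB'0 (by positivity), ← Real.rpow_mul (by positivity)]
        congr 2; field_simp
      _ ≤ B' ^ (1 / γ) * ((1 / 3 : ℝ) * (1 + t)) ^ (-3 : ℝ) := by
        refine mul_le_mul_of_nonneg_left ?_ (by positivity)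
        exact Real.rpow_le_rpow_of_nonpos (by positivity) (by linarith) (by norm_num)
      _ = C2 * (1 + t) ^ (-3 : ℝ) := by
        rw [Real.mul_rpow (by norm_num) (by positivity)]; ring
  · suffices φ t ^ (p / γ) ≤ C1 * (1 + t) ^ (-3 : ℝ) by nlinarith
    have h1 : φ t ≤ φ 0 := hA.rate_antitone (mem_Ici.2 le_rfl) ht ht
    have h2 : φ t ^ (p / γ) ≤ φ 0 ^ (p / γ) :=
      Real.rpow_le_rpow (hA.rate_nonneg ht) h1 (by positivity)
    have h3 : (1 + T) ^ (-3 : ℝ) ≤ (1 + t) ^ (-3 : ℝ) :=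
      Real.rpow_le_rpow_of_nonpos (by positivity) (by linarith) (by norm_num)
    have h4 : (1 + T) ^ (3 : ℝ) * (1 + T) ^ (-3 : ℝ) = 1 := by
      rw [← Real.rpow_add (by positivity)]; norm_num
    calc φ t ^ (p / γ) ≤ φ 0 ^ (p / γ) * ((1 + T) ^ (3 : ℝ) * (1 + T) ^ (-3 : ℝ)) := by
          rw [h4, mul_one]; exact h2
      _ ≤ φ 0 ^ (p / γ) * ((1 + T) ^ (3 : ℝ) * (1 + t) ^ (-3 : ℝ)) := by gcongr
      _ = C1 * (1 + t) ^ (-3 : ℝ) := by ring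

/-- Covariance of bounded functions of the field at two sites. -/
theorem ProcessAssumption.abs_covariance_le [IsProbabilityMeasure P]
    (hA : ProcessAssumption P X s h φ ψ γ κ) {g : ℝ → ℝ} (hg : Measurable g) {M : ℝ}
    (hM : ∀ z, |g z| ≤ M) (u v : Plane) :
    |cov[fun ω => g (X u ω), fun ω => g (X v ω); P]| ≤ 4 * M ^ 2 * (ψ 1 1 * φ ‖u - v‖) := by
  have hsig : ∀ w : Plane, fieldSigma X {w} = MeasurableSpace.comap (X w) inferInstance := by
    intro w; simp [fieldSigma]
  refine abs_covariance_le_of_mixing (hA.measurable u).comap_le (hA.measurable v).comap_le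
    (hg.comp (comap_measurable (X u))).stronglyMeasurable
    (hg.comp (comap_measurable (X v))).stronglyMeasurable (fun ω => hM _) (fun ω => hM _) ?_
  intro A B hAm hBm
  have := hA.mixing {u} {v} (Finset.singleton_nonempty _) (Finset.singleton_nonempty _) A B
    (by rw [hsig]; exact hAm) (by rw [hsig]; exact hBm)
  simp only [Finset.card_singleton] at this
  convert this using 3
  rw [setDist]
  have hp : ∀ p : {x // x ∈ ({u} : Finset Plane)} × {x // x ∈ ({v} : Finset Plane)},
      ‖(p.1 : Plane) - (p.2 : Plane)‖ = ‖u - v‖ := by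
    rintro ⟨⟨a, ha⟩, ⟨b, hb⟩⟩
    rw [Finset.mem_singleton] at ha hb
    simp only [ha, hb]
  have : Nonempty ({x // x ∈ ({u} : Finset Plane)} × {x // x ∈ ({v} : Finset Plane)}) :=
    ⟨(⟨u, by simp⟩, ⟨v, by simp⟩)⟩
  simp_rw [hp]
  rw [ciInf_const]

end Mixing

/-! ### Consequences of the sampling scheme. -/

section Spacing

variable {s : (n : ℕ) → Fin n → Plane}

/-- Two sites are required: for a single site the infimum over the empty family of neighbours is 0
by convention. -/
theorem DEISampling.infillGap_pos (hs : DEISampling s) {n : ℕ} (hn : 2 ≤ n) :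
    0 < infillGap (s n) := by
  have hn0 : 0 < n := by omega
  let j : Fin n := ⟨0, hn0⟩
  have : Nonempty {k : Fin n // k ≠ j} := ⟨⟨⟨1, by omega⟩, by simp [j, Fin.ext_iff]⟩⟩
  obtain ⟨k, hk⟩ := exists_eq_ciInf_of_finite (f := fun k : {k : Fin n // k ≠ j} => ‖s n k - s n j‖)
  have h1 : 0 < nearest (s n) j := by
    rw [nearest, ← hk]
    exact norm_pos_iff.2 (sub_ne_zero.2 fun h => k.2 (hs.distinct n h))
  exact h1.trans_le (le_ciSup (f := fun j => nearest (s n) j) (Set.finite_range _).bddAbove j)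

/-- The weighted numbers of sites around each site are of order `δ_n⁻²`. -/
theorem DEISampling.exists_sum_le (hs : DEISampling s) :
    ∃ C : ℝ, 0 < C ∧ ∀ᶠ n in atTop, 0 < infillGap (s n) ∧ infillGap (s n) ≤ 1 ∧ ∀ j : Fin n,
      ∑ k, (1 + ‖s n j - s n k‖) ^ (-3 : ℝ) ≤ C * infillGap (s n) ^ (-2 : ℝ) := by
  obtain ⟨C, hC, hpack⟩ := exists_sum_one_add_norm_le
  obtain ⟨c, hc, hsp⟩ := hs.spacing
  -- The half matches the separation 2ρ of the packing bound; the cap 1 ensures ρ ≤ 1 once the gap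
  -- is at most 1.
  set c' := min (c / 2) 1 with hc'
  have hc'0 : 0 < c' := by positivity
  refine ⟨C * c' ^ (-2 : ℝ), by positivity, ?_⟩
  filter_upwards [hsp, eventually_ge_atTop 2, hs.infill.eventually (eventually_le_nhds one_pos)]
    with n h1 h2 h3
  have hδ := hs.infillGap_pos h2
  refine ⟨hδ, h3, fun j => ?_⟩
  have h := hpack n (s n) (c' * infillGap (s n)) (by positivity) ?_ ?_ (s n j)
  · rw [Real.mul_rpow hc'0.le hδ.le, ← mul_assoc] at h
    simpa [norm_sub_rev] using h
  · calc c' * infillGap (s n) ≤ 1 * 1 := by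
          gcongr
          exact min_le_right _ _
      _ = 1 := one_mul 1
  · intro j k hjk
    have hle : nearest (s n) j ≤ ‖s n k - s n j‖ :=
      ciInf_le (f := fun k : {k : Fin n // k ≠ j} => ‖s n k - s n j‖)
        (Set.finite_range _).bddBelow ⟨k, hjk.symm⟩
    have h4 : c' ≤ c / 2 := min_le_left _ _
    have := h1 j
    nlinarith

end Spacing

/-! ### Bounded functions with bounded support. -/

/-- `g` is measurable, bounded by `M` and supported in `[-L, L]`. -/
structure LocalFun (g : ℝ → ℝ) (M L : ℝ) : Prop where
  measurable : Measurable g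
  bound : ∀ z, |g z| ≤ M
  support : ∀ z, L < |z| → g z = 0
  bound_nonneg : 0 ≤ M
  radius_nonneg : 0 ≤ L

namespace LocalFun

variable {g : ℝ → ℝ} {M L : ℝ}

theorem abs_le_indicator (hg : LocalFun g M L) (z : ℝ) :
    |g z| ≤ (Icc (-L) L).indicator (fun _ => M) z := by
  by_cases hz : z ∈ Icc (-L) L
  · rw [indicator_of_mem hz]; exact hg.bound z
  · rw [indicator_of_notMem hz, hg.support z, abs_zero]
    by_contra h
    exact hz (abs_le.1 (not_lt.1 h))

theorem integrable_majorant (M L : ℝ) :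
    Integrable ((Icc (-L) L).indicator fun _ : ℝ => M) :=
  (integrable_indicator_iff measurableSet_Icc).2 (by simp)

theorem integrable (hg : LocalFun g M L) : Integrable g :=
  (integrable_majorant M L).mono' hg.measurable.aestronglyMeasurable
    (ae_of_all _ fun z => by simpa using hg.abs_le_indicator z)

theorem integral_majorant (hg : LocalFun g M L) :
    ∫ z, (Icc (-L) L).indicator (fun _ : ℝ => M) z = 2 * L * M := by
  rw [integral_indicator measurableSet_Icc, setIntegral_const, measureReal_def, Real.volume_Icc,
    ENNReal.toReal_ofReal (by linarith [hg.radius_nonneg]), smul_eq_mul]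
  ring

theorem abs (hg : LocalFun g M L) : LocalFun (fun z => |g z|) M L where
  measurable := hg.measurable.abs
  bound z := by rw [abs_abs]; exact hg.bound z
  support z hz := by rw [hg.support z hz, abs_zero]
  bound_nonneg := hg.bound_nonneg
  radius_nonneg := hg.radius_nonneg

theorem sq (hg : LocalFun g M L) : LocalFun (fun z => g z ^ 2) (M ^ 2) L where
  measurable := hg.measurable.pow_const 2
  bound z := by rw [abs_pow]; exact pow_le_pow_left₀ (abs_nonneg _) (hg.bound z) 2
  support z hz := by rw [hg.support z hz]; norm_num
  bound_nonneg := sq_nonneg _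
  radius_nonneg := hg.radius_nonneg

theorem id_mul (hg : LocalFun g M L) : LocalFun (fun z => z * g z) (L * M) L where
  measurable := measurable_id.mul hg.measurable
  bound z := by
    rw [abs_mul]
    rcases le_or_gt |z| L with h | h
    · exact mul_le_mul h (hg.bound z) (abs_nonneg _) hg.radius_nonneg
    · rw [hg.support z h, abs_zero, mul_zero]
      exact mul_nonneg hg.radius_nonneg hg.bound_nonneg
  support z hz := by rw [hg.support z hz, mul_zero]
  bound_nonneg := mul_nonneg hg.radius_nonneg hg.bound_nonneg
  radius_nonneg := hg.radius_nonneg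

theorem sub_left (hg : LocalFun g M L) (u : ℝ) : LocalFun (fun z => g (u - z)) M (L + |u|) where
  measurable := hg.measurable.comp (measurable_const.sub measurable_id)
  bound z := hg.bound _
  support z hz := hg.support _ (by
    have := abs_sub_abs_le_abs_sub z u
    rw [abs_sub_comm] at this; linarith)
  bound_nonneg := hg.bound_nonneg
  radius_nonneg := add_nonneg hg.radius_nonneg (abs_nonneg _)

end LocalFun

theorem KernelAssumption.exists_localFun {K : ℝ → ℝ} (hK : KernelAssumption K) :
    ∃ M L : ℝ, LocalFun K M L := by
  obtain ⟨M, hM⟩ := hK.bounded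
  obtain ⟨L, hL⟩ := hK.bounded_support.exists_norm_le
  refine ⟨M, max L 0, hK.measurable, hM, fun z hz => ?_, (abs_nonneg _).trans (hM 0),
    le_max_right _ _⟩
  by_contra h
  have := hL z h
  rw [Real.norm_eq_abs] at this
  exact absurd ((le_max_left L 0).trans_lt hz) (not_lt.2 this)

/-! ### Moments and laws of large numbers for local sums. -/

section Average

variable {Ω : Type*} [MeasurableSpace Ω] {P : Measure Ω}
  {X V : Plane → Ω → ℝ} {s : (n : ℕ) → Fin n → Plane} {m σ f : ℝ → ℝ} {ν : Measure ℝ}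
  {I : Set ℝ} {ε : ℝ} {b h : ℕ → ℝ} {φ : ℝ → ℝ} {ψ : ℕ → ℕ → ℝ} {γ κ : ℝ}
  {g : ℝ → ℝ} {M L : ℝ}

theorem ModelAssumption.integral_comp (hX : ∀ u, Measurable (X u))
    (hA : ModelAssumption P X V s m σ f ν I ε κ)
    (hg : Measurable g) (u : Plane) (x : ℝ) {β : ℝ} (hβ : 0 < β) :
    ∫ ω, g ((X u ω - x) / β) ∂P = β * ∫ z, g z * f (x + β * z) := by
  have hgm : Measurable fun y => g ((y - x) / β) :=
    hg.comp ((measurable_id.sub_const x).div_const β)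
  rw [← integral_map (f := fun y => g ((y - x) / β)) (hX u).aemeasurable hgm.aestronglyMeasurable,
    hA.f_density u, integral_withDensity_eq_integral_toReal_smul
      hA.f_measurable.ennreal_ofReal (ae_of_all _ fun _ => ENNReal.ofReal_lt_top)]
  set F : ℝ → ℝ := fun y => f (x + y) * g (y / β) with hF
  have h1 := Measure.integral_comp_mul_left F β
  have h2 : ∫ y, F y = ∫ y, (ENNReal.ofReal (f y)).toReal • g ((y - x) / β) := by
    rw [← integral_add_left_eq_self (fun y => (ENNReal.ofReal (f y)).toReal • g ((y - x) / β)) x]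
    refine integral_congr_ae (ae_of_all _ fun y => ?_)
    simp [hF, ENNReal.toReal_ofReal (hA.f_nonneg _)]
  rw [← h2]
  rw [abs_of_pos (inv_pos.2 hβ), smul_eq_mul] at h1
  have h3 : ∫ z, g z * f (x + β * z) = ∫ z, F (β * z) := by
    refine integral_congr_ae (ae_of_all _ fun y => ?_)
    simp only [hF, mul_div_cancel_left₀ _ hβ.ne']
    ring
  rw [h3, h1]
  field_simp

theorem ModelAssumption.integral_abs_le (hX : ∀ u, Measurable (X u))
    (hA : ModelAssumption P X V s m σ f ν I ε κ) :
    ∃ C : ℝ, 0 ≤ C ∧ ∀ (g : ℝ → ℝ) (M L : ℝ), LocalFun g M L → ∀ (u : Plane) (x β : ℝ), 0 < β →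
      ∫ ω, |g ((X u ω - x) / β)| ∂P ≤ C * (2 * L * M) * β := by
  obtain ⟨C, hC⟩ := hA.f_bounded
  have hC0 : 0 ≤ C := (hA.f_nonneg 0).trans (hC 0)
  refine ⟨C, hC0, fun g M L hg u x β hβ => ?_⟩
  have h0 := hA.integral_comp hX hg.abs.measurable u x hβ
  rw [h0, mul_comm]
  refine mul_le_mul_of_nonneg_right ?_ hβ.le
  rw [← hg.integral_majorant, ← integral_const_mul]
  refine integral_mono_of_nonneg (ae_of_all _ fun z => mul_nonneg (abs_nonneg _) (hA.f_nonneg _))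
    ((LocalFun.integrable_majorant M L).const_mul C) (ae_of_all _ fun z => ?_)
  have := mul_le_mul (hg.abs_le_indicator z) (hC (x + β * z)) (hA.f_nonneg _)
    ((abs_nonneg _).trans (hg.abs_le_indicator z))
  simp only
  linarith

/-- The product vanishes unless both values lie in a square of side 2Lβ centred at (x, x), and a
bounded joint density gives that square probability O(β²). -/
theorem ModelAssumption.integral_abs_mul_le [IsProbabilityMeasure P] (hX : ∀ u, Measurable (X u))
    (hA : ModelAssumption P X V s m σ f ν I ε κ) :
    ∃ C : ℝ, 0 ≤ C ∧ ∀ (g : ℝ → ℝ) (M L : ℝ), LocalFun g M L →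
      ∀ (n : ℕ) (j k : Fin n), j ≠ k → ∀ (x β : ℝ), 0 < β →
      ∫ ω, |g ((X (s n j) ω - x) / β) * g ((X (s n k) ω - x) / β)| ∂P
        ≤ C * (2 * L * M) ^ 2 * β ^ 2 := by
  obtain ⟨C, hC⟩ := hA.joint_density
  refine ⟨C, C.2, fun g M L hg n j k hjk x β hβ => ?_⟩
  have hL := hg.radius_nonneg
  set τ : Fin 2 → Fin n := ![j, k] with hτ
  have hτi : Function.Injective τ := by
    intro a b hab
    fin_cases a <;> fin_cases b <;> simp_all
  obtain ⟨d, -, hdC, hd⟩ := hC n 2 le_rfl (by norm_num) τ hτi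
  set box : Set (Fin 2 → ℝ) := Icc (fun _ => x - L * β) (fun _ => x + L * β) with hbox
  have hXτ : Measurable fun ω i => X (s n (τ i)) ω := measurable_pi_lambda _ fun i => hX _
  set B : Set Ω := (fun ω i => X (s n (τ i)) ω) ⁻¹' box with hB
  have hBm : MeasurableSet B := hXτ measurableSet_Icc
  have hPB : P.real B ≤ C * (2 * L * β) ^ 2 := by
    rw [measureReal_def, hB, ← Measure.map_apply hXτ measurableSet_Icc, hd,
      withDensity_apply _ measurableSet_Icc]
    have h1 : ∫⁻ z in box, d z ≤ C * ENNReal.ofReal ((2 * L * β) ^ 2) := by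
      refine (lintegral_mono hdC).trans (le_of_eq ?_)
      rw [lintegral_const, Measure.restrict_apply_univ, hbox, Real.volume_Icc_pi]
      congr 1
      simp only [Fin.prod_univ_two]
      rw [← ENNReal.ofReal_mul (by nlinarith [mul_nonneg hL hβ.le])]
      congr 1; ring
    refine (ENNReal.toReal_mono (by finiteness) h1).trans (le_of_eq ?_)
    rw [ENNReal.toReal_mul, ENNReal.toReal_ofReal (by positivity)]
    rfl
  have hin : ∀ y, L * β < |y - x| → g ((y - x) / β) = 0 := by
    intro y hy
    refine hg.support _ ?_
    rw [abs_div, abs_of_pos hβ, lt_div_iff₀ hβ]; exact hy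
  calc ∫ ω, |g ((X (s n j) ω - x) / β) * g ((X (s n k) ω - x) / β)| ∂P
      ≤ ∫ ω, B.indicator (fun _ => M ^ 2) ω ∂P := by
        refine integral_mono_of_nonneg (ae_of_all _ fun ω => abs_nonneg _)
          ((integrable_const _).indicator hBm) (ae_of_all _ fun ω => ?_)
        by_cases hω : ω ∈ B
        · simp only [indicator_of_mem hω, abs_mul, _root_.sq]
          exact mul_le_mul (hg.bound _) (hg.bound _) (abs_nonneg _) hg.bound_nonneg
        · simp only [indicator_of_notMem hω]
          have : L * β < |X (s n j) ω - x| ∨ L * β < |X (s n k) ω - x| := by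
            by_contra hcon
            push Not at hcon
            refine hω ?_
            rw [abs_le, abs_le] at hcon
            simp only [hB, hbox, mem_preimage, mem_Icc, Pi.le_def]
            refine ⟨fun i => ?_, fun i => ?_⟩ <;> fin_cases i <;> simp [hτ] <;> linarith
          rcases this with h1 | h1 <;> simp [hin _ h1]
    _ = P.real B * M ^ 2 := by
        rw [integral_indicator hBm, setIntegral_const, smul_eq_mul]
    _ ≤ C * (2 * L * β) ^ 2 * M ^ 2 := mul_le_mul_of_nonneg_right hPB (sq_nonneg _)
    _ = C * (2 * L * M) ^ 2 * β ^ 2 := by ring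

/-- The variance of a local sum is of the order of its number of terms. -/
theorem exists_variance_sum_le [IsProbabilityMeasure P] (hs : DEISampling s)
    (hA1 : ProcessAssumption P X s h φ ψ γ κ) (hA2 : BandwidthAssumption s b h γ κ)
    (hA4 : ModelAssumption P X V s m σ f ν I ε κ) (hg : LocalFun g M L) (x : ℝ) {β : ℕ → ℝ}
    (hβ0 : ∀ n, 0 < β n) {c : ℝ} (hβ : ∀ n, β n ≤ c * (b n + h n)) :
    ∃ C : ℝ, 0 ≤ C ∧ ∀ᶠ n in atTop,
      Var[fun ω => ∑ j, g ((X (s n j) ω - x) / β n); P] ≤ C * (n * β n) := by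
  set θ := κ / (2 + κ) / γ with hθ
  have hθ2 := hA1.two_exponent_lt
  have hγ := hA1.gamma_pos
  have hθ0 : 0 < θ := div_pos hA1.exponent_pos (by linarith)
  obtain ⟨C1, hC1, hE⟩ := hA4.integral_abs_le hA1.measurable
  obtain ⟨C2, hC2, hEE⟩ := hA4.integral_abs_mul_le hA1.measurable
  obtain ⟨C3, hC3, hφ⟩ := hA1.rate_le
  obtain ⟨C4, hC4, hpack⟩ := hs.exists_sum_le
  set D1 := C2 * (2 * L * M) ^ 2 + (C1 * (2 * L * M)) ^ 2 with hD1
  have hD10 : 0 ≤ D1 := by positivity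
  set D2 := 4 * M ^ 2 * ψ 1 1 with hD2
  have hD20 : 0 ≤ D2 := by have := hA1.card_nonneg 1 1; positivity
  set c1 := max c 0 with hc1
  set D3 := D1 ^ (1 - θ) * D2 ^ θ * C3 * C4 * c1 ^ (1 - 2 * θ) with hD3
  have hM0 := hg.bound_nonneg
  have hL0 := hg.radius_nonneg
  refine ⟨M * (C1 * (2 * L * M)) + D3, by positivity, ?_⟩
  filter_upwards [hpack, hA2.gap.eventually (eventually_le_nhds one_pos), eventually_ge_atTop 1]
    with n ⟨hδ, hδ1, hsum⟩ hgap hn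
  have hn0 : (0 : ℝ) < n := by exact_mod_cast hn
  have hβn := hβ0 n
  set δ := infillGap (s n) with hδdef
  set ξ : Fin n → Ω → ℝ := fun j ω => g ((X (s n j) ω - x) / β n) with hξ
  have hξm : ∀ j, Measurable (ξ j) := fun j =>
    hg.measurable.comp (((hA1.measurable _).sub_const x).div_const _)
  have hξL : ∀ j, MemLp (ξ j) 2 P := fun j =>
    MemLp.of_bound (hξm j).aestronglyMeasurable M (ae_of_all _ fun ω => hg.bound _)
  have hξi : ∀ j, Integrable (ξ j) P := fun j => (hξL j).integrable (by norm_num)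
  have hdiag : ∀ j, cov[ξ j, ξ j; P] ≤ M * (C1 * (2 * L * M)) * β n := by
    intro j
    rw [covariance_self (hξm j).aemeasurable]
    refine (variance_le_expectation_sq (hξm j).aestronglyMeasurable).trans ?_
    calc ∫ ω, (ξ j ^ 2) ω ∂P ≤ ∫ ω, M * |ξ j ω| ∂P := by
          refine integral_mono_of_nonneg (ae_of_all _ fun ω => by simp; positivity)
            ((hξi j).abs.const_mul M) (ae_of_all _ fun ω => ?_)
          simp only [Pi.pow_apply]
          rw [← sq_abs, _root_.sq]
          exact mul_le_mul_of_nonneg_right (hg.bound _) (abs_nonneg _)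
      _ ≤ M * (C1 * (2 * L * M) * β n) := by
          rw [integral_const_mul]
          exact mul_le_mul_of_nonneg_left (hE g M L hg _ x _ hβn) hM0
      _ = _ := by ring
  -- The density bound `ha` and the mixing bound `hb'` are interpolated geometrically with exponents
  -- 1 - θ and θ.
  have hoff : ∀ j k, j ≠ k → cov[ξ j, ξ k; P] ≤
      (D1 ^ (1 - θ) * D2 ^ θ * C3 * (β n) ^ (2 - 2 * θ)) * (1 + ‖s n j - s n k‖) ^ (-3 : ℝ) := by
    intro j k hjk
    have ha : |cov[ξ j, ξ k; P]| ≤ D1 * β n ^ 2 := by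
      rw [covariance_eq_sub (hξL j) (hξL k)]
      refine (abs_sub _ _).trans ?_
      have h1 : |∫ ω, (ξ j * ξ k) ω ∂P| ≤ C2 * (2 * L * M) ^ 2 * β n ^ 2 :=
        abs_integral_le_integral_abs.trans (hEE g M L hg n j k hjk x _ hβn)
      have h2 : ∀ i, |∫ ω, ξ i ω ∂P| ≤ C1 * (2 * L * M) * β n := fun i =>
        abs_integral_le_integral_abs.trans (hE g M L hg _ x _ hβn)
      rw [abs_mul]
      have h3 := mul_le_mul (h2 j) (h2 k) (abs_nonneg _) (by positivity)
      rw [hD1]; nlinarith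
    have hb' : |cov[ξ j, ξ k; P]| ≤ D2 * φ ‖s n j - s n k‖ := by
      have := hA1.abs_covariance_le (g := fun y => g ((y - x) / β n))
        (hg.measurable.comp ((measurable_id.sub_const x).div_const _)) (fun z => hg.bound _)
        (s n j) (s n k)
      rw [hD2]; convert this using 1; ring
    have hφ0 := hA1.rate_nonneg (norm_nonneg (s n j - s n k))
    set a := |cov[ξ j, ξ k; P]| with haa
    have ha0 : 0 ≤ a := abs_nonneg _
    calc cov[ξ j, ξ k; P] ≤ a := le_abs_self _
      _ = a ^ (1 - θ) * a ^ θ := by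
        rw [← Real.rpow_add_of_nonneg ha0 (by linarith) hθ0.le]
        simp
      _ ≤ (D1 * β n ^ 2) ^ (1 - θ) * (D2 * φ ‖s n j - s n k‖) ^ θ := by
        refine mul_le_mul (Real.rpow_le_rpow ha0 ha (by linarith))
          (Real.rpow_le_rpow ha0 hb' hθ0.le) (by positivity) (by positivity)
      _ = D1 ^ (1 - θ) * (β n) ^ (2 - 2 * θ) * (D2 ^ θ * φ ‖s n j - s n k‖ ^ θ) := by
        rw [Real.mul_rpow hD10 (by positivity), Real.mul_rpow hD20 hφ0, ← Real.rpow_natCast,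
          ← Real.rpow_mul hβn.le]
        congr 3; push_cast; ring
      _ ≤ D1 ^ (1 - θ) * (β n) ^ (2 - 2 * θ) *
          (D2 ^ θ * (C3 * (1 + ‖s n j - s n k‖) ^ (-3 : ℝ))) := by
        gcongr
        exact hφ _ (norm_nonneg _)
      _ = _ := by ring
  have hrow : ∀ j, ∑ k, cov[ξ j, ξ k; P] ≤ (M * (C1 * (2 * L * M)) + D3) * β n := by
    intro j
    have hle : ∀ k, cov[ξ j, ξ k; P] ≤ (if j = k then M * (C1 * (2 * L * M)) * β n else 0) +
        (D1 ^ (1 - θ) * D2 ^ θ * C3 * (β n) ^ (2 - 2 * θ)) *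
          (1 + ‖s n j - s n k‖) ^ (-3 : ℝ) := by
      intro k
      by_cases hjk : j = k
      · subst hjk
        rw [if_pos rfl]
        have : 0 ≤ (D1 ^ (1 - θ) * D2 ^ θ * C3 * (β n) ^ (2 - 2 * θ)) *
          (1 + ‖s n j - s n j‖) ^ (-3 : ℝ) := by positivity
        linarith [hdiag j]
      · rw [if_neg hjk, zero_add]
        exact hoff j k hjk
    refine (Finset.sum_le_sum fun k _ => hle k).trans ?_
    rw [Finset.sum_add_distrib, Finset.sum_ite_eq Finset.univ j, if_pos (Finset.mem_univ _),
      ← Finset.mul_sum, add_mul]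
    refine add_le_add le_rfl ?_
    have hbh : 0 < b n + h n := add_pos (hA2.b_pos n) (hA2.h_pos n)
    have h1 : (β n) ^ (1 - 2 * θ) ≤ c1 ^ (1 - 2 * θ) * (b n + h n) ^ (1 - 2 * θ) := by
      rw [← Real.mul_rpow (le_max_right _ _) hbh.le]
      refine Real.rpow_le_rpow hβn.le ((hβ n).trans ?_) (by linarith)
      exact mul_le_mul_of_nonneg_right (le_max_left _ _) hbh.le
    -- As δ ≤ 1, the packing factor is below the power of δ in the bandwidth condition; the
    -- remaining power of `β n` is absorbed by that condition.
    have h2 : δ ^ (-2 : ℝ) ≤ δ ^ (-(2 + 2 / γ)) := by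
      refine Real.rpow_le_rpow_of_exponent_ge hδ hδ1 ?_
      have : 0 < 2 / γ := by positivity
      linarith
    have h3 : δ ^ (-(2 + 2 / γ)) * (b n + h n) ^ (1 - 2 * θ) ≤ 1 := by
      have e : 2 * κ / ((2 + κ) * γ) = 2 * θ := by rw [hθ, div_div]; ring
      rwa [e] at hgap
    have h4 : (β n) ^ (2 - 2 * θ) = β n * (β n) ^ (1 - 2 * θ) := by
      rw [← Real.rpow_one_add' hβn.le (by linarith)]
      congr 1; ring
    calc D1 ^ (1 - θ) * D2 ^ θ * C3 * (β n) ^ (2 - 2 * θ) *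
          ∑ k, (1 + ‖s n j - s n k‖) ^ (-3 : ℝ)
        ≤ D1 ^ (1 - θ) * D2 ^ θ * C3 * (β n) ^ (2 - 2 * θ) * (C4 * δ ^ (-(2 + 2 / γ))) := by
          refine mul_le_mul_of_nonneg_left ((hsum j).trans ?_) (by positivity)
          exact mul_le_mul_of_nonneg_left h2 hC4.le
      _ = D1 ^ (1 - θ) * D2 ^ θ * C3 * C4 * β n *
          (δ ^ (-(2 + 2 / γ)) * (β n) ^ (1 - 2 * θ)) := by rw [h4]; ring
      _ ≤ D1 ^ (1 - θ) * D2 ^ θ * C3 * C4 * β n * (δ ^ (-(2 + 2 / γ)) *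
          (c1 ^ (1 - 2 * θ) * (b n + h n) ^ (1 - 2 * θ))) := by gcongr
      _ = D3 * β n * (δ ^ (-(2 + 2 / γ)) * (b n + h n) ^ (1 - 2 * θ)) := by rw [hD3]; ring
      _ ≤ D3 * β n * 1 := by gcongr
      _ = D3 * β n := mul_one _
  rw [← covariance_self (Finset.measurable_sum _ fun j _ => hξm j).aemeasurable,
    covariance_fun_sum_fun_sum hξL hξL]
  refine (Finset.sum_le_sum fun j _ => hrow j).trans (le_of_eq ?_)
  rw [Finset.sum_const, Finset.card_univ, Fintype.card_fin, nsmul_eq_mul]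
  ring

theorem memLp_local_sum [IsProbabilityMeasure P] (hX : ∀ u, Measurable (X u))
    (hg : LocalFun g M L) (x : ℝ) (n : ℕ) (β : ℝ) :
    MemLp (fun ω => ∑ j, g ((X (s n j) ω - x) / β)) 2 P :=
  memLp_finsetSum _ fun _ _ => MemLp.of_bound
    (hg.measurable.comp (((hX _).sub_const x).div_const _)).aestronglyMeasurable M
    (ae_of_all _ fun _ => hg.bound _)

theorem integral_local_sum [IsProbabilityMeasure P] (hX : ∀ u, Measurable (X u))
    (hA : ModelAssumption P X V s m σ f ν I ε κ) (hg : LocalFun g M L) (x : ℝ) (n : ℕ) {β : ℝ}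
    (hβ : 0 < β) :
    ∫ ω, ∑ j, g ((X (s n j) ω - x) / β) ∂P = n * β * ∫ z, g z * f (x + β * z) := by
  rw [integral_finsetSum]
  · simp_rw [hA.integral_comp hX hg.measurable _ x hβ]
    rw [Finset.sum_const, Finset.card_univ, Fintype.card_fin, nsmul_eq_mul]
    ring
  · exact fun j _ => Integrable.of_bound
      (hg.measurable.comp (((hX _).sub_const x).div_const _)).aestronglyMeasurable M
      (ae_of_all _ fun ω => hg.bound _)

/-- Law of large numbers for local averages. -/
theorem tendsto_local_average [IsProbabilityMeasure P] (hs : DEISampling s)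
    (hA1 : ProcessAssumption P X s h φ ψ γ κ) (hA2 : BandwidthAssumption s b h γ κ)
    (hA4 : ModelAssumption P X V s m σ f ν I ε κ) (hg : LocalFun g M L) {x : ℝ}
    (hfx : ContinuousAt f x) {β : ℕ → ℝ} (hβ0 : ∀ n, 0 < β n) {c : ℝ}
    (hβ : ∀ n, β n ≤ c * (b n + h n)) (hβt : Tendsto β atTop (𝓝 0))
    (hnβ : Tendsto (fun n : ℕ => n * β n) atTop atTop) :
    Tendsto (fun p : ℕ × Ω => ((p.1 : ℝ) * β p.1)⁻¹ * ∑ j, g ((X (s p.1 j) p.2 - x) / β p.1))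
      (whp P) (𝓝 (f x * ∫ z, g z)) := by
  refine tendsto_whp_of_variance
    (Z := fun n ω => ((n : ℝ) * β n)⁻¹ * ∑ j, g ((X (s n j) ω - x) / β n))
    (fun n => (memLp_local_sum hA1.measurable hg x n _).const_mul _) ?_ ?_
  · have h1 : Tendsto (fun n => ∫ z, g z * f (x + β n * z)) atTop (𝓝 (f x * ∫ z, g z)) := by
      rw [mul_comm, ← integral_mul_const]
      obtain ⟨C, hC⟩ := hA4.f_bounded
      refine tendsto_integral_of_dominated_convergence
        (fun z => C * (Icc (-L) L).indicator (fun _ : ℝ => M) z)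
        (fun n => (hg.measurable.mul (hA4.f_measurable.comp
          ((measurable_id.const_mul _).const_add _))).aestronglyMeasurable)
        ((LocalFun.integrable_majorant M L).const_mul C)
        (fun n => ae_of_all _ fun z => ?_) (ae_of_all _ fun z => ?_)
      · rw [Real.norm_eq_abs, abs_mul, abs_of_nonneg (hA4.f_nonneg _), mul_comm]
        exact mul_le_mul (hC _) (hg.abs_le_indicator z) (abs_nonneg _)
          ((hA4.f_nonneg 0).trans (hC 0))
      · refine Tendsto.const_mul _ (hfx.tendsto.comp ?_)
        have := (hβt.mul_const z).const_add x
        simpa using this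
    refine h1.congr' ?_
    filter_upwards [eventually_gt_atTop 0] with n hn
    rw [integral_const_mul, integral_local_sum hA1.measurable hA4 hg x n (hβ0 n)]
    have : (n : ℝ) * β n ≠ 0 := mul_ne_zero (by positivity) (hβ0 n).ne'
    rw [← mul_assoc, inv_mul_cancel₀ this, one_mul]
  · obtain ⟨C, hC, hvar⟩ := exists_variance_sum_le hs hA1 hA2 hA4 hg x hβ0 hβ
    have h1 : Tendsto (fun n : ℕ => C * ((n : ℝ) * β n)⁻¹) atTop (𝓝 0) := by
      simpa using (tendsto_inv_atTop_zero.comp hnβ).const_mul C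
    refine squeeze_zero' (Eventually.of_forall fun n => variance_nonneg _ _) ?_ h1
    filter_upwards [hvar, eventually_gt_atTop 0] with n hn hn0
    have : (0 : ℝ) < n * β n := mul_pos (by exact_mod_cast hn0) (hβ0 n)
    rw [variance_const_mul]
    calc ((n : ℝ) * β n)⁻¹ ^ 2 * _ ≤ ((n : ℝ) * β n)⁻¹ ^ 2 * (C * (n * β n)) := by gcongr
      _ = _ := by field_simp

/-- Local sums of centred kernels are of smaller order than `β⁻¹ √(n β)`. -/
theorem tendsto_centred_local_sum [IsProbabilityMeasure P] (hs : DEISampling s)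
    (hA1 : ProcessAssumption P X s h φ ψ γ κ) (hA2 : BandwidthAssumption s b h γ κ)
    (hA4 : ModelAssumption P X V s m σ f ν I ε κ) (hg : LocalFun g M L)
    (hg0 : ∫ z, g z = 0) {x r Λ : ℝ} (hr : 0 < r)
    (hfx : ∀ y, |y - x| ≤ r → |f y - f x| ≤ Λ * |y - x|) {β : ℕ → ℝ} (hβ0 : ∀ n, 0 < β n) {c : ℝ}
    (hβ : ∀ n, β n ≤ c * (b n + h n)) (hβt : Tendsto β atTop (𝓝 0))
    (hnβ : Tendsto (fun n : ℕ => n * β n ^ 5) atTop (𝓝 0)) :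
    Tendsto (fun p : ℕ × Ω => (√((p.1 : ℝ) * β p.1))⁻¹ * β p.1 *
      ∑ j, g ((X (s p.1 j) p.2 - x) / β p.1)) (whp P) (𝓝 0) := by
  have hL0 := hg.radius_nonneg
  have hM0 := hg.bound_nonneg
  refine tendsto_whp_of_variance
    (Z := fun n ω => (√((n : ℝ) * β n))⁻¹ * β n * ∑ j, g ((X (s n j) ω - x) / β n))
    (fun n => (memLp_local_sum hA1.measurable hg x n _).const_mul _) ?_ ?_
  · have h1 : Tendsto (fun n : ℕ => (2 * L * M * (|Λ| * L)) * √(n * β n ^ 5)) atTop (𝓝 0) := by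
      have := (hnβ.sqrt).const_mul (2 * L * M * (|Λ| * L))
      simpa using this
    refine squeeze_zero_norm' ?_ h1
    have h2 : ∀ᶠ n in atTop, L * β n < r := by
      have := hβt.const_mul L
      rw [mul_zero] at this
      exact this.eventually (eventually_lt_nhds hr)
    filter_upwards [eventually_gt_atTop 0, h2] with n hn hn2
    have hn0 : (0 : ℝ) < n := by exact_mod_cast hn
    have hβn := hβ0 n
    rw [integral_const_mul, integral_local_sum hA1.measurable hA4 hg x n (hβ0 n)]
    have h3 : |∫ z, g z * f (x + β n * z)| ≤ 2 * L * M * (|Λ| * L) * β n := by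
      -- Since `g` integrates to zero, only increments of `f` count, and they are O(β). The scaled
      -- mean is then of order √(nβ) β² = √(nβ⁵).
      have h4 : ∫ z, g z * f (x + β n * z) = ∫ z, g z * (f (x + β n * z) - f x) := by
        obtain ⟨C, hC⟩ := hA4.f_bounded
        have hi : Integrable fun z => g z * f (x + β n * z) :=
          hg.integrable.mul_bdd (c := C) (hA4.f_measurable.comp
            ((measurable_id.const_mul _).const_add _)).aestronglyMeasurable
            (ae_of_all _ fun z => by
              rw [Real.norm_eq_abs, abs_of_nonneg (hA4.f_nonneg _)]; exact hC _)
        simp_rw [mul_sub]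
        rw [integral_sub hi (hg.integrable.mul_const _), integral_mul_const, hg0]
        simp
      rw [h4]
      refine abs_integral_le_integral_abs.trans ?_
      have e : 2 * L * M * (|Λ| * L) * β n =
          ∫ z, (Icc (-L) L).indicator (fun _ : ℝ => M) z * (|Λ| * L * β n) := by
        rw [integral_mul_const, hg.integral_majorant]; ring
      rw [e]
      refine integral_mono_of_nonneg (ae_of_all _ fun z => abs_nonneg _)
        ((LocalFun.integrable_majorant M L).mul_const _) (ae_of_all _ fun z => ?_)
      simp only [abs_mul]
      have hi0 := (abs_nonneg _).trans (hg.abs_le_indicator z)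
      rcases le_or_gt |z| L with hz | hz
      · refine mul_le_mul (hg.abs_le_indicator z) ?_ (abs_nonneg _) hi0
        have h5 : |x + β n * z - x| = β n * |z| := by
          rw [add_sub_cancel_left, abs_mul, abs_of_pos hβn]
        have h6 : β n * |z| ≤ L * β n := by
          rw [mul_comm]; exact mul_le_mul_of_nonneg_right hz hβn.le
        have h7 := hfx (x + β n * z) (by rw [h5]; linarith)
        rw [h5] at h7
        calc |f (x + β n * z) - f x| ≤ Λ * (β n * |z|) := h7
          _ ≤ |Λ| * (L * β n) :=
            mul_le_mul (le_abs_self _) h6 (by positivity) (abs_nonneg _)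
          _ = |Λ| * L * β n := by ring
      · rw [hg.support z hz, abs_zero, zero_mul]
        positivity
    have hsq : √((n : ℝ) * β n) * √((n : ℝ) * β n) = n * β n := Real.mul_self_sqrt (by positivity)
    have hsq5 : √((n : ℝ) * β n ^ 5) = √((n : ℝ) * β n) * β n ^ 2 := by
      rw [show (n : ℝ) * β n ^ 5 = (n * β n) * (β n ^ 2) ^ 2 by ring,
        Real.sqrt_mul (by positivity), Real.sqrt_sq (by positivity)]
    have hspos : 0 < √((n : ℝ) * β n) := Real.sqrt_pos.2 (by positivity)
    rw [Real.norm_eq_abs, abs_mul, abs_mul ((n : ℝ) * β n),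
      abs_of_pos (by positivity : (0:ℝ) < n * β n),
      abs_of_pos (by positivity : 0 < (√((n : ℝ) * β n))⁻¹ * β n), hsq5]
    calc (√((n : ℝ) * β n))⁻¹ * β n * (n * β n * |∫ z, g z * f (x + β n * z)|)
        ≤ (√((n : ℝ) * β n))⁻¹ * β n * (n * β n * (2 * L * M * (|Λ| * L) * β n)) := by gcongr
      _ = (√((n : ℝ) * β n))⁻¹ * β n * ((√((n : ℝ) * β n) * √((n : ℝ) * β n)) *
          (2 * L * M * (|Λ| * L) * β n)) := by rw [hsq]
      _ = _ := by field_simp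
  · obtain ⟨C, hC, hvar⟩ := exists_variance_sum_le hs hA1 hA2 hA4 hg x hβ0 hβ
    have h1 : Tendsto (fun n : ℕ => C * β n ^ 2) atTop (𝓝 0) := by
      simpa using (hβt.pow 2).const_mul C
    refine squeeze_zero' (Eventually.of_forall fun n => variance_nonneg _ _) ?_ h1
    filter_upwards [hvar, eventually_gt_atTop 0] with n hn hn0
    have hpos : (0 : ℝ) < n * β n := mul_pos (by exact_mod_cast hn0) (hβ0 n)
    have hsq : √((n : ℝ) * β n) ^ 2 = n * β n := Real.sq_sqrt hpos.le
    rw [variance_const_mul, mul_pow, inv_pow, hsq]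
    calc ((n : ℝ) * β n)⁻¹ * β n ^ 2 * _ ≤ ((n : ℝ) * β n)⁻¹ * β n ^ 2 * (C * (n * β n)) := by
          gcongr
      _ = (((n : ℝ) * β n)⁻¹ * (n * β n)) * (C * β n ^ 2) := by ring
      _ = _ := by rw [inv_mul_cancel₀ hpos.ne', one_mul]

end Average

/-! ### Lower envelopes of the kernel. -/

section Envelope

/-- Lower envelope of `K` over the open intervals of radius `t`. -/
noncomputable def lowerEnv (K : ℝ → ℝ) (t z : ℝ) : ℝ := sInf (K '' Metric.ball z t)

variable {K : ℝ → ℝ} {M L t : ℝ}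

theorem LocalFun.bddBelow_image (hK : LocalFun K M L) (S : Set ℝ) : BddBelow (K '' S) :=
  ⟨-M, by rintro _ ⟨z, -, rfl⟩; exact (abs_le.1 (hK.bound z)).1⟩

theorem lowerEnv_le (hK : LocalFun K M L) {z z' : ℝ} (h : |z' - z| < t) :
    lowerEnv K t z ≤ K z' :=
  csInf_le (hK.bddBelow_image _) ⟨z', by rwa [Metric.mem_ball, Real.dist_eq], rfl⟩

/-- An infimum over open balls is upper semicontinuous whatever `K` is: its strict sublevel sets are
unions of open balls. This gives measurability. -/
theorem LocalFun.lowerEnv (hK : LocalFun K M L) (ht : 0 < t) :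
    LocalFun (lowerEnv K t) M (L + t) where
  measurable := by
    refine measurable_of_Iio fun a => IsOpen.measurableSet ?_
    have : SpatialReg.lowerEnv K t ⁻¹' Iio a = ⋃ z' ∈ {z' | K z' < a}, Metric.ball z' t := by
      ext z
      have hne : (K '' Metric.ball z t).Nonempty :=
        ⟨_, mem_image_of_mem K (Metric.mem_ball_self ht)⟩
      simp only [SpatialReg.lowerEnv, mem_preimage, mem_Iio,
        csInf_lt_iff (hK.bddBelow_image _) hne, mem_iUnion, exists_prop, mem_ofPred_eq,
        exists_mem_image]
      constructor
      · rintro ⟨z', h1, h2⟩; exact ⟨z', h2, Metric.mem_ball_comm.1 h1⟩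
      · rintro ⟨z', h1, h2⟩; exact ⟨z', Metric.mem_ball_comm.1 h2, h1⟩
    rw [this]
    exact isOpen_biUnion fun _ _ => Metric.isOpen_ball
  bound z := by
    have hne : (K '' Metric.ball z t).Nonempty := ⟨_, mem_image_of_mem K (Metric.mem_ball_self ht)⟩
    refine abs_le.2 ⟨le_csInf hne ?_, ?_⟩
    · rintro _ ⟨z', -, rfl⟩; exact (abs_le.1 (hK.bound z')).1
    · exact (lowerEnv_le hK (by simpa using ht)).trans (abs_le.1 (hK.bound z)).2
  support z hz := by
    have : K '' Metric.ball z t = {0} := by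
      refine eq_singleton_iff_nonempty_unique_mem.2
        ⟨⟨_, mem_image_of_mem K (Metric.mem_ball_self ht)⟩, ?_⟩
      rintro _ ⟨z', h, rfl⟩
      refine hK.support _ ?_
      rw [Metric.mem_ball, Real.dist_eq] at h
      have h1 := abs_sub_abs_le_abs_sub z z'
      rw [abs_sub_comm] at h1
      linarith
    rw [SpatialReg.lowerEnv, this, csInf_singleton]
  bound_nonneg := hK.bound_nonneg
  radius_nonneg := add_nonneg hK.radius_nonneg ht.le

theorem tendsto_lowerEnv (hK : LocalFun K M L) {z : ℝ} (hz : ContinuousAt K z) {τ : ℕ → ℝ}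
    (hτ0 : ∀ k, 0 < τ k) (hτ : Tendsto τ atTop (𝓝 0)) :
    Tendsto (fun k => lowerEnv K (τ k) z) atTop (𝓝 (K z)) := by
  refine Metric.tendsto_nhds.2 fun e he => ?_
  obtain ⟨δ, hδ, hd⟩ := Metric.continuousAt_iff.1 hz (e / 2) (by linarith)
  filter_upwards [hτ.eventually (eventually_lt_nhds hδ)] with k hk
  have h1 : lowerEnv K (τ k) z ≤ K z := lowerEnv_le hK (by simpa using hτ0 k)
  have h2 : K z - e / 2 ≤ lowerEnv K (τ k) z := by
    refine le_csInf ⟨_, mem_image_of_mem K (Metric.mem_ball_self (hτ0 k))⟩ ?_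
    rintro _ ⟨z', h, rfl⟩
    have := hd ((Metric.mem_ball.1 h).trans hk)
    rw [Real.dist_eq, abs_lt] at this
    linarith
  rw [Real.dist_eq, abs_lt]
  constructor <;> linarith

/-- Where `K` is continuous, the envelopes converge to it as the radius shrinks, so little mass is
lost. This is where almost everywhere continuity of the kernel enters. -/
theorem exists_lowerEnv_integral_gt (hK : LocalFun K M L) (hc : ∀ᵐ z, ContinuousAt K z)
    {a : ℝ} (ha : a < ∫ z, K z) : ∃ t : ℝ, 0 < t ∧ a < ∫ z, lowerEnv K t z := by
  set τ : ℕ → ℝ := fun k => 1 / ((k : ℝ) + 1) with hτ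
  have hτ0 : ∀ k, 0 < τ k := fun k => by positivity
  have hτ1 : ∀ k, τ k ≤ 1 := fun k => by
    simp only [hτ]
    rw [div_le_one (by positivity)]
    have : (0 : ℝ) ≤ k := Nat.cast_nonneg k
    linarith
  have h : Tendsto (fun k => ∫ z, lowerEnv K (τ k) z) atTop (𝓝 (∫ z, K z)) := by
    refine tendsto_integral_of_dominated_convergence _
      (fun k => (hK.lowerEnv (hτ0 k)).measurable.aestronglyMeasurable)
      (LocalFun.integrable_majorant M (L + 1)) (fun k => ae_of_all _ fun z => ?_)
      (hc.mono fun z hz => tendsto_lowerEnv hK hz hτ0 tendsto_one_div_add_atTop_nhds_zero_nat)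
    refine ((hK.lowerEnv (hτ0 k)).abs_le_indicator z).trans ?_
    exact indicator_le_indicator_of_subset
      (Icc_subset_Icc (by linarith [hτ1 k]) (by linarith [hτ1 k])) (fun _ => hK.bound_nonneg) z
  obtain ⟨k, hk⟩ := (h.eventually (eventually_gt_nhds ha)).exists
  exact ⟨τ k, hτ0 k, hk⟩

end Envelope

/-! ### Uniform lower bound for kernel sums. -/

section Uniform

variable {Ω : Type*} [MeasurableSpace Ω] {P : Measure Ω}
  {X V : Plane → Ω → ℝ} {s : (n : ℕ) → Fin n → Plane} {m σ f K : ℝ → ℝ} {ν : Measure ℝ}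
  {I : Set ℝ} {ε : ℝ} {b h : ℕ → ℝ} {φ : ℝ → ℝ} {ψ : ℕ → ℕ → ℝ} {γ κ : ℝ}

/-- Local uniform lower bound for the kernel density estimator. -/
theorem eventually_kernel_sum_ge [IsProbabilityMeasure P] (hs : DEISampling s)
    (hA1 : ProcessAssumption P X s h φ ψ γ κ) (hA2 : BandwidthAssumption s b h γ κ)
    (hA3 : KernelAssumption K) (hA4 : ModelAssumption P X V s m σ f ν I ε κ) {x : ℝ}
    (hfx : ContinuousAt f x) (hf0 : 0 < f x) {β : ℕ → ℝ} (hβ0 : ∀ n, 0 < β n) {c : ℝ}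
    (hβ : ∀ n, β n ≤ c * (b n + h n)) (hβt : Tendsto β atTop (𝓝 0))
    (hnβ : Tendsto (fun n : ℕ => n * β n) atTop atTop) (R : ℝ) :
    ∀ᶠ p in whp P, ∀ y, |y - x| ≤ R * β p.1 →
      f x / 2 * (p.1 * β p.1) ≤ ∑ j, K ((y - X (s p.1 j) p.2) / β p.1) := by
  obtain ⟨M, L, hK⟩ := hA3.exists_localFun
  obtain ⟨t, ht, hI⟩ := exists_lowerEnv_integral_gt hK hA3.ae_continuous (a := 1 / 2)
    (by rw [hA3.integral_one]; norm_num)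
  -- Uniformity comes from a finite net: the envelope at a net point lies below the kernel at every
  -- point within `t`, so the law of large numbers is needed at finitely many points only.
  obtain ⟨F, -, hF, hcov⟩ := (isCompact_Icc (a := -R) (b := R)).finite_cover_balls ht
  have hE := hK.lowerEnv ht
  have h1 : ∀ᶠ p in whp P, ∀ u ∈ F, f x / 2 <
      ((p.1 : ℝ) * β p.1)⁻¹ * ∑ j, lowerEnv K t (u - (X (s p.1 j) p.2 - x) / β p.1) := by
    rw [eventually_all_finite hF]
    intro u _
    have h2 := tendsto_local_average hs hA1 hA2 hA4 (hE.sub_left u) hfx hβ0 hβ hβt hnβ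
    rw [integral_sub_left_eq_self (fun z => lowerEnv K t z) volume u] at h2
    exact h2.eventually (eventually_gt_nhds (by nlinarith))
  filter_upwards [h1, (tendsto_fst_whp P).eventually (eventually_gt_atTop 0)] with p hp hp0 y hy
  have hβp := hβ0 p.1
  have hpos : (0 : ℝ) < p.1 * β p.1 := mul_pos (by exact_mod_cast hp0) hβp
  have hu : (y - x) / β p.1 ∈ Icc (-R) R := by
    rw [mem_Icc, ← abs_le, abs_div, abs_of_pos hβp, div_le_iff₀ hβp]
    exact hy
  obtain ⟨u, huF, hub⟩ := mem_iUnion₂.1 (hcov hu)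
  rw [Metric.mem_ball, Real.dist_eq] at hub
  have h3 := hp u huF
  rw [inv_mul_eq_div, lt_div_iff₀ hpos] at h3
  refine h3.le.trans (Finset.sum_le_sum fun j _ => lowerEnv_le hK ?_)
  convert hub using 2
  field_simp
  ring

end Uniform

/-! ### Linear and quadratic forms in independent errors. -/

section Moments

/-- Nonnegativity of the variance of |Y|. -/
theorem integral_abs_le_sqrt {α : Type*} [MeasurableSpace α] {μ : Measure α}
    [IsProbabilityMeasure μ] {Y : α → ℝ} (hY : MemLp Y 2 μ) :
    ∫ a, |Y a| ∂μ ≤ √(∫ a, Y a ^ 2 ∂μ) := by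
  refine Real.le_sqrt_of_sq_le ?_
  have h := variance_nonneg |Y| μ
  rw [variance_eq_sub hY.abs] at h
  simp only [Pi.pow_apply, Pi.abs_apply, sq_abs] at h
  linarith

/-- A standardized error law with finite fourth moment. -/
structure StdNoise (ν : Measure ℝ) : Prop where
  prob : IsProbabilityMeasure ν
  fourth : Integrable (fun v => v ^ 4) ν
  mean : ∫ v, v ∂ν = 0
  second : ∫ v, v ^ 2 ∂ν = 1

variable {ι : Type*} [Fintype ι] {ν : Measure ℝ}

theorem StdNoise.integrable_pow (hν : StdNoise ν) {k : ℕ} (hk : k ≤ 4) :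
    Integrable (fun v => v ^ k) ν := by
  have := hν.prob
  refine ((integrable_const (1 : ℝ)).add hν.fourth).mono' (by fun_prop) (ae_of_all _ fun v => ?_)
  rw [Real.norm_eq_abs, abs_pow]
  simp only [Pi.add_apply]
  have h4' : v ^ 4 = |v| ^ 4 := by rw [← abs_pow, abs_of_nonneg (by positivity)]
  rw [h4']
  rcases le_total |v| 1 with hv | hv
  · have h1 := pow_le_one₀ (n := k) (abs_nonneg v) hv
    have h2 : 0 ≤ |v| ^ 4 := by positivity
    linarith
  · have := pow_le_pow_right₀ hv hk
    linarith

theorem StdNoise.integrable_monomial (hν : StdNoise ν) {e : ι → ℕ} (he : ∀ i, e i ≤ 4) :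
    Integrable (fun v : ι → ℝ => ∏ i, v i ^ e i) (Measure.pi fun _ => ν) := by
  have := hν.prob
  exact Integrable.fintype_prod (f := fun i (v : ℝ) => v ^ e i) fun i => hν.integrable_pow (he i)

theorem StdNoise.integral_monomial (hν : StdNoise ν) (e : ι → ℕ) :
    ∫ v : ι → ℝ, ∏ i, v i ^ e i ∂(Measure.pi fun _ => ν) = ∏ i, ∫ v, v ^ e i ∂ν := by
  have := hν.prob
  exact integral_fintype_prod_eq_prod (f := fun i (v : ℝ) => v ^ e i)

/-- As a single monomial with indicator exponents, the product has an expectation that factors over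
coordinates, with coincidences between indices recorded in the exponents. -/
theorem monomial_four [DecidableEq ι] (v : ι → ℝ) (j k l m : ι) :
    ∏ i, v i ^ ((if i = j then 1 else 0) + (if i = k then 1 else 0) + (if i = l then 1 else 0) +
      (if i = m then 1 else 0)) = (v j * v k) * (v l * v m) := by
  simp only [pow_add, Finset.prod_mul_distrib, pow_ite, pow_one, pow_zero, Finset.prod_ite_eq',
    Finset.mem_univ, if_true, mul_assoc]

theorem monomial_two [DecidableEq ι] (v : ι → ℝ) (j k : ι) :
    ∏ i, v i ^ ((if i = j then 1 else 0) + (if i = k then 1 else 0)) = v j * v k := by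
  simp only [pow_add, Finset.prod_mul_distrib, pow_ite, pow_one, pow_zero, Finset.prod_ite_eq',
    Finset.mem_univ, if_true]

theorem StdNoise.integrable_four (hν : StdNoise ν) (j k l m : ι) :
    Integrable (fun v : ι → ℝ => (v j * v k) * (v l * v m)) (Measure.pi fun _ => ν) := by
  classical
  simp_rw [← monomial_four]
  exact hν.integrable_monomial fun i => by split_ifs <;> norm_num

theorem StdNoise.integrable_two (hν : StdNoise ν) (j k : ι) :
    Integrable (fun v : ι → ℝ => v j * v k) (Measure.pi fun _ => ν) := by
  classical
  simp_rw [← monomial_two]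
  exact hν.integrable_monomial fun i => by split_ifs <;> norm_num

theorem StdNoise.integral_two [DecidableEq ι] (hν : StdNoise ν) (j k : ι) :
    ∫ v : ι → ℝ, v j * v k ∂(Measure.pi fun _ => ν) = if j = k then 1 else 0 := by
  have := hν.prob
  simp_rw [← monomial_two]
  rw [hν.integral_monomial]
  split_ifs with h
  · subst h
    refine Finset.prod_eq_one fun i _ => ?_
    split_ifs <;> simp [hν.second]
  · refine Finset.prod_eq_zero (Finset.mem_univ j) ?_
    rw [if_pos rfl, if_neg h]
    simpa using hν.mean

theorem StdNoise.integral_four_of_swap (hν : StdNoise ν) {j k : ι} (hjk : j ≠ k) :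
    ∫ v : ι → ℝ, (v j * v k) * (v j * v k) ∂(Measure.pi fun _ => ν) = 1 := by
  classical
  have := hν.prob
  simp_rw [← monomial_four]
  rw [hν.integral_monomial]
  refine Finset.prod_eq_one fun i _ => ?_
  by_cases h1 : i = j
  · have h2 : i ≠ k := h1 ▸ hjk
    simp only [h1, if_true, if_neg hjk]
    exact hν.second
  · by_cases h2 : i = k
    · simp only [h2, if_true, if_neg hjk.symm]
      exact hν.second
    · simp [h1, h2]

/-- Some index occurs exactly once, and its factor has mean zero: `m` if `l` is one of `j`, `k`, and
`l` otherwise. -/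
theorem StdNoise.integral_four_eq_zero (hν : StdNoise ν) {j k l m : ι} (hlm : l ≠ m)
    (h1 : ¬(l = j ∧ m = k)) (h2 : ¬(l = k ∧ m = j)) :
    ∫ v : ι → ℝ, (v j * v k) * (v l * v m) ∂(Measure.pi fun _ => ν) = 0 := by
  classical
  simp_rw [← monomial_four]
  rw [hν.integral_monomial]
  have hone : ∀ i, ((if i = j then 1 else 0) + (if i = k then 1 else 0) + (if i = l then 1 else 0) +
      (if i = m then 1 else 0)) = 1 → ∏ i, ∫ v, v ^ ((if i = j then 1 else 0) +
      (if i = k then 1 else 0) + (if i = l then 1 else 0) + (if i = m then 1 else 0)) ∂ν = 0 := by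
    intro i hi
    refine Finset.prod_eq_zero (Finset.mem_univ i) ?_
    rw [hi]
    simpa using hν.mean
  by_cases hl : l = j ∨ l = k
  · refine hone m ?_
    have hmj : m ≠ j := by rintro rfl; rcases hl with rfl | rfl <;> simp_all
    have hmk : m ≠ k := by rintro rfl; rcases hl with rfl | rfl <;> simp_all
    simp [hmj, hmk, hlm.symm]
  · push Not at hl
    refine hone l ?_
    simp [hl.1, hl.2, hlm]

theorem StdNoise.memLp_linear (hν : StdNoise ν) (a : ι → ℝ) :
    MemLp (fun v : ι → ℝ => ∑ k, a k * v k) 2 (Measure.pi fun _ => ν) := by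
  refine memLp_finsetSum _ fun k _ => ?_
  rw [memLp_two_iff_integrable_sq ((measurable_pi_apply k).const_mul _).aestronglyMeasurable]
  refine ((hν.integrable_two k k).const_mul (a k ^ 2)).congr (ae_of_all _ fun v => ?_)
  simp only; ring

theorem StdNoise.integral_linear_sq (hν : StdNoise ν) (a : ι → ℝ) :
    ∫ v : ι → ℝ, (∑ k, a k * v k) ^ 2 ∂(Measure.pi fun _ => ν) = ∑ k, a k ^ 2 := by
  classical
  have h : ∀ v : ι → ℝ, (∑ k, a k * v k) ^ 2 = ∑ j, ∑ k, (a j * a k) * (v j * v k) := by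
    intro v
    rw [sq, Finset.sum_mul_sum]
    exact Finset.sum_congr rfl fun j _ => Finset.sum_congr rfl fun k _ => by ring
  simp_rw [h]
  rw [integral_finsetSum _ fun j _ => integrable_finsetSum _ fun k _ =>
    (hν.integrable_two j k).const_mul _]
  refine Finset.sum_congr rfl fun j _ => ?_
  rw [integral_finsetSum _ fun k _ => (hν.integrable_two j k).const_mul _]
  simp_rw [integral_const_mul, hν.integral_two]
  simp [sq]

theorem StdNoise.memLp_quadratic (hν : StdNoise ν) (A : Finset (ι × ι)) (d : ι × ι → ℝ) :
    MemLp (fun v : ι → ℝ => ∑ p ∈ A, d p * (v p.1 * v p.2)) 2 (Measure.pi fun _ => ν) := by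
  refine memLp_finsetSum _ fun p _ => ?_
  rw [memLp_two_iff_integrable_sq (((measurable_pi_apply p.1).mul
    (measurable_pi_apply p.2)).const_mul _).aestronglyMeasurable]
  refine ((hν.integrable_four p.1 p.2 p.1 p.2).const_mul (d p ^ 2)).congr (ae_of_all _ fun v => ?_)
  simp only; ring

/-- Second moment of an off-diagonal quadratic form in independent standardized variables. -/
theorem StdNoise.integral_quadratic_sq_le [DecidableEq ι] (hν : StdNoise ν) (d : ι × ι → ℝ) :
    ∫ v : ι → ℝ, (∑ p ∈ (Finset.univ : Finset ι).offDiag, d p * (v p.1 * v p.2)) ^ 2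
      ∂(Measure.pi fun _ => ν) ≤ 2 * ∑ p ∈ (Finset.univ : Finset ι).offDiag, d p ^ 2 := by
  set A := (Finset.univ : Finset ι).offDiag with hA
  have hmem : ∀ p : ι × ι, p ∈ A ↔ p.1 ≠ p.2 := fun p => by simp [hA]
  have h : ∀ v : ι → ℝ, (∑ p ∈ A, d p * (v p.1 * v p.2)) ^ 2 =
      ∑ p ∈ A, ∑ q ∈ A, (d p * d q) * ((v p.1 * v p.2) * (v q.1 * v q.2)) := by
    intro v
    rw [sq, Finset.sum_mul_sum]
    exact Finset.sum_congr rfl fun j _ => Finset.sum_congr rfl fun k _ => by ring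
  simp_rw [h]
  rw [integral_finsetSum _ fun p _ => integrable_finsetSum _ fun q _ =>
    (hν.integrable_four _ _ _ _).const_mul _]
  -- Only the pair itself and its transpose contribute.
  have hrow : ∀ p ∈ A, ∫ v : ι → ℝ, ∑ q ∈ A, (d p * d q) * ((v p.1 * v p.2) * (v q.1 * v q.2))
      ∂(Measure.pi fun _ => ν) = d p ^ 2 + d p * d p.swap := by
    intro p hp
    have hp' := (hmem p).1 hp
    rw [integral_finsetSum _ fun q _ => (hν.integrable_four _ _ _ _).const_mul _]
    simp_rw [integral_const_mul]
    have hne : p ≠ p.swap := fun h => hp' (by simpa using congrArg Prod.fst h)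
    have hsw : p.swap ∈ A := (hmem _).2 (by simpa using hp'.symm)
    rw [← Finset.sum_subset (s₁ := {p, p.swap}) (by
      intro q hq; simp only [Finset.mem_insert, Finset.mem_singleton] at hq
      rcases hq with rfl | rfl <;> assumption), Finset.sum_pair hne]
    · have e1 := hν.integral_four_of_swap hp'
      have e2 : ∫ v : ι → ℝ, (v p.1 * v p.2) * (v p.swap.1 * v p.swap.2)
          ∂(Measure.pi fun _ => ν) = 1 := by
        rw [← e1]; congr 1; ext v; simp only [Prod.fst_swap, Prod.snd_swap]; ring
      rw [e1, e2]; ring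
    · intro q hq hqn
      simp only [Finset.mem_insert, Finset.mem_singleton, not_or] at hqn
      rw [hν.integral_four_eq_zero ((hmem q).1 hq), mul_zero]
      · rintro ⟨h1, h2⟩; exact hqn.1 (Prod.ext h1 h2)
      · rintro ⟨h1, h2⟩; exact hqn.2 (Prod.ext h1 h2)
  rw [Finset.sum_congr rfl hrow]
  have hswap : ∑ p ∈ A, d p.swap ^ 2 = ∑ p ∈ A, d p ^ 2 := by
    refine Finset.sum_nbij' Prod.swap Prod.swap ?_ ?_ (by simp) (by simp) (by simp)
    · intro p hp; exact (hmem _).2 (by simpa using ((hmem p).1 hp).symm)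
    · intro p hp; exact (hmem _).2 (by simpa using ((hmem p).1 hp).symm)
  calc ∑ p ∈ A, (d p ^ 2 + d p * d p.swap)
      ≤ ∑ p ∈ A, (3 / 2 * d p ^ 2 + 1 / 2 * d p.swap ^ 2) :=
        Finset.sum_le_sum fun p _ => by nlinarith [sq_nonneg (d p - d p.swap)]
    _ = 2 * ∑ p ∈ A, d p ^ 2 := by
        rw [Finset.sum_add_distrib, ← Finset.mul_sum, ← Finset.mul_sum, hswap]; ring

/-- Replacing the errors by residuals changes a weighted sum of squares by little, on average. -/
theorem StdNoise.lintegral_residual_le (hν : StdNoise ν) {q σ B : ι → ℝ} {c : ι → ι → ℝ}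
    {J J' : Finset ι} {Q S β cc N : ℝ} (hJ : (J.card : ℝ) ≤ N) (hJ' : (J'.card : ℝ) ≤ N)
    (hQ0 : 0 ≤ Q) (hS0 : 0 ≤ S) (hβ0 : 0 ≤ β) (hcc0 : 0 ≤ cc)
    (hq0 : ∀ j ∉ J, q j = 0) (hq : ∀ j, |q j| ≤ Q) (hσ : ∀ j ∈ J, |σ j| ≤ S)
    (hB : ∀ j ∈ J, |B j| ≤ β) (hc : ∀ j ∈ J, ∀ k, |c j k| ≤ cc)
    (hc0 : ∀ j ∈ J, ∀ k ∉ J', c j k = 0) :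
    ∫⁻ v : ι → ℝ, ‖∑ j, q j * ((σ j * v j - (B j + ∑ k, c j k * v k)) ^ 2 - (σ j * v j) ^ 2)‖ₑ
        ∂(Measure.pi fun _ => ν) ≤
      ENNReal.ofReal (2 * Q * N * (β ^ 2 + N * cc ^ 2) + 2 * (Q * S * β * √N) +
        2 * (Q * S * cc * N) + 2 * (√2 * (Q * S * cc * N))) := by
  classical
  have hprob := hν.prob
  set π : Measure (ι → ℝ) := Measure.pi fun _ => ν with hπ
  have hN : 0 ≤ N := (Nat.cast_nonneg _).trans hJ
  set A := (Finset.univ : Finset ι).offDiag with hA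
  set G1 : (ι → ℝ) → ℝ := fun v => ∑ j, |q j| * (2 * B j ^ 2 + 2 * (∑ k, c j k * v k) ^ 2) with hG1
  set lin : (ι → ℝ) → ℝ := fun v => ∑ j, (q j * σ j * B j) * v j with hlin
  set G3 : (ι → ℝ) → ℝ := fun v => ∑ j, |q j * σ j * c j j| * (v j * v j) with hG3
  set d : ι × ι → ℝ := fun p => q p.1 * σ p.1 * c p.1 p.2 with hd
  set off : (ι → ℝ) → ℝ := fun v => ∑ p ∈ A, d p * (v p.1 * v p.2) with hoff
  have hlinL : MemLp lin 2 π := hν.memLp_linear _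
  have hoffL : MemLp off 2 π := hν.memLp_quadratic _ _
  have hsqi : ∀ j, Integrable (fun v : ι → ℝ => (∑ k, c j k * v k) ^ 2) π := fun j =>
    (hν.memLp_linear _).integrable_sq
  have hterm : ∀ j, Integrable
      (fun v : ι → ℝ => |q j| * (2 * B j ^ 2 + 2 * (∑ k, c j k * v k) ^ 2)) π := fun j =>
    ((integrable_const _).add ((hsqi j).const_mul 2)).const_mul _
  have hG1i : Integrable G1 π := integrable_finsetSum _ fun j _ => hterm j
  have hG3i : Integrable G3 π := integrable_finsetSum _ fun j _ =>
    (hν.integrable_two j j).const_mul _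
  have hlini : Integrable (fun v => |lin v|) π := (hlinL.integrable (by norm_num)).abs
  have hoffi : Integrable (fun v => |off v|) π := (hoffL.integrable (by norm_num)).abs
  -- With r = B + Σ c v, the increment is r² - 2σvr. The square is bounded by `G1`; the cross term
  -- splits into a linear form, the diagonal `G3` and an off-diagonal quadratic form.
  have hpt : ∀ v : ι → ℝ,
      |∑ j, q j * ((σ j * v j - (B j + ∑ k, c j k * v k)) ^ 2 - (σ j * v j) ^ 2)| ≤
      G1 v + 2 * |lin v| + 2 * G3 v + 2 * |off v| := by
    intro v
    have e : ∑ j, q j * ((σ j * v j - (B j + ∑ k, c j k * v k)) ^ 2 - (σ j * v j) ^ 2) =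
        ∑ j, q j * (B j + ∑ k, c j k * v k) ^ 2 - 2 * lin v -
          2 * ∑ j, ∑ k, d (j, k) * (v j * v k) := by
      rw [hlin]
      simp only [Finset.mul_sum, ← Finset.sum_sub_distrib]
      refine Finset.sum_congr rfl fun j _ => ?_
      have : ∑ k, 2 * (d (j, k) * (v j * v k)) = 2 * (q j * σ j * v j) * ∑ k, c j k * v k := by
        rw [Finset.mul_sum]
        exact Finset.sum_congr rfl fun k _ => by simp only [hd]; ring
      rw [this]; ring
    have e2 : ∑ j, ∑ k, d (j, k) * (v j * v k) =
        (∑ j, (q j * σ j * c j j) * (v j * v j)) + off v := by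
      rw [← Finset.sum_product', ← Finset.diag_union_offDiag, Finset.sum_union
        (Finset.disjoint_diag_offDiag _), Finset.sum_diag]
    have h1 : |∑ j, q j * (B j + ∑ k, c j k * v k) ^ 2| ≤ G1 v := by
      refine (Finset.abs_sum_le_sum_abs _ _).trans (Finset.sum_le_sum fun j _ => ?_)
      rw [abs_mul, abs_of_nonneg (sq_nonneg (B j + ∑ k, c j k * v k))]
      refine mul_le_mul_of_nonneg_left ?_ (abs_nonneg _)
      nlinarith [sq_nonneg (B j - ∑ k, c j k * v k)]
    have h3 : |∑ j, (q j * σ j * c j j) * (v j * v j)| ≤ G3 v := by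
      refine (Finset.abs_sum_le_sum_abs _ _).trans (Finset.sum_le_sum fun j _ => ?_)
      rw [abs_mul, abs_of_nonneg (mul_self_nonneg (v j))]
    rw [e, e2]
    have t1 := abs_sub (∑ j, q j * (B j + ∑ k, c j k * v k) ^ 2 - 2 * lin v)
      (2 * ((∑ j, (q j * σ j * c j j) * (v j * v j)) + off v))
    have t2 := abs_sub (∑ j, q j * (B j + ∑ k, c j k * v k) ^ 2) (2 * lin v)
    have t3 := abs_add_le (∑ j, (q j * σ j * c j j) * (v j * v j)) (off v)
    rw [abs_mul, abs_two] at t1 t2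
    linarith
  have hqJ : ∀ a : ι → ℝ, (∀ j ∉ J, a j = 0) → ∀ C : ℝ, (∀ j ∈ J, a j ≤ C) → 0 ≤ C →
      ∑ j, a j ≤ N * C := by
    intro a ha0 C haC hC
    rw [← Finset.sum_subset (Finset.subset_univ J) fun j _ hj => ha0 j hj]
    refine (Finset.sum_le_card_nsmul _ _ _ haC).trans ?_
    rw [nsmul_eq_mul]
    exact mul_le_mul_of_nonneg_right hJ hC
  have hcsq : ∀ j ∈ J, ∑ k, c j k ^ 2 ≤ N * cc ^ 2 := by
    intro j hj
    rw [← Finset.sum_subset (Finset.subset_univ J') fun k _ hk => by rw [hc0 j hj k hk]; norm_num]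
    refine (Finset.sum_le_card_nsmul _ _ (cc ^ 2) fun k _ => ?_).trans ?_
    · rw [← sq_abs]; exact pow_le_pow_left₀ (abs_nonneg _) (hc j hj k) 2
    · rw [nsmul_eq_mul]
      exact mul_le_mul_of_nonneg_right hJ' (sq_nonneg _)
  have hqσ : ∀ j ∈ J, |q j * σ j| ≤ Q * S := fun j hj => by
    rw [abs_mul]; exact mul_le_mul (hq j) (hσ j hj) (abs_nonneg _) hQ0
  have I1 : ∫ v, G1 v ∂π ≤ 2 * Q * N * (β ^ 2 + N * cc ^ 2) := by
    rw [hG1, integral_finsetSum _ fun j _ => hterm j]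
    refine (hqJ _ (fun j hj => by simp [hq0 j hj]) (Q * (2 * β ^ 2 + 2 * (N * cc ^ 2))) ?_
      (by positivity)).trans (le_of_eq (by ring))
    intro j hj
    have e : ∫ v : ι → ℝ, 2 * (∑ k, c j k * v k) ^ 2 ∂π = 2 * ∑ k, c j k ^ 2 := by
      rw [integral_const_mul, hν.integral_linear_sq]
    rw [integral_const_mul, integral_add (integrable_const _) ((hsqi j).const_mul 2), e,
      integral_const, probReal_univ, one_smul]
    refine mul_le_mul (hq j) (add_le_add ?_ ?_) ?_ hQ0
    · have := pow_le_pow_left₀ (abs_nonneg _) (hB j hj) 2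
      rw [sq_abs] at this; linarith
    · linarith [hcsq j hj]
    · have : 0 ≤ ∑ k, c j k ^ 2 := Finset.sum_nonneg fun k _ => sq_nonneg _
      positivity
  -- Centring pays here: the second moment gives √N where termwise absolute values would give N.
  have I2 : ∫ v, |lin v| ∂π ≤ Q * S * β * √N := by
    refine (integral_abs_le_sqrt hlinL).trans ?_
    rw [hν.integral_linear_sq]
    refine (Real.sqrt_le_sqrt (hqJ _ (fun j hj => by simp [hq0 j hj]) ((Q * S * β) ^ 2) ?_
      (by positivity))).trans (le_of_eq ?_)
    · intro j hj
      rw [← sq_abs, abs_mul]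
      exact pow_le_pow_left₀ (by positivity)
        (mul_le_mul (hqσ j hj) (hB j hj) (abs_nonneg _) (by positivity)) 2
    · rw [Real.sqrt_mul hN, Real.sqrt_sq (by positivity)]; ring
  have I3 : ∫ v, G3 v ∂π ≤ Q * S * cc * N := by
    rw [hG3, integral_finsetSum _ fun j _ => (hν.integrable_two j j).const_mul _]
    simp_rw [integral_const_mul, hν.integral_two, if_true, mul_one]
    refine (hqJ _ (fun j hj => by simp [hq0 j hj]) (Q * S * cc) ?_ (by positivity)).trans
      (le_of_eq (by ring))
    intro j hj
    rw [abs_mul]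
    exact mul_le_mul (hqσ j hj) (hc j hj j) (abs_nonneg _) (by positivity)
  -- There are up to N² active pairs, but orthogonality leaves only order N in the L² norm.
  have I4 : ∫ v, |off v| ∂π ≤ √2 * (Q * S * cc * N) := by
    refine (integral_abs_le_sqrt hoffL).trans ?_
    have h2 : ∑ p ∈ A, d p ^ 2 ≤ (Q * S * cc * N) ^ 2 := by
      calc ∑ p ∈ A, d p ^ 2 ≤ ∑ p : ι × ι, d p ^ 2 :=
            Finset.sum_le_sum_of_subset_of_nonneg (Finset.subset_univ _) fun p _ _ => sq_nonneg _
        _ = ∑ j, ∑ k, d (j, k) ^ 2 := Fintype.sum_prod_type _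
        _ ≤ N * ((Q * S) ^ 2 * (N * cc ^ 2)) := by
            refine hqJ _ (fun j hj => by simp [hd, hq0 j hj]) _ (fun j hj => ?_) (by positivity)
            have e : ∑ k, d (j, k) ^ 2 = (q j * σ j) ^ 2 * ∑ k, c j k ^ 2 := by
              rw [Finset.mul_sum]
              exact Finset.sum_congr rfl fun k _ => by simp only [hd]; ring
            rw [e]
            refine mul_le_mul ?_ (hcsq j hj) (Finset.sum_nonneg fun k _ => sq_nonneg _)
              (by positivity)
            rw [← sq_abs]
            exact pow_le_pow_left₀ (abs_nonneg _) (hqσ j hj) 2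
        _ = (Q * S * cc * N) ^ 2 := by ring
    calc √(∫ v, off v ^ 2 ∂π) ≤ √(2 * (Q * S * cc * N) ^ 2) :=
          Real.sqrt_le_sqrt ((hν.integral_quadratic_sq_le d).trans (by linarith))
      _ = _ := by rw [Real.sqrt_mul (by norm_num), Real.sqrt_sq (by positivity)]
  have hG12 : Integrable (fun v => G1 v + 2 * |lin v|) π := hG1i.add (hlini.const_mul 2)
  have hG123 : Integrable (fun v => G1 v + 2 * |lin v| + 2 * G3 v) π := hG12.add (hG3i.const_mul 2)
  have hGi : Integrable (fun v => G1 v + 2 * |lin v| + 2 * G3 v + 2 * |off v|) π :=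
    hG123.add (hoffi.const_mul 2)
  calc _ ≤ ∫⁻ v, ENNReal.ofReal (G1 v + 2 * |lin v| + 2 * G3 v + 2 * |off v|) ∂π := by
        refine lintegral_mono fun v => ?_
        rw [← ofReal_norm]
        exact ENNReal.ofReal_le_ofReal (hpt v)
    _ = ENNReal.ofReal (∫ v, (G1 v + 2 * |lin v| + 2 * G3 v + 2 * |off v|) ∂π) := by
        rw [ofReal_integral_eq_lintegral_ofReal hGi
          (ae_of_all _ fun v => (abs_nonneg _).trans (hpt v))]
    _ ≤ _ := by
        refine ENNReal.ofReal_le_ofReal ?_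
        rw [integral_add hG123 (hoffi.const_mul 2), integral_add hG12 (hG3i.const_mul 2),
          integral_add hG1i (hlini.const_mul 2), integral_const_mul, integral_const_mul,
          integral_const_mul]
        linarith

end Moments

/-! ### Characteristic functions of weighted squared errors. -/

section CharFun

/-- Characteristic function of the centred squared error. -/
noncomputable def sqCharFun (ν : Measure ℝ) (a : ℝ) : ℂ :=
  ∫ v, Complex.exp ((a * (v ^ 2 - 1) : ℝ) * Complex.I) ∂ν

variable {ν : Measure ℝ}

theorem norm_sqCharFun_le (hν : StdNoise ν) (a : ℝ) : ‖sqCharFun ν a‖ ≤ 1 := by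
  have := hν.prob
  refine (norm_integral_le_integral_norm _).trans (le_of_eq ?_)
  simp_rw [Complex.norm_exp_ofReal_mul_I]
  simp

theorem continuous_sqCharFun (hν : StdNoise ν) : Continuous (sqCharFun ν) := by
  have := hν.prob
  refine continuous_of_dominated (bound := fun _ => 1)
    (fun a => (by fun_prop : Continuous _).aestronglyMeasurable)
    (fun a => ae_of_all _ fun v => (Complex.norm_exp_ofReal_mul_I _).le)
    (integrable_const _) (ae_of_all _ fun v => by fun_prop)

theorem integral_exp_sum_sq {ι : Type*} [Fintype ι] (hν : StdNoise ν) (a : ι → ℝ) :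
    ∫ v : ι → ℝ, Complex.exp ((∑ j, a j * (v j ^ 2 - 1) : ℝ) * Complex.I)
      ∂(Measure.pi fun _ => ν) = ∏ j, sqCharFun ν (a j) := by
  have := hν.prob
  simp only [sqCharFun]
  rw [← integral_fintype_prod_eq_prod
    (f := fun j (v : ℝ) => Complex.exp ((a j * (v ^ 2 - 1) : ℝ) * Complex.I))]
  refine integral_congr_ae (ae_of_all _ fun v => ?_)
  simp only
  rw [← Complex.exp_sum, ← Finset.sum_mul, Complex.ofReal_sum]

/-- Here τ is the variance of V². Rescaled by √τ, the variable V² - 1 is standardized and its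
characteristic function has a second-order Taylor expansion; the Gaussian factor has the same one.
-/
theorem sqCharFun_isLittleO (hν : StdNoise ν) {τ : ℝ} (hτ : τ = (∫ v, v ^ 4 ∂ν) - 1) (hτ0 : 0 < τ) :
    (fun a : ℝ => sqCharFun ν a - Complex.exp (-(τ * a ^ 2 / 2 : ℝ))) =o[𝓝 0] fun a => a ^ 2 := by
  have := hν.prob
  set W : ℝ → ℝ := fun v => (√τ)⁻¹ * (v ^ 2 - 1) with hW
  have hsτ : √τ ≠ 0 := (Real.sqrt_pos.2 hτ0).ne'
  have hi2 := hν.integrable_pow (k := 2) (by norm_num)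
  have hWm : AEMeasurable W ν := by fun_prop
  have h0 : ∫ v, W v ∂ν = 0 := by
    simp only [hW]
    rw [integral_const_mul, integral_sub hi2 (integrable_const _), hν.second]
    simp
  have h1 : ∫ v, (W ^ 2) v ∂ν = 1 := by
    have e : ∀ v, (W ^ 2) v = τ⁻¹ * (v ^ 4 - (2 * v ^ 2 - 1)) := by
      intro v
      simp only [hW, Pi.pow_apply, mul_pow, inv_pow, Real.sq_sqrt hτ0.le]
      ring
    simp_rw [e]
    have hi : Integrable (fun v : ℝ => 2 * v ^ 2 - 1) ν :=
      (hi2.const_mul 2).sub (integrable_const _)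
    rw [integral_const_mul, integral_sub hν.fourth hi,
      integral_sub (hi2.const_mul 2) (integrable_const _), integral_const_mul, hν.second]
    simp only [integral_const, probReal_univ, smul_eq_mul, mul_one]
    rw [show (∫ v, v ^ 4 ∂ν) - (2 - 1) = τ by rw [hτ]; ring]
    exact inv_mul_cancel₀ hτ0.ne'
  have htay := taylor_charFun_two hWm h0 h1
  have hlin : Tendsto (fun a : ℝ => √τ * a) (𝓝 0) (𝓝 0) := by
    have : Continuous fun a : ℝ => √τ * a := by fun_prop
    simpa using this.tendsto 0
  have h2 := htay.comp_tendsto hlin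
  have e1 : ∀ a : ℝ, charFun (ν.map W) (√τ * a) = sqCharFun ν a := by
    intro a
    rw [charFun_apply_real, integral_map hWm (by fun_prop)]
    refine integral_congr_ae (ae_of_all _ fun v => ?_)
    simp only [hW]
    congr 2
    push_cast
    have : (√τ : ℂ) ≠ 0 := by exact_mod_cast hsτ
    field_simp
  have h3 : (fun a : ℝ => sqCharFun ν a - (1 - ((τ * a ^ 2 / 2 : ℝ) : ℂ))) =o[𝓝 0]
      fun a : ℝ => a ^ 2 := by
    have h4 : (fun a : ℝ => (√τ * a) ^ 2) =O[𝓝 0] fun a : ℝ => a ^ 2 := by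
      simp_rw [mul_pow]
      exact (Asymptotics.isBigO_refl _ _).const_mul_left _
    refine (h2.trans_isBigO h4).congr_left fun a => ?_
    simp only [Function.comp_apply, e1]
    congr 2
    push_cast
    have : (√τ : ℂ) ^ 2 = τ := by exact_mod_cast Real.sq_sqrt hτ0.le
    rw [mul_pow, this]
  have h5 : (fun a : ℝ => Complex.exp (-(τ * a ^ 2 / 2 : ℝ)) - (1 - ((τ * a ^ 2 / 2 : ℝ) : ℂ)))
      =o[𝓝 0] fun a : ℝ => a ^ 2 := by
    have h6 : (fun z : ℂ => Complex.exp z - 1 - z) =o[𝓝 0] fun z => z := by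
      have := (Complex.hasDerivAt_exp 0).isLittleO
      simpa using this
    have h7 : Tendsto (fun a : ℝ => -((τ * a ^ 2 / 2 : ℝ) : ℂ)) (𝓝 0) (𝓝 0) := by
      have : Continuous fun a : ℝ => -((τ * a ^ 2 / 2 : ℝ) : ℂ) := by fun_prop
      simpa using this.tendsto 0
    have h8 := h6.comp_tendsto h7
    have h9 : (fun a : ℝ => -((τ * a ^ 2 / 2 : ℝ) : ℂ)) =O[𝓝 0] fun a : ℝ => a ^ 2 := by
      refine Asymptotics.IsBigO.of_bound (τ / 2) (Eventually.of_forall fun a => ?_)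
      rw [norm_neg, Complex.norm_real, Real.norm_eq_abs, Real.norm_eq_abs,
        abs_of_nonneg (by positivity), abs_of_nonneg (by positivity)]
      linarith
    refine (h8.trans_isBigO h9).congr_left fun a => ?_
    simp only [Function.comp_apply]
    ring
  refine (h3.sub h5).congr_left fun a => ?_
  ring

/-- Telescoping: factors are exchanged one at a time while all others have norm at most one. -/
theorem norm_prod_sub_prod_le {ι : Type*} (A : Finset ι) {u w : ι → ℂ} (hu : ∀ i, ‖u i‖ ≤ 1)
    (hw : ∀ i, ‖w i‖ ≤ 1) : ‖∏ i ∈ A, u i - ∏ i ∈ A, w i‖ ≤ ∑ i ∈ A, ‖u i - w i‖ := by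
  classical
  induction A using Finset.induction_on with
  | empty => simp
  | insert i A hi ih =>
    rw [Finset.prod_insert hi, Finset.prod_insert hi, Finset.sum_insert hi]
    have e : u i * ∏ i ∈ A, u i - w i * ∏ i ∈ A, w i =
        (u i - w i) * ∏ i ∈ A, u i + w i * (∏ i ∈ A, u i - ∏ i ∈ A, w i) := by ring
    rw [e]
    refine (norm_add_le _ _).trans (add_le_add ?_ ?_)
    · rw [norm_mul]
      refine mul_le_of_le_one_right (norm_nonneg _) ?_
      rw [norm_prod]
      exact Finset.prod_le_one (fun _ _ => norm_nonneg _) fun i _ => hu i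
    · rw [norm_mul]
      exact (mul_le_of_le_one_left (norm_nonneg _) (hw i)).trans ih

/-- The characteristic functions of weighted sums of centred squared errors with small weights are
asymptotically Gaussian. -/
theorem tendsto_prod_sqCharFun (hν : StdNoise ν) {τ : ℝ} (hτ : τ = (∫ v, v ^ 4 ∂ν) - 1)
    (hτ0 : 0 < τ) {α : Type*} {l : Filter α} {N : α → ℕ} {a : (p : α) → Fin (N p) → ℝ}
    {A : α → ℝ} {w : ℝ} (hA : Tendsto A l (𝓝 0)) (haA : ∀ᶠ p in l, ∀ j, |a p j| ≤ A p)
    (hw : Tendsto (fun p => ∑ j, a p j ^ 2) l (𝓝 w)) :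
    Tendsto (fun p => ∏ j, sqCharFun ν (a p j)) l (𝓝 (Complex.exp (-(τ * w / 2 : ℝ)))) := by
  have h1 : Tendsto (fun p => ∏ j, Complex.exp (-(τ * a p j ^ 2 / 2 : ℝ))) l
      (𝓝 (Complex.exp (-(τ * w / 2 : ℝ)))) := by
    have e : ∀ p, ∏ j, Complex.exp (-(τ * a p j ^ 2 / 2 : ℝ)) =
        Complex.exp (-(τ * (∑ j, a p j ^ 2) / 2 : ℝ)) := by
      intro p
      rw [← Complex.exp_sum]
      congr 1
      rw [Finset.mul_sum, Finset.sum_div, Complex.ofReal_sum, Finset.sum_neg_distrib]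
    simp_rw [e]
    have hc : Continuous fun y : ℝ => Complex.exp (-(τ * y / 2 : ℝ)) := by fun_prop
    exact (hc.tendsto w).comp hw
  have h2 : Tendsto (fun p => ∏ j, sqCharFun ν (a p j) -
      ∏ j, Complex.exp (-(τ * a p j ^ 2 / 2 : ℝ))) l (𝓝 0) := by
    refine Metric.tendsto_nhds.2 fun e he => ?_
    -- The factorwise errors are at most c a_j², and the squares eventually sum to less than |w| +
    -- 1, so the total error is at most e/2.
    set c := e / (2 * (|w| + 1)) with hc
    have hc0 : 0 < c := by positivity
    have ho := (sqCharFun_isLittleO hν hτ hτ0).bound hc0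
    obtain ⟨r, hr, hball⟩ := Metric.eventually_nhds_iff.1 ho
    filter_upwards [haA, hA.eventually (eventually_lt_nhds hr),
      hw.eventually (eventually_lt_nhds (show w < |w| + 1 by linarith [le_abs_self w]))]
      with p hp hp1 hp2
    rw [dist_zero_right]
    refine (norm_prod_sub_prod_le _ (fun j => norm_sqCharFun_le hν _) fun j => ?_).trans_lt ?_
    · rw [Complex.norm_exp]
      refine Real.exp_le_one_iff.2 ?_
      rw [Complex.neg_re, Complex.ofReal_re]
      have : 0 ≤ τ * a p j ^ 2 / 2 := by positivity
      linarith
    · calc ∑ j, ‖sqCharFun ν (a p j) - Complex.exp (-(τ * a p j ^ 2 / 2 : ℝ))‖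
          ≤ ∑ j, c * a p j ^ 2 := by
            refine Finset.sum_le_sum fun j _ => ?_
            have := hball (y := a p j) (by
              rw [Real.dist_eq, sub_zero]; exact (hp j).trans_lt hp1)
            rwa [Real.norm_eq_abs, abs_of_nonneg (sq_nonneg _)] at this
        _ = c * ∑ j, a p j ^ 2 := (Finset.mul_sum _ _ _).symm
        _ ≤ c * (|w| + 1) := by gcongr
        _ = e / 2 := by rw [hc]; field_simp
        _ < e := by linarith
  have := h2.add h1
  simpa using this

end CharFun

/-! ### Conditioning on the covariates. -/

section JointLaw

variable {Ω : Type*} [MeasurableSpace Ω] {P : Measure Ω} [IsProbabilityMeasure P]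
  {X V : Plane → Ω → ℝ} {s : (n : ℕ) → Fin n → Plane} {m σ f : ℝ → ℝ} {ν : Measure ℝ}
  {I : Set ℝ} {ε κ : ℝ}

theorem ModelAssumption.stdNoise (hA : ModelAssumption P X V s m σ f ν I ε κ) (hκ : 0 < κ) :
    StdNoise ν := by
  have hp : IsProbabilityMeasure ν := by
    rw [← hA.V_law 1 0]
    exact Measure.isProbabilityMeasure_map (hA.V_measurable _).aemeasurable
  refine ⟨hp, ?_, hA.V_mean, hA.V_second⟩
  refine ((integrable_const (1 : ℝ)).add hA.V_moment).mono' (by fun_prop) (ae_of_all _ fun v => ?_)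
  rw [Real.norm_eq_abs, abs_pow]
  simp only [Pi.add_apply]
  rcases le_total |v| 1 with hv | hv
  · have h1 := pow_le_one₀ (n := 4) (abs_nonneg v) hv
    have h2 := Real.rpow_nonneg (abs_nonneg v) (8 + 4 * κ)
    linarith
  · have h1 := Real.rpow_le_rpow_of_exponent_le hv (show ((4 : ℕ) : ℝ) ≤ 8 + 4 * κ by
      push_cast; linarith)
    rw [Real.rpow_natCast] at h1
    linarith

/-- Independence of the two fields combines with independence of the errors at the sites. With a
product law, conditioning on the covariates is integration over the second factor. -/
theorem ModelAssumption.joint_law (hX : ∀ u, Measurable (X u))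
    (hA : ModelAssumption P X V s m σ f ν I ε κ) (n : ℕ) :
    P.map (fun ω => ((fun j => X (s n j) ω), fun j => V (s n j) ω)) =
      (P.map fun ω j => X (s n j) ω).prod (Measure.pi fun _ : Fin n => ν) := by
  have h1 : IndepFun (fun ω (j : Fin n) => X (s n j) ω) (fun ω (j : Fin n) => V (s n j) ω) P :=
    hA.fields_indep.comp
      (φ := fun (x : Plane → ℝ) (j : Fin n) => x (s n j))
      (ψ := fun (x : Plane → ℝ) (j : Fin n) => x (s n j))
      (measurable_pi_lambda _ fun j => measurable_pi_apply _)
      (measurable_pi_lambda _ fun j => measurable_pi_apply _)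
  rw [(indepFun_iff_map_prod_eq_prod_map_map
    (measurable_pi_lambda _ fun j => hX _).aemeasurable
    (measurable_pi_lambda _ fun j => hA.V_measurable _).aemeasurable).1 h1]
  congr 1
  rw [(iIndepFun_iff_map_fun_eq_pi_map fun j => (hA.V_measurable _).aemeasurable).1 (hA.V_indep n)]
  simp_rw [hA.V_law n]

/-- Conditional characteristic function of a weighted sum of centred squared errors, with weights
depending on the covariates. -/
theorem ModelAssumption.integral_exp_weighted (hX : ∀ u, Measurable (X u))
    (hA : ModelAssumption P X V s m σ f ν I ε κ) (hκ : 0 < κ) (n : ℕ)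
    {a : (Fin n → ℝ) → Fin n → ℝ} (ha : ∀ j, Measurable fun x => a x j) :
    ∫ ω, Complex.exp ((∑ j, a (fun k => X (s n k) ω) j * (V (s n j) ω ^ 2 - 1) : ℝ) *
        Complex.I) ∂P =
      ∫ ω, ∏ j, sqCharFun ν (a (fun k => X (s n k) ω) j) ∂P := by
  have hν := hA.stdNoise hκ
  have := hν.prob
  have hXm : Measurable fun ω (j : Fin n) => X (s n j) ω := measurable_pi_lambda _ fun j => hX _
  have hVm : Measurable fun ω (j : Fin n) => V (s n j) ω :=
    measurable_pi_lambda _ fun j => hA.V_measurable _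
  have := Measure.isProbabilityMeasure_map (μ := P) hXm.aemeasurable
  set F : (Fin n → ℝ) × (Fin n → ℝ) → ℂ := fun z =>
    Complex.exp ((∑ j, a z.1 j * (z.2 j ^ 2 - 1) : ℝ) * Complex.I) with hF
  have hFm : Measurable F := by
    refine Complex.measurable_exp.comp ((Complex.measurable_ofReal.comp ?_).mul_const _)
    refine Finset.measurable_sum _ fun j _ => ((ha j).comp measurable_fst).mul ?_
    exact (((measurable_pi_apply j).comp measurable_snd).pow_const 2).sub_const 1
  have hFi : Integrable F ((P.map fun ω (j : Fin n) => X (s n j) ω).prod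
      (Measure.pi fun _ : Fin n => ν)) :=
    Integrable.of_bound hFm.aestronglyMeasurable 1
      (ae_of_all _ fun z => (Complex.norm_exp_ofReal_mul_I _).le)
  have hpm : Measurable fun x : Fin n → ℝ => ∏ j, sqCharFun ν (a x j) :=
    Finset.measurable_prod _ fun j _ => (continuous_sqCharFun hν).measurable.comp (ha j)
  have e1 : ∫ ω, F ((fun j => X (s n j) ω), fun j => V (s n j) ω) ∂P =
      ∫ z, F z ∂((P.map fun ω (j : Fin n) => X (s n j) ω).prod
        (Measure.pi fun _ : Fin n => ν)) := by
    rw [← hA.joint_law hX n, integral_map (hXm.prodMk hVm).aemeasurable hFm.aestronglyMeasurable]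
  refine e1.trans ?_
  rw [integral_prod _ hFi]
  simp only [hF, integral_exp_sum_sq hν]
  rw [integral_map hXm.aemeasurable hpm.aestronglyMeasurable]

end JointLaw

/-! ### Local Lipschitz and Taylor bounds. -/

section Smooth

variable {g : ℝ → ℝ} {x : ℝ}

theorem exists_lipschitz_near (hg : ContDiffAt ℝ 1 g x) :
    ∃ r > 0, ∃ Λ ≥ 0, ∀ y y', |y - x| ≤ r → |y' - x| ≤ r → |g y - g y'| ≤ Λ * |y - y'| := by
  obtain ⟨Λ, t, ht, hL⟩ := hg.exists_lipschitzOnWith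
  obtain ⟨r, hr, hrt⟩ := Metric.nhds_basis_closedBall.mem_iff.1 ht
  refine ⟨r, hr, Λ, Λ.2, fun y y' hy hy' => ?_⟩
  have := hL.dist_le_mul y (hrt (by simpa [Real.dist_eq] using hy)) y'
    (hrt (by simpa [Real.dist_eq] using hy'))
  simpa [Real.dist_eq] using this

/-- The mean value inequality for g(z) - g'(x) z: its derivative g'(z) - g'(x) is at most Λ|y - x|
on the ball of radius |y - x|, as g' is Lipschitz near x. -/
theorem exists_quadratic_near (hg : ContDiffAt ℝ 2 g x) :
    ∃ r > 0, ∃ C ≥ 0, ∃ a, ∀ y, |y - x| ≤ r → |g y - g x - a * (y - x)| ≤ C * (y - x) ^ 2 := by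
  have hd : ContDiffAt ℝ 1 (deriv g) x := by
    have h1 : ContDiffAt ℝ 1 (fderiv ℝ g) x := hg.fderiv_right (by norm_num)
    exact h1.clm_apply contDiffAt_const
  obtain ⟨r1, hr1, Λ, hΛ, hL⟩ := exists_lipschitz_near hd
  have hev : ∀ᶠ y in 𝓝 x, DifferentiableAt ℝ g y :=
    (hg.eventually (by simp)).mono fun y hy => hy.differentiableAt (by simp)
  obtain ⟨r2, hr2, hdiff⟩ := Metric.nhds_basis_closedBall.eventually_iff.1 hev
  refine ⟨min r1 r2, by positivity, Λ, hΛ, deriv g x, fun y hy => ?_⟩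
  set G : ℝ → ℝ := fun z => g z - deriv g x * z with hG
  have key := Convex.norm_image_sub_le_of_norm_deriv_le (f := G)
    (s := Metric.closedBall x |y - x|) (x := x) (y := y) (C := Λ * |y - x|) ?_ ?_
    (convex_closedBall _ _) (Metric.mem_closedBall_self (abs_nonneg _))
    (by simp [Real.dist_eq])
  · simp only [hG, Real.norm_eq_abs] at key
    have e : g y - g x - deriv g x * (y - x) = g y - deriv g x * y - (g x - deriv g x * x) := by
      ring
    rw [e]
    refine key.trans (le_of_eq ?_)
    rw [mul_assoc, ← sq, sq_abs]
  · intro z hz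
    have hz' : |z - x| ≤ |y - x| := by simpa [Real.dist_eq] using hz
    have : DifferentiableAt ℝ g z := hdiff (by
      rw [Metric.mem_closedBall, Real.dist_eq]; exact hz'.trans (hy.trans (min_le_right _ _)))
    exact this.sub (differentiableAt_id.const_mul _)
  · intro z hz
    have hz' : |z - x| ≤ |y - x| := by simpa [Real.dist_eq] using hz
    have hdz : DifferentiableAt ℝ g z := hdiff (by
      rw [Metric.mem_closedBall, Real.dist_eq]; exact hz'.trans (hy.trans (min_le_right _ _)))
    have e : deriv G z = deriv g z - deriv g x := by
      have := (hdz.hasDerivAt.sub ((hasDerivAt_id z).const_mul (deriv g x))).deriv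
      rw [mul_one] at this
      exact this
    rw [e, Real.norm_eq_abs]
    refine (hL z x (hz'.trans (hy.trans (min_le_left _ _))) (by simpa using hr1.le)).trans ?_
    gcongr

end Smooth

/-! ### Residuals of the jackknife estimator. -/

section Residual

variable {K : ℝ → ℝ} {M L : ℝ} {m σ : ℝ → ℝ} {ν : Measure ℝ}

theorem meanEst_eq {n : ℕ} (hn : n ≠ 0) (Xs Ys : Fin n → ℝ) {b : ℝ} (hb : b ≠ 0) (y : ℝ) :
    meanEst K Xs Ys b y =
      ∑ k, K ((y - Xs k) / b) / (∑ l, K ((y - Xs l) / b)) * Ys k := by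
  have hnb : (n : ℝ) * b ≠ 0 := mul_ne_zero (by exact_mod_cast hn) hb
  rw [meanEst, densityEst, ← mul_assoc, mul_one_div_cancel hnb, one_mul, Finset.mul_sum]
  exact Finset.sum_congr rfl fun k _ => by ring

theorem varianceEst_eq {n : ℕ} (hn : n ≠ 0) (Xs Ys : Fin n → ℝ) (b : ℝ) {h : ℝ} (hh : h ≠ 0)
    (y : ℝ) :
    varianceEst K Xs Ys b h y = (∑ l, K ((y - Xs l) / h))⁻¹ *
      ∑ j, (Ys j - jackknifeMeanEst K Xs Ys b (Xs j)) ^ 2 * K ((y - Xs j) / h) := by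
  have hnb : (n : ℝ) * h ≠ 0 := mul_ne_zero (by exact_mod_cast hn) hh
  rw [varianceEst, densityEst, ← mul_assoc, mul_one_div_cancel hnb, one_mul, one_div]

/-- The effect of replacing the errors by the residuals of the jackknife estimator in the local
sum of squares at `x`. -/
noncomputable def residualEffect (K m σ : ℝ → ℝ) {n : ℕ} (b h x : ℝ) (xs vs : Fin n → ℝ) : ℝ :=
  ∑ j, K ((x - xs j) / h) *
    ((m (xs j) + σ (xs j) * vs j -
      jackknifeMeanEst K xs (fun k => m (xs k) + σ (xs k) * vs k) b (xs j)) ^ 2 -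
      (σ (xs j) * vs j) ^ 2)

/-- Near `x` the jackknife is a linear smoother with weights `w j k` that sum to 2 - 1 = 1, are at
most 2M/a + M/a, and vanish beyond distance 2Lb, which covers the supports at bandwidths b and √2 b.
Each residual is thus the error minus a bias `B j`, formed from increments of `m`, and minus a
linear form in the errors; this is the setting of `StdNoise.lintegral_residual_le`. -/
theorem lintegral_residualEffect_le (hν : StdNoise ν) (hK : LocalFun K M L) {n : ℕ} (hn : n ≠ 0)
    (xs : Fin n → ℝ) {x b h r Λ S a N : ℝ} (hb : 0 < b) (hh : 0 < h) (hΛ : 0 ≤ Λ)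
    (hm : ∀ y y', |y - x| ≤ r → |y' - x| ≤ r → |m y - m y'| ≤ Λ * |y - y'|)
    (hσ : ∀ y, |y - x| ≤ r → |σ y| ≤ S) (hr : L * h + 2 * L * b ≤ r)
    (hN : (({k | |xs k - x| ≤ L * h + 2 * L * b} : Finset (Fin n)).card : ℝ) ≤ N) (ha : 0 < a)
    (hlow : ∀ y, |y - x| ≤ L * h → a ≤ ∑ k, K ((y - xs k) / b))
    (hlow2 : ∀ y, |y - x| ≤ L * h → a ≤ ∑ k, K ((y - xs k) / (√2 * b))) :
    ∫⁻ v : Fin n → ℝ, ‖residualEffect K m σ b h x xs v‖ₑ ∂(Measure.pi fun _ => ν) ≤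
      ENNReal.ofReal (2 * M * N * ((N * (3 * M / a * (Λ * (2 * L * b)))) ^ 2 +
          N * (3 * M / a * S) ^ 2) +
        2 * (M * S * (N * (3 * M / a * (Λ * (2 * L * b)))) * √N) +
        2 * (M * S * (3 * M / a * S) * N) + 2 * (√2 * (M * S * (3 * M / a * S) * N))) := by
  have hM0 := hK.bound_nonneg
  have hL0 := hK.radius_nonneg
  have hN0 : 0 ≤ N := (Nat.cast_nonneg _).trans hN
  have hS0 : 0 ≤ S := (abs_nonneg _).trans (hσ x (by
    rw [sub_self, abs_zero]; exact le_trans (by positivity) hr))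
  have hs2 : (0 : ℝ) < √2 := by positivity
  have hs2' : √2 ≤ 2 := by
    rw [Real.sqrt_le_left (by norm_num)]; norm_num
  set J : Finset (Fin n) := {k | |xs k - x| ≤ L * h} with hJ
  set J' : Finset (Fin n) := {k | |xs k - x| ≤ L * h + 2 * L * b} with hJ'
  have hmemJ : ∀ j, j ∈ J ↔ |xs j - x| ≤ L * h := fun j => by simp [hJ]
  have hmemJ' : ∀ j, j ∈ J' ↔ |xs j - x| ≤ L * h + 2 * L * b := fun j => by simp [hJ']
  have hJJ' : J ⊆ J' := fun j hj => (hmemJ' j).2 (((hmemJ j).1 hj).trans (by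
    have : 0 ≤ 2 * L * b := by positivity
    linarith))
  set w : Fin n → Fin n → ℝ := fun j k =>
    2 * (K ((xs j - xs k) / b) / (∑ l, K ((xs j - xs l) / b))) -
      K ((xs j - xs k) / (√2 * b)) / (∑ l, K ((xs j - xs l) / (√2 * b))) with hw
  set B : Fin n → ℝ := fun j => ∑ k, w j k * (m (xs k) - m (xs j)) with hB
  set c : Fin n → Fin n → ℝ := fun j k => w j k * σ (xs k) with hc
  have hjack : ∀ (Ys : Fin n → ℝ) j, jackknifeMeanEst K xs Ys b (xs j) = ∑ k, w j k * Ys k := by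
    intro Ys j
    rw [jackknifeMeanEst, meanEst_eq hn _ _ hb.ne', meanEst_eq hn _ _ (by positivity),
      Finset.mul_sum, ← Finset.sum_sub_distrib]
    exact Finset.sum_congr rfl fun k _ => by simp only [hw]; ring
  have hpos1 : ∀ j ∈ J, a ≤ ∑ l, K ((xs j - xs l) / b) := fun j hj => hlow _ ((hmemJ j).1 hj)
  have hpos2 : ∀ j ∈ J, a ≤ ∑ l, K ((xs j - xs l) / (√2 * b)) :=
    fun j hj => hlow2 _ ((hmemJ j).1 hj)
  have hwsum : ∀ j ∈ J, ∑ k, w j k = 1 := by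
    intro j hj
    simp only [hw]
    rw [Finset.sum_sub_distrib, ← Finset.mul_sum, ← Finset.sum_div, ← Finset.sum_div,
      div_self (ha.trans_le (hpos1 j hj)).ne', div_self (ha.trans_le (hpos2 j hj)).ne']
    norm_num
  have hwle : ∀ j ∈ J, ∀ k, |w j k| ≤ 3 * M / a := by
    intro j hj k
    have hdiv : ∀ (u T : ℝ), |u| ≤ M → a ≤ T → |u / T| ≤ M / a := by
      intro u T hu hT
      rw [abs_div, abs_of_pos (ha.trans_le hT)]
      exact div_le_div₀ hM0 hu ha hT
    have h1 := hdiv _ _ (hK.bound ((xs j - xs k) / b)) (hpos1 j hj)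
    have h2 := hdiv _ _ (hK.bound ((xs j - xs k) / (√2 * b))) (hpos2 j hj)
    have h3 := abs_sub (2 * (K ((xs j - xs k) / b) / (∑ l, K ((xs j - xs l) / b))))
      (K ((xs j - xs k) / (√2 * b)) / (∑ l, K ((xs j - xs l) / (√2 * b))))
    rw [abs_mul, abs_two] at h3
    have e : 3 * M / a = 2 * (M / a) + M / a := by ring
    rw [e]
    exact h3.trans (by linarith)
  have hwsupp : ∀ j k, 2 * L * b < |xs j - xs k| → w j k = 0 := by
    intro j k hjk
    have h1 : K ((xs j - xs k) / b) = 0 := hK.support _ (by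
      rw [abs_div, abs_of_pos hb, lt_div_iff₀ hb]
      have : 0 ≤ L * b := by positivity
      linarith)
    have h2 : K ((xs j - xs k) / (√2 * b)) = 0 := hK.support _ (by
      rw [abs_div, abs_of_pos (by positivity : 0 < √2 * b), lt_div_iff₀ (by positivity)]
      have : L * (√2 * b) ≤ L * (2 * b) := by gcongr
      linarith)
    simp only [hw, h1, h2, zero_div, mul_zero, sub_zero]
  have hwJ' : ∀ j ∈ J, ∀ k ∉ J', w j k = 0 := by
    intro j hj k hk
    refine hwsupp j k ?_
    rw [hmemJ', not_le] at hk
    have h1 := (hmemJ j).1 hj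
    have h2 := abs_sub_le (xs k) (xs j) x
    rw [abs_sub_comm (xs k) (xs j)] at h2
    linarith
  have hrJ' : ∀ k ∈ J', |xs k - x| ≤ r := fun k hk => ((hmemJ' k).1 hk).trans hr
  have hF : ∀ v : Fin n → ℝ, residualEffect K m σ b h x xs v =
      ∑ j, K ((x - xs j) / h) * ((σ (xs j) * v j - (B j + ∑ k, c j k * v k)) ^ 2 -
        (σ (xs j) * v j) ^ 2) := by
    intro v
    refine Finset.sum_congr rfl fun j _ => ?_
    by_cases hj : j ∈ J
    · have e : ∑ k, w j k * (m (xs k) + σ (xs k) * v k) = m (xs j) + (B j + ∑ k, c j k * v k) := by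
        have e1 : m (xs j) = ∑ k, w j k * m (xs j) := by rw [← Finset.sum_mul, hwsum j hj, one_mul]
        rw [e1]
        simp only [hB, hc]
        rw [← Finset.sum_add_distrib, ← Finset.sum_add_distrib]
        exact Finset.sum_congr rfl fun k _ => by ring
      rw [hjack, e]
      congr 2
      ring
    · have : K ((x - xs j) / h) = 0 := hK.support _ (by
        rw [hmemJ, not_le] at hj
        rwa [abs_div, abs_of_pos hh, lt_div_iff₀ hh, abs_sub_comm])
      rw [this, zero_mul, zero_mul]
  simp_rw [hF]
  refine hν.lintegral_residual_le (J := J) (J' := J') ?_ hN hM0 hS0 (by positivity) (by positivity)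
    ?_ (fun j => hK.bound _) (fun j hj => hσ _ (hrJ' j (hJJ' hj))) ?_ ?_ ?_
  · exact le_trans (by exact_mod_cast Finset.card_le_card hJJ') hN
  · intro j hj
    refine hK.support _ ?_
    rw [hmemJ, not_le] at hj
    rwa [abs_div, abs_of_pos hh, lt_div_iff₀ hh, abs_sub_comm]
  · intro j hj
    simp only [hB]
    refine (Finset.abs_sum_le_sum_abs _ _).trans ?_
    rw [← Finset.sum_subset (Finset.subset_univ J') fun k _ hk => by
      rw [hwJ' j hj k hk, zero_mul, abs_zero]]
    refine (Finset.sum_le_card_nsmul _ _ (3 * M / a * (Λ * (2 * L * b))) fun k hk => ?_).trans ?_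
    · rcases le_or_gt |xs j - xs k| (2 * L * b) with hjk | hjk
      · rw [abs_mul]
        refine mul_le_mul (hwle j hj k) ?_ (abs_nonneg _) (by positivity)
        refine (hm _ _ (hrJ' k hk) (hrJ' j (hJJ' hj))).trans ?_
        rw [abs_sub_comm]
        gcongr
      · rw [hwsupp j k hjk, zero_mul, abs_zero]
        positivity
    · rw [nsmul_eq_mul]
      gcongr
  · intro j hj k
    simp only [hc]
    by_cases hk : k ∈ J'
    · rw [abs_mul]
      exact mul_le_mul (hwle j hj k) (hσ _ (hrJ' k hk)) (abs_nonneg _) (by positivity)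
    · rw [hwJ' j hj k hk, zero_mul, abs_zero]
      positivity
  · intro j hj k hk
    simp only [hc, hwJ' j hj k hk, zero_mul]

end Residual

/-! ### Bandwidth asymptotics. -/

section Bandwidth

variable {s : (n : ℕ) → Fin n → Plane} {b h : ℕ → ℝ} {γ κ : ℝ}

theorem BandwidthAssumption.exists_ratio (hA : BandwidthAssumption s b h γ κ) :
    ∃ C : ℝ, 0 < C ∧ ∀ᶠ n in atTop, b n ≤ C * h n ∧ h n ≤ C * b n := by
  obtain ⟨c1, h1, hb⟩ := hA.same_order.1.exists_pos
  obtain ⟨c2, h2, hh⟩ := hA.same_order.2.exists_pos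
  refine ⟨max c1 c2, by positivity, ?_⟩
  filter_upwards [hb.bound, hh.bound] with n hn1 hn2
  have hbn := hA.b_pos n
  have hhn := hA.h_pos n
  rw [Real.norm_eq_abs, Real.norm_eq_abs, abs_of_pos hbn, abs_of_pos hhn] at hn1 hn2
  constructor
  · exact hn1.trans (by gcongr; exact le_max_left _ _)
  · exact hn2.trans (by gcongr; exact le_max_right _ _)

theorem BandwidthAssumption.tendsto_mul_b (hA : BandwidthAssumption s b h γ κ) :
    Tendsto (fun n : ℕ => (n : ℝ) * b n) atTop atTop := by
  obtain ⟨C, hC, hr⟩ := hA.exists_ratio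
  have h1 := hA.linear.atTop_mul_const (show 0 < (1 + C)⁻¹ by positivity)
  refine tendsto_atTop_mono' _ ?_ h1
  filter_upwards [hr] with n hn
  rw [← div_eq_mul_inv, div_le_iff₀ (by positivity)]
  have : (0 : ℝ) ≤ n := Nat.cast_nonneg n
  nlinarith [mul_le_mul_of_nonneg_left hn.2 this]

theorem BandwidthAssumption.tendsto_mul_h (hA : BandwidthAssumption s b h γ κ) :
    Tendsto (fun n : ℕ => (n : ℝ) * h n) atTop atTop := by
  obtain ⟨C, hC, hr⟩ := hA.exists_ratio
  have h1 := hA.linear.atTop_mul_const (show 0 < (1 + C)⁻¹ by positivity)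
  refine tendsto_atTop_mono' _ ?_ h1
  filter_upwards [hr] with n hn
  rw [← div_eq_mul_inv, div_le_iff₀ (by positivity)]
  have : (0 : ℝ) ≤ n := Nat.cast_nonneg n
  nlinarith [mul_le_mul_of_nonneg_left hn.1 this]

theorem BandwidthAssumption.tendsto_inv_sqrt (hA : BandwidthAssumption s b h γ κ) :
    Tendsto (fun n : ℕ => (√((n : ℝ) * h n))⁻¹) atTop (𝓝 0) :=
  tendsto_inv_atTop_zero.comp (Real.tendsto_sqrt_atTop.comp hA.tendsto_mul_h)

theorem BandwidthAssumption.tendsto_sqrt_fifth (hA : BandwidthAssumption s b h γ κ) :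
    Tendsto (fun n : ℕ => √((n : ℝ) * h n) * h n ^ 2) atTop (𝓝 0) := by
  have h1 := hA.h_fifth.sqrt
  rw [Real.sqrt_zero] at h1
  refine h1.congr fun n => ?_
  have := hA.h_pos n
  rw [show (n : ℝ) * h n ^ 5 = (n * h n) * (h n ^ 2) ^ 2 by ring,
    Real.sqrt_mul (by positivity), Real.sqrt_sq (by positivity)]

end Bandwidth

/-! ### Bounds for local sums and the rate of the residual effect. -/

theorem abs_sum_local_le {G : ℝ → ℝ} {M L : ℝ} (hG : LocalFun G M L) {n : ℕ} (xs : Fin n → ℝ)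
    {x h D : ℝ} (hh : 0 < h) {u : ℝ → ℝ} (hu : ∀ y, |y - x| ≤ L * h → |u y| ≤ D) :
    |∑ j, G ((xs j - x) / h) * u (xs j)| ≤ D * ∑ j, |G ((xs j - x) / h)| := by
  rw [Finset.mul_sum]
  refine (Finset.abs_sum_le_sum_abs _ _).trans (Finset.sum_le_sum fun j _ => ?_)
  rw [abs_mul, mul_comm]
  rcases le_or_gt |xs j - x| (L * h) with hj | hj
  · exact mul_le_mul_of_nonneg_right (hu _ hj) (abs_nonneg _)
  · have : G ((xs j - x) / h) = 0 := hG.support _ (by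
      rwa [abs_div, abs_of_pos hh, lt_div_iff₀ hh])
    rw [this, abs_zero, mul_zero, mul_zero]

/-- The bound of `lintegral_residualEffect_le` with window count Cy, denominators cy and y = nh,
divided by √y. The three summands come from the squared bias, from terms free of bias, and from the
bias times a centred error. -/
theorem residual_rate_le {M S Λ L C c Cb y b h : ℝ} (hM : 0 ≤ M) (hC : 0 < C) (hc : 0 < c)
    (hy : 0 < y) (hb : 0 ≤ b) (hbh : b ≤ Cb * h) :
    (√y)⁻¹ * (2 * M * (C * y) * ((C * y * (3 * M / (c * y) * (Λ * (2 * L * b)))) ^ 2 +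
          C * y * (3 * M / (c * y) * S) ^ 2) +
        2 * (M * S * (C * y * (3 * M / (c * y) * (Λ * (2 * L * b)))) * √(C * y)) +
        2 * (M * S * (3 * M / (c * y) * S) * (C * y)) +
        2 * (√2 * (M * S * (3 * M / (c * y) * S) * (C * y)))) ≤
      2 * M * C * (2 * (C * (3 * M) / c) * Λ * L) ^ 2 * Cb ^ 2 * (√y * h ^ 2) +
      (2 * M * C * (C * (3 * M) / c) * (3 * M / c) * S ^ 2 + 2 * M * S ^ 2 * (C * (3 * M) / c) +
        2 * √2 * M * S ^ 2 * (C * (3 * M) / c)) * (√y)⁻¹ +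
      4 * M * S * (C * (3 * M) / c) * Λ * L * √C * b := by
  have hsy : √y * √y = y := Real.mul_self_sqrt hy.le
  have hsy0 : 0 < √y := Real.sqrt_pos.2 hy
  set w := C * (3 * M) / c with hw
  have hb2 : b ^ 2 ≤ Cb ^ 2 * h ^ 2 := by
    rw [← mul_pow]; exact pow_le_pow_left₀ hb hbh 2
  have e1 : C * y * (3 * M / (c * y) * (Λ * (2 * L * b))) = 2 * w * Λ * L * b := by
    rw [hw]; field_simp
  have e2 : C * y * (3 * M / (c * y) * S) ^ 2 = w * (3 * M / c) * S ^ 2 / y := by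
    rw [hw]; field_simp
  have e3 : M * S * (3 * M / (c * y) * S) * (C * y) = M * S ^ 2 * w := by
    rw [hw]; field_simp
  have e5 : (√y)⁻¹ * y = √y := by
    calc (√y)⁻¹ * y = (√y)⁻¹ * (√y * √y) := by rw [hsy]
      _ = √y := by rw [← mul_assoc, inv_mul_cancel₀ hsy0.ne', one_mul]
  have e6 : (√y)⁻¹ * √y = 1 := inv_mul_cancel₀ hsy0.ne'
  have e7 : y / y = 1 := div_self hy.ne'
  rw [e1, e2, e3, Real.sqrt_mul hC.le]
  have e4 : (√y)⁻¹ * (2 * M * (C * y) * ((2 * w * Λ * L * b) ^ 2 + w * (3 * M / c) * S ^ 2 / y) +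
        2 * (M * S * (2 * w * Λ * L * b) * (√C * √y)) + 2 * (M * S ^ 2 * w) +
        2 * (√2 * (M * S ^ 2 * w))) =
      2 * M * C * (2 * w * Λ * L) ^ 2 * (((√y)⁻¹ * y) * b ^ 2) +
      (2 * M * C * (y / y) * w * (3 * M / c) * S ^ 2 + 2 * M * S ^ 2 * w +
        2 * √2 * M * S ^ 2 * w) * (√y)⁻¹ + 4 * M * S * w * Λ * L * √C * ((√y)⁻¹ * √y) * b := by
    ring
  have hfin : 2 * M * C * (2 * w * Λ * L) ^ 2 * (√y * b ^ 2) ≤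
      2 * M * C * (2 * w * Λ * L) ^ 2 * (√y * (Cb ^ 2 * h ^ 2)) := by gcongr
  rw [e4, e5, e6, e7, mul_one, mul_one]
  refine add_le_add (add_le_add (hfin.trans (le_of_eq (by ring))) le_rfl) le_rfl

theorem measurable_residualEffect {K m σ : ℝ → ℝ} (hK : Measurable K) (hm : Measurable m)
    (hσ : Measurable σ) (n : ℕ) (b h x : ℝ) :
    Measurable fun z : (Fin n → ℝ) × (Fin n → ℝ) => residualEffect K m σ b h x z.1 z.2 := by
  unfold residualEffect jackknifeMeanEst meanEst densityEst
  fun_prop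

/-! ### Limits of the local sums at a design point. -/

section Limits

variable {Ω : Type*} [MeasurableSpace Ω] {P : Measure Ω}
  {X V : Plane → Ω → ℝ} {s : (n : ℕ) → Fin n → Plane} {m σ f K : ℝ → ℝ} {ν : Measure ℝ}
  {I : Set ℝ} {ε : ℝ} {b h : ℕ → ℝ} {φ : ℝ → ℝ} {ψ : ℕ → ℕ → ℝ} {γ κ : ℝ} {x : ℝ}

theorem ModelAssumption.mem_thickening (hA : ModelAssumption P X V s m σ f ν I ε κ) (hx : x ∈ I) :
    x ∈ Metric.thickening ε I :=
  Metric.self_subset_thickening hA.eps_pos I hx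

theorem BddContDiffOn.contDiffAt {p : ℕ} {g : ℝ → ℝ} {S : Set ℝ} (hg : BddContDiffOn p g S)
    (hS : IsOpen S) (hx : x ∈ S) : ContDiffAt ℝ p g x :=
  hg.1.contDiffAt (hS.mem_nhds hx)

theorem ModelAssumption.contDiffAt_f (hA : ModelAssumption P X V s m σ f ν I ε κ) (hx : x ∈ I) :
    ContDiffAt ℝ 1 f x := by
  simpa using hA.f_smooth.contDiffAt Metric.isOpen_thickening (hA.mem_thickening hx)

theorem ModelAssumption.contDiffAt_m (hA : ModelAssumption P X V s m σ f ν I ε κ) (hx : x ∈ I) :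
    ContDiffAt ℝ 1 m x :=
  (hA.m_smooth.contDiffAt Metric.isOpen_thickening (hA.mem_thickening hx)).of_le (by norm_num)

theorem ModelAssumption.contDiffAt_σ (hA : ModelAssumption P X V s m σ f ν I ε κ) (hx : x ∈ I) :
    ContDiffAt ℝ 2 σ x := by
  simpa using hA.σ_smooth.contDiffAt Metric.isOpen_thickening (hA.mem_thickening hx)

theorem ModelAssumption.f_pos_at (hA : ModelAssumption P X V s m σ f ν I ε κ) (hx : x ∈ I) :
    0 < f x := by
  obtain ⟨c, hc, h⟩ := hA.f_pos
  exact hc.trans_le (h x (hA.mem_thickening hx))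

theorem ModelAssumption.σ_pos_at (hA : ModelAssumption P X V s m σ f ν I ε κ) (hx : x ∈ I) :
    0 < σ x := by
  obtain ⟨c, hc, h⟩ := hA.σ_pos
  exact hc.trans_le (h x (hA.mem_thickening hx))

theorem KernelAssumption.comp_sub_comm (hK : KernelAssumption K) (x y c : ℝ) :
    K ((x - y) / c) = K ((y - x) / c) := by
  rw [← hK.symmetric, ← neg_div, neg_sub]

theorem tendsto_average_h [IsProbabilityMeasure P] (hs : DEISampling s)
    (hA1 : ProcessAssumption P X s h φ ψ γ κ) (hA2 : BandwidthAssumption s b h γ κ)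
    (hA4 : ModelAssumption P X V s m σ f ν I ε κ) (hx : x ∈ I)
    {g : ℝ → ℝ} {M L : ℝ} (hg : LocalFun g M L) :
    Tendsto (fun p : ℕ × Ω => ((p.1 : ℝ) * h p.1)⁻¹ * ∑ j, g ((X (s p.1 j) p.2 - x) / h p.1))
      (whp P) (𝓝 (f x * ∫ z, g z)) :=
  tendsto_local_average hs hA1 hA2 hA4 hg (hA4.contDiffAt_f hx).continuousAt hA2.h_pos (c := 1)
    (fun n => by have := hA2.b_pos n; linarith) hA2.h_tendsto hA2.tendsto_mul_h

theorem tendsto_kernel_average [IsProbabilityMeasure P] (hs : DEISampling s)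
    (hA1 : ProcessAssumption P X s h φ ψ γ κ) (hA2 : BandwidthAssumption s b h γ κ)
    (hA3 : KernelAssumption K) (hA4 : ModelAssumption P X V s m σ f ν I ε κ) (hx : x ∈ I) :
    Tendsto (fun p : ℕ × Ω => ((p.1 : ℝ) * h p.1)⁻¹ * ∑ j, K ((x - X (s p.1 j) p.2) / h p.1))
      (whp P) (𝓝 (f x)) := by
  obtain ⟨M, L, hK⟩ := hA3.exists_localFun
  have h1 := tendsto_average_h hs hA1 hA2 hA4 hx hK
  rw [hA3.integral_one, mul_one] at h1
  simp_rw [hA3.comp_sub_comm x]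
  exact h1

/-- On the kernel window σ⁴ differs from its value at `x` by O(h), so the average reduces to that of
K². -/
theorem tendsto_weighted_sq_average [IsProbabilityMeasure P] (hs : DEISampling s)
    (hA1 : ProcessAssumption P X s h φ ψ γ κ) (hA2 : BandwidthAssumption s b h γ κ)
    (hA3 : KernelAssumption K) (hA4 : ModelAssumption P X V s m σ f ν I ε κ) (hx : x ∈ I) :
    Tendsto (fun p : ℕ × Ω => ((p.1 : ℝ) * h p.1)⁻¹ *
      ∑ j, K ((x - X (s p.1 j) p.2) / h p.1) ^ 2 * σ (X (s p.1 j) p.2) ^ 4)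
      (whp P) (𝓝 (f x * (∫ z, K z ^ 2) * σ x ^ 4)) := by
  obtain ⟨M, L, hK⟩ := hA3.exists_localFun
  have h1 := tendsto_average_h hs hA1 hA2 hA4 hx hK.sq
  have hσ4 : ContDiffAt ℝ 1 (fun y => σ y ^ 4) x :=
    ((hA4.contDiffAt_σ hx).of_le (by norm_num)).pow 4
  obtain ⟨r, hr, Λ, hΛ, hlip⟩ := exists_lipschitz_near hσ4
  have hL0 := hK.radius_nonneg
  have hhw : Tendsto (fun p : ℕ × Ω => h p.1) (whp P) (𝓝 0) :=
    hA2.h_tendsto.comp (tendsto_fst_whp P)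
  have h2 : Tendsto (fun p : ℕ × Ω => ((p.1 : ℝ) * h p.1)⁻¹ *
      ∑ j, K ((X (s p.1 j) p.2 - x) / h p.1) ^ 2 * (σ (X (s p.1 j) p.2) ^ 4 - σ x ^ 4))
      (whp P) (𝓝 0) := by
    have h3 := (hhw.const_mul (Λ * L)).mul h1
    rw [mul_zero, zero_mul] at h3
    have h4 : Tendsto (fun p : ℕ × Ω => L * h p.1) (whp P) (𝓝 0) := by
      simpa using hhw.const_mul L
    refine squeeze_zero_norm' ?_ h3
    filter_upwards [h4.eventually (eventually_lt_nhds hr)] with p hp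
    have hhp := hA2.h_pos p.1
    have h5 := abs_sum_local_le hK.sq (fun j => X (s p.1 j) p.2) (x := x) hhp
      (u := fun y => σ y ^ 4 - σ x ^ 4) (D := Λ * L * h p.1) (fun y hy => by
        refine (hlip y x (hy.trans hp.le) (by simpa using hr.le)).trans ?_
        rw [mul_assoc]
        gcongr)
    have h6 : ∀ j, |K ((X (s p.1 j) p.2 - x) / h p.1) ^ 2| =
        K ((X (s p.1 j) p.2 - x) / h p.1) ^ 2 :=
      fun j => abs_of_nonneg (sq_nonneg _)
    simp_rw [h6] at h5
    have hn0 : (0 : ℝ) ≤ p.1 := Nat.cast_nonneg _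
    rw [Real.norm_eq_abs, abs_mul, abs_of_nonneg (by positivity : 0 ≤ ((p.1 : ℝ) * h p.1)⁻¹)]
    calc _ ≤ ((p.1 : ℝ) * h p.1)⁻¹ * (Λ * L * h p.1 *
          ∑ j, K ((X (s p.1 j) p.2 - x) / h p.1) ^ 2) := by gcongr
      _ = _ := by ring
  have h3 := (h1.mul_const (σ x ^ 4)).add h2
  rw [add_zero] at h3
  refine h3.congr fun p => ?_
  simp_rw [hA3.comp_sub_comm x]
  rw [mul_assoc, ← mul_add, Finset.sum_mul, ← Finset.sum_add_distrib]
  congr 1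
  exact Finset.sum_congr rfl fun j _ => by ring

/-- The smoothing bias of the variance estimator is negligible. -/
theorem tendsto_bias [IsProbabilityMeasure P] (hs : DEISampling s)
    (hA1 : ProcessAssumption P X s h φ ψ γ κ) (hA2 : BandwidthAssumption s b h γ κ)
    (hA3 : KernelAssumption K) (hA4 : ModelAssumption P X V s m σ f ν I ε κ) (hx : x ∈ I) :
    Tendsto (fun p : ℕ × Ω => (√((p.1 : ℝ) * h p.1))⁻¹ *
      ∑ j, K ((x - X (s p.1 j) p.2) / h p.1) * (σ (X (s p.1 j) p.2) ^ 2 - σ x ^ 2))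
      (whp P) (𝓝 0) := by
  obtain ⟨M, L, hK⟩ := hA3.exists_localFun
  have hL0 := hK.radius_nonneg
  obtain ⟨r, hr, C, hC, a, hquad⟩ := exists_quadratic_near ((hA4.contDiffAt_σ hx).pow 2)
  obtain ⟨r', hr', Λ, hΛ, hlip⟩ := exists_lipschitz_near (hA4.contDiffAt_f hx)
  -- By symmetry of the kernel, the linear Taylor term of σ² is a local sum with a centred kernel.
  have hodd : ∫ z, z * K z = 0 := by
    have h1 := integral_neg_eq_self (fun z => z * K z) volume
    simp_rw [hA3.symmetric, neg_mul] at h1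
    rw [integral_neg] at h1
    linarith
  have h1 := tendsto_centred_local_sum hs hA1 hA2 hA4 hK.id_mul hodd hr'
    (fun y hy => hlip y x hy (by simpa using hr'.le)) hA2.h_pos (c := 1)
    (fun n => by have := hA2.b_pos n; linarith) hA2.h_tendsto hA2.h_fifth
  have h2 := tendsto_average_h hs hA1 hA2 hA4 hx hK.abs
  have hhw : Tendsto (fun p : ℕ × Ω => h p.1) (whp P) (𝓝 0) :=
    hA2.h_tendsto.comp (tendsto_fst_whp P)
  -- The remainder is O(h²) on a window with O(nh) observations, hence O(√(nh) h²) after scaling.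
  have h3 : Tendsto (fun p : ℕ × Ω => (√((p.1 : ℝ) * h p.1))⁻¹ *
      ∑ j, K ((X (s p.1 j) p.2 - x) / h p.1) *
        (σ (X (s p.1 j) p.2) ^ 2 - σ x ^ 2 - a * (X (s p.1 j) p.2 - x))) (whp P) (𝓝 0) := by
    have h4 := ((hA2.tendsto_sqrt_fifth.comp (tendsto_fst_whp P)).const_mul (C * L ^ 2)).mul h2
    rw [mul_zero, zero_mul] at h4
    have h5 : Tendsto (fun p : ℕ × Ω => L * h p.1) (whp P) (𝓝 0) := by
      simpa using hhw.const_mul L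
    refine squeeze_zero_norm' ?_ h4
    filter_upwards [h5.eventually (eventually_lt_nhds hr),
      (tendsto_fst_whp P).eventually (eventually_gt_atTop 0)] with p hp hp0
    have hhp := hA2.h_pos p.1
    have hn0 : (0 : ℝ) < p.1 := by exact_mod_cast hp0
    have h6 := abs_sum_local_le hK (fun j => X (s p.1 j) p.2) (x := x) hhp
      (u := fun y => σ y ^ 2 - σ x ^ 2 - a * (y - x)) (D := C * (L * h p.1) ^ 2) (fun y hy => by
        refine (hquad y (hy.trans hp.le)).trans ?_
        rw [← sq_abs]
        gcongr)
    have hsq : √((p.1 : ℝ) * h p.1) * √((p.1 : ℝ) * h p.1) = p.1 * h p.1 :=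
      Real.mul_self_sqrt (by positivity)
    have hspos : 0 < √((p.1 : ℝ) * h p.1) := Real.sqrt_pos.2 (by positivity)
    rw [Real.norm_eq_abs, abs_mul, abs_of_nonneg (by positivity : 0 ≤ (√((p.1 : ℝ) * h p.1))⁻¹)]
    simp only [Function.comp_apply]
    calc _ ≤ (√((p.1 : ℝ) * h p.1))⁻¹ * (C * (L * h p.1) ^ 2 *
          ∑ j, |K ((X (s p.1 j) p.2 - x) / h p.1)|) := by gcongr
      _ = _ := by
        have e : (√((p.1 : ℝ) * h p.1))⁻¹ = √((p.1 : ℝ) * h p.1) * ((p.1 : ℝ) * h p.1)⁻¹ := by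
          have h7 : √((p.1 : ℝ) * h p.1) * ((p.1 : ℝ) * h p.1)⁻¹ =
              √((p.1 : ℝ) * h p.1) * (√((p.1 : ℝ) * h p.1) * √((p.1 : ℝ) * h p.1))⁻¹ := by rw [hsq]
          rw [h7]
          field_simp
        rw [e]
        ring
  have h4 := (h1.const_mul a).add h3
  rw [mul_zero, add_zero] at h4
  refine h4.congr fun p => ?_
  have hhp := hA2.h_pos p.1
  simp_rw [hA3.comp_sub_comm x]
  have e : a * ((√((p.1 : ℝ) * h p.1))⁻¹ * h p.1 * ∑ j, (X (s p.1 j) p.2 - x) / h p.1 *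
      K ((X (s p.1 j) p.2 - x) / h p.1)) = (√((p.1 : ℝ) * h p.1))⁻¹ *
      ∑ j, K ((X (s p.1 j) p.2 - x) / h p.1) * (a * (X (s p.1 j) p.2 - x)) := by
    rw [mul_assoc, mul_left_comm, Finset.mul_sum, Finset.mul_sum]
    congr 1
    refine Finset.sum_congr rfl fun j _ => ?_
    field_simp
  rw [e, ← mul_add, ← Finset.sum_add_distrib]
  congr 1
  exact Finset.sum_congr rfl fun j _ => by ring

/-- Replacing the errors by the residuals has a negligible effect. -/
theorem tendsto_residualEffect [IsProbabilityMeasure P] (hs : DEISampling s)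
    (hA1 : ProcessAssumption P X s h φ ψ γ κ) (hA2 : BandwidthAssumption s b h γ κ)
    (hA3 : KernelAssumption K) (hA4 : ModelAssumption P X V s m σ f ν I ε κ) (hx : x ∈ I) :
    Tendsto (fun p : ℕ × Ω => (√((p.1 : ℝ) * h p.1))⁻¹ *
      residualEffect K m σ (b p.1) (h p.1) x (fun j => X (s p.1 j) p.2)
        (fun j => V (s p.1 j) p.2)) (whp P) (𝓝 0) := by
  obtain ⟨M, L, hK⟩ := hA3.exists_localFun
  have hL0 := hK.radius_nonneg
  have hM0 := hK.bound_nonneg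
  have hν := hA4.stdNoise hA1.kappa_pos
  have hprob := hν.prob
  have hf0 := hA4.f_pos_at hx
  have hfc := (hA4.contDiffAt_f hx).continuousAt
  obtain ⟨r1, hr1, Λ, hΛ, hlip⟩ := exists_lipschitz_near (hA4.contDiffAt_m hx)
  obtain ⟨r2, hr2, Λ', hΛ', hlip'⟩ := exists_lipschitz_near
    ((hA4.contDiffAt_σ hx).of_le (by norm_num : (1 : WithTop ℕ∞) ≤ 2))
  obtain ⟨Cb, hCb, hratio⟩ := hA2.exists_ratio
  set r := min r1 r2 with hr
  have hr0 : 0 < r := by positivity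
  set S := |σ x| + Λ' * r2 with hS
  have hS0 : 0 ≤ S := by positivity
  have hσS : ∀ y, |y - x| ≤ r → |σ y| ≤ S := by
    intro y hy
    have h1 := hlip' y x (hy.trans (min_le_right _ _)) (by simpa using hr2.le)
    have h2 : Λ' * |y - x| ≤ Λ' * r2 := by
      gcongr
      exact hy.trans (min_le_right _ _)
    have h3 := abs_sub_abs_le_abs_sub (σ y) (σ x)
    linarith
  -- In units of h, this contains the window of radius Lh + 2Lb holding every observation that
  -- enters the residuals.
  set R := L + 2 * L * Cb with hR
  have hR0 : 0 ≤ R := by positivity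
  have hind : LocalFun ((Icc (-R) R).indicator fun _ => (1 : ℝ)) 1 R :=
    ⟨measurable_const.indicator measurableSet_Icc, fun z => by
      by_cases hz : z ∈ Icc (-R) R <;> simp [hz], fun z hz => by
      refine indicator_of_notMem (fun hz' => ?_) _
      exact absurd (abs_le.2 hz') (not_le.2 hz), zero_le_one, hR0⟩
  set C1 := f x * (∫ z, (Icc (-R) R).indicator (fun _ => (1 : ℝ)) z) + 1 with hC1
  have hC10 : 0 < C1 := by
    have : 0 ≤ ∫ z, (Icc (-R) R).indicator (fun _ => (1 : ℝ)) z :=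
      integral_nonneg fun z => indicator_nonneg (fun _ _ => zero_le_one) z
    positivity
  -- The denominators are at least f(x)/2 · nb, and nb ≥ nh/Cb.
  set c1 := f x / (2 * Cb) with hc1
  have hc10 : 0 < c1 := by positivity
  set w0 := C1 * (3 * M) / c1 with hw0
  set k1 := 2 * M * C1 * (2 * w0 * Λ * L) ^ 2 * Cb ^ 2 with hk1
  set k2 := 2 * M * C1 * w0 * (3 * M / c1) * S ^ 2 + 2 * M * S ^ 2 * w0 +
    2 * √2 * M * S ^ 2 * w0 with hk2
  set k3 := 4 * M * S * w0 * Λ * L * √C1 with hk3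
  set rate : ℕ → ℝ := fun n => k1 * (√((n : ℝ) * h n) * h n ^ 2) + k2 * (√((n : ℝ) * h n))⁻¹ +
    k3 * b n with hrate
  have hratet : Tendsto rate atTop (𝓝 0) := by
    have := ((hA2.tendsto_sqrt_fifth.const_mul k1).add (hA2.tendsto_inv_sqrt.const_mul k2)).add
      (hA2.b_tendsto.const_mul k3)
    simpa only [mul_zero, add_zero] using this
  -- It suffices to bound the conditional first moment given the covariates, on covariate events
  -- whose probability tends to one.
  refine tendsto_whp_of_conditional (fun n => Measure.pi fun _ : Fin n => ν)
    (U := fun n ω j => X (s n j) ω) (W := fun n ω j => V (s n j) ω)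
    (fun n => measurable_pi_lambda _ fun j => hA1.measurable _)
    (fun n => measurable_pi_lambda _ fun j => hA4.V_measurable _)
    (fun n => hA4.joint_law hA1.measurable n)
    (F := fun n z => (√((n : ℝ) * h n))⁻¹ * residualEffect K m σ (b n) (h n) x z.1 z.2)
    (fun n => (measurable_residualEffect hA3.measurable hA4.m_measurable hA4.σ_measurable n _ _
      _).const_mul _) hratet ?_
  have hcount := (tendsto_average_h hs hA1 hA2 hA4 hx hind).eventually
    (eventually_lt_nhds (show _ < C1 by rw [hC1]; linarith))
  have hlow1 := eventually_kernel_sum_ge hs hA1 hA2 hA3 hA4 hfc hf0 hA2.b_pos (c := 1)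
    (fun n => by have := hA2.h_pos n; linarith) hA2.b_tendsto hA2.tendsto_mul_b (L * Cb)
  have hs2 : (1 : ℝ) ≤ √2 := Real.one_le_sqrt.2 (by norm_num)
  have hs2' : √2 ≤ 2 := by
    rw [Real.sqrt_le_left (by norm_num)]; norm_num
  have hlow2 := eventually_kernel_sum_ge hs hA1 hA2 hA3 hA4 hfc hf0 (β := fun n => √2 * b n)
    (fun n => mul_pos (by positivity) (hA2.b_pos n)) (c := 2)
    (fun n => by
      have h1 := hA2.h_pos n
      have h2 := hA2.b_pos n
      nlinarith) (by simpa using hA2.b_tendsto.const_mul √2)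
    (by
      have := hA2.tendsto_mul_b.const_mul_atTop (show 0 < √2 by positivity)
      refine this.congr fun n => ?_
      ring) (L * Cb)
  have hsmall : Tendsto (fun n => L * h n + 2 * L * b n) atTop (𝓝 0) := by
    simpa using (hA2.h_tendsto.const_mul L).add (hA2.b_tendsto.const_mul (2 * L))
  filter_upwards [hcount, hlow1, hlow2, (tendsto_fst_whp P).eventually hratio,
    (tendsto_fst_whp P).eventually (hsmall.eventually (eventually_lt_nhds hr0)),
    (tendsto_fst_whp P).eventually (eventually_gt_atTop 0)] with p hp1 hp2 hp3 hp4 hp5 hp6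
  obtain ⟨n, ω⟩ := p
  simp only at hp1 hp2 hp3 hp4 hp5 hp6 ⊢
  have hn0 : (0 : ℝ) < n := by exact_mod_cast hp6
  have hhn := hA2.h_pos n
  have hbn := hA2.b_pos n
  set y := (n : ℝ) * h n with hy
  have hy0 : 0 < y := by positivity
  have hsy : √y * √y = y := Real.mul_self_sqrt hy0.le
  have hsy0 : 0 < √y := Real.sqrt_pos.2 hy0
  have hcard : (({k | |X (s n k) ω - x| ≤ L * h n + 2 * L * b n} : Finset (Fin n)).card : ℝ) ≤
      C1 * y := by
    rw [inv_mul_eq_div, div_lt_iff₀ hy0] at hp1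
    refine le_trans ?_ hp1.le
    rw [Finset.card_filter, Nat.cast_sum]
    refine Finset.sum_le_sum fun k _ => ?_
    split_ifs with hk
    · rw [indicator_of_mem]
      · simp
      · rw [mem_Icc, ← abs_le, abs_div, abs_of_pos hhn, div_le_iff₀ hhn]
        refine hk.trans ?_
        have := mul_le_mul_of_nonneg_left hp4.1 (by positivity : 0 ≤ 2 * L)
        rw [hR]; linarith
    · simp only [Nat.cast_zero]
      exact indicator_nonneg (fun _ _ => zero_le_one) _
  have hnb : c1 * y ≤ f x / 2 * (n * b n) := by
    have e : c1 * y = f x / 2 * (n * (h n / Cb)) := by rw [hc1, hy]; field_simp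
    rw [e]
    gcongr
    rw [div_le_iff₀ hCb]; linarith [hp4.2]
  have hLh : ∀ y', |y' - x| ≤ L * h n → |y' - x| ≤ L * Cb * b n := fun y' h' =>
    h'.trans (by rw [mul_assoc]; exact mul_le_mul_of_nonneg_left hp4.2 hL0)
  have key := lintegral_residualEffect_le hν hK (m := m) (σ := σ) hp6.ne'
    (fun j => X (s n j) ω) (x := x)
    (r := r) (Λ := Λ) (S := S) (a := c1 * y) (N := C1 * y) hbn hhn hΛ
    (fun y y' h1 h2 => hlip y y' (h1.trans (min_le_left _ _)) (h2.trans (min_le_left _ _)))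
    hσS hp5.le hcard (by positivity) (fun y' h' => hnb.trans (hp2 y' (hLh y' h')))
    (fun y' h' => (hnb.trans ?_).trans (hp3 y' ((hLh y' h').trans ?_)))
  · have e : ∀ v : Fin n → ℝ, ‖(√y)⁻¹ * residualEffect K m σ (b n) (h n) x
        (fun j => X (s n j) ω) v‖ₑ = ENNReal.ofReal (√y)⁻¹ *
          ‖residualEffect K m σ (b n) (h n) x (fun j => X (s n j) ω) v‖ₑ := by
      intro v
      rw [enorm_mul, Real.enorm_of_nonneg (by positivity)]
    simp_rw [e]
    rw [lintegral_const_mul' _ _ ENNReal.ofReal_ne_top]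
    refine (mul_le_mul_right key _).trans ?_
    rw [← ENNReal.ofReal_mul (by positivity)]
    refine ENNReal.ofReal_le_ofReal ?_
    refine (residual_rate_le hM0 hC10 hc10 hy0 hbn.le hp4.1).trans (le_of_eq ?_)
    simp only [hrate, hk1, hk2, hk3, hw0, hy]
  · gcongr
    exact le_mul_of_one_le_left hbn.le hs2
  · gcongr
    exact le_mul_of_one_le_left hbn.le hs2

end Limits

/-! ### The leading weighted sum and its limit law. -/

/-- The weight of the centred squared error of observation `j` in the leading term of the variance
estimator at `x`, standardized by `c √(n h)`. -/
noncomputable def errorWeight (K σ : ℝ → ℝ) (h c x : ℝ) {n : ℕ} (xs : Fin n → ℝ) (j : Fin n) : ℝ :=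
  c * √(n * h) * ((∑ l, K ((x - xs l) / h))⁻¹ * (K ((x - xs j) / h) * σ (xs j) ^ 2))

theorem measurable_errorWeight {K σ : ℝ → ℝ} (hK : Measurable K) (hσ : Measurable σ) (h c x : ℝ)
    {n : ℕ} (j : Fin n) : Measurable fun xs : Fin n → ℝ => errorWeight K σ h c x xs j := by
  unfold errorWeight
  fun_prop

/-- Separates the rate from the convergent average A/(nh). No condition on `A` is needed, as both
sides are 0 when A = 0. -/
theorem sqrt_mul_inv_eq {y : ℝ} (hy : 0 < y) (A : ℝ) : √y * A⁻¹ = (√y)⁻¹ * (y⁻¹ * A)⁻¹ := by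
  have h1 : √y * √y = y := Real.mul_self_sqrt hy.le
  have h2 : 0 < √y := Real.sqrt_pos.2 hy
  have h3 : (√y)⁻¹ * y = √y := by
    rw [inv_mul_eq_div, div_eq_iff h2.ne', h1]
  rw [mul_inv, inv_inv, ← mul_assoc, h3]

section Leading

variable {Ω : Type*} [MeasurableSpace Ω] {P : Measure Ω}
  {X V : Plane → Ω → ℝ} {s : (n : ℕ) → Fin n → Plane} {m σ f K : ℝ → ℝ} {ν : Measure ℝ}
  {I : Set ℝ} {ε : ℝ} {b h : ℕ → ℝ} {φ : ℝ → ℝ} {ψ : ℕ → ℕ → ℝ} {γ κ : ℝ} {x : ℝ}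

/-- The standardized variance estimator is asymptotically equivalent to a weighted sum of the
centred squared errors. -/
theorem tendsto_varianceEst_sub_leading [IsProbabilityMeasure P] (hs : DEISampling s)
    (hA1 : ProcessAssumption P X s h φ ψ γ κ) (hA2 : BandwidthAssumption s b h γ κ)
    (hA3 : KernelAssumption K) (hA4 : ModelAssumption P X V s m σ f ν I ε κ) (hx : x ∈ I)
    (c : ℝ) :
    Tendsto (fun p : ℕ × Ω => c * √((p.1 : ℝ) * h p.1) *
        (varianceEst K (fun j : Fin p.1 => X (s p.1 j) p.2)
          (fun j : Fin p.1 => response m σ X V (s p.1 j) p.2) (b p.1) (h p.1) x - σ x ^ 2) -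
        ∑ j, errorWeight K σ (h p.1) c x (fun k => X (s p.1 k) p.2) j *
          (V (s p.1 j) p.2 ^ 2 - 1)) (whp P) (𝓝 0) := by
  have hf := hA4.f_pos_at hx
  have hav := tendsto_kernel_average hs hA1 hA2 hA3 hA4 hx
  have h1 := ((hav.inv₀ hf.ne').const_mul c).mul ((tendsto_bias hs hA1 hA2 hA3 hA4 hx).add
    (tendsto_residualEffect hs hA1 hA2 hA3 hA4 hx))
  rw [add_zero, mul_zero] at h1
  refine h1.congr' ?_
  filter_upwards [hav.eventually (eventually_gt_nhds hf),
    (tendsto_fst_whp P).eventually (eventually_gt_atTop 0)] with p hp hp0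
  obtain ⟨n, ω⟩ := p
  simp only at hp hp0 ⊢
  have hn0 : (0 : ℝ) < n := by exact_mod_cast hp0
  have hhn := hA2.h_pos n
  have hy : 0 < (n : ℝ) * h n := by positivity
  rw [varianceEst_eq hp0.ne' _ _ _ hhn.ne']
  unfold errorWeight residualEffect response
  set A := ∑ l, K ((x - X (s n l) ω) / h n) with hA
  have hA0 : A ≠ 0 := by
    rintro h0
    rw [h0, mul_zero] at hp
    exact lt_irrefl _ hp
  -- Writing σ²(x) as A⁻¹ A σ²(x), possible because A ≠ 0, puts everything under one kernel sum,
  -- which then splits into leading term, bias and residual effect.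
  have e1 : ∀ S : ℝ, c * √(n * h n) * (A⁻¹ * S - σ x ^ 2) =
      c * (√(n * h n) * A⁻¹) * (S - A * σ x ^ 2) := by
    intro S
    field_simp
  rw [e1]
  have e2 : ∀ (q w : Fin n → ℝ), ∑ j, c * √(n * h n) * (A⁻¹ * q j) * w j =
      c * (√(n * h n) * A⁻¹) * ∑ j, q j * w j := by
    intro q w
    rw [Finset.mul_sum]
    exact Finset.sum_congr rfl fun j _ => by ring
  rw [e2, ← mul_sub, sqrt_mul_inv_eq hy, ← mul_add, ← Finset.sum_add_distrib, hA, Finset.sum_mul,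
    ← Finset.sum_sub_distrib, ← Finset.sum_sub_distrib]
  rw [mul_comm (√(n * h n))⁻¹ _⁻¹, ← mul_assoc, ← mul_assoc]
  congr 1
  exact Finset.sum_congr rfl fun j _ => by ring

/-- The sum is c² (A/(nh))⁻² times the average of K² σ⁴; the powers f(x)⁻² and f(x) of the two
limits leave 1/f(x). -/
theorem tendsto_sum_errorWeight_sq [IsProbabilityMeasure P] (hs : DEISampling s)
    (hA1 : ProcessAssumption P X s h φ ψ γ κ) (hA2 : BandwidthAssumption s b h γ κ)
    (hA3 : KernelAssumption K) (hA4 : ModelAssumption P X V s m σ f ν I ε κ) (hx : x ∈ I)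
    (c : ℝ) :
    Tendsto (fun p : ℕ × Ω =>
      ∑ j, errorWeight K σ (h p.1) c x (fun k => X (s p.1 k) p.2) j ^ 2) (whp P)
      (𝓝 (c ^ 2 * ((∫ z, K z ^ 2) * σ x ^ 4 / f x))) := by
  have hf := hA4.f_pos_at hx
  have hav := tendsto_kernel_average hs hA1 hA2 hA3 hA4 hx
  have h1 := (((hav.inv₀ hf.ne').pow 2).const_mul (c ^ 2)).mul
    (tendsto_weighted_sq_average hs hA1 hA2 hA3 hA4 hx)
  have e : c ^ 2 * (f x)⁻¹ ^ 2 * (f x * (∫ z, K z ^ 2) * σ x ^ 4) =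
      c ^ 2 * ((∫ z, K z ^ 2) * σ x ^ 4 / f x) := by
    field_simp
  rw [e] at h1
  refine h1.congr' ?_
  filter_upwards [(tendsto_fst_whp P).eventually (eventually_gt_atTop 0)] with p hp0
  obtain ⟨n, ω⟩ := p
  simp only at hp0 ⊢
  have hn0 : (0 : ℝ) < n := by exact_mod_cast hp0
  have hhn := hA2.h_pos n
  have hy : 0 < (n : ℝ) * h n := by positivity
  unfold errorWeight
  set A := ∑ l, K ((x - X (s n l) ω) / h n)
  have e2 : ∀ q w : Fin n → ℝ, ∑ j, (c * √(n * h n) * (A⁻¹ * (q j * w j ^ 2))) ^ 2 =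
      c ^ 2 * (√(n * h n) * A⁻¹) ^ 2 * ∑ j, q j ^ 2 * w j ^ 4 := by
    intro q w
    rw [Finset.mul_sum]
    exact Finset.sum_congr rfl fun j _ => by ring
  rw [e2, sqrt_mul_inv_eq hy, mul_pow _⁻¹, inv_pow √(n * h n), Real.sq_sqrt hy.le]
  ring

/-- Uniform negligibility: every weight is of order (nh)^(-1/2). The bound is random because the
kernel sum stands in the denominator. -/
theorem exists_errorWeight_bound [IsProbabilityMeasure P] (hs : DEISampling s)
    (hA1 : ProcessAssumption P X s h φ ψ γ κ) (hA2 : BandwidthAssumption s b h γ κ)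
    (hA3 : KernelAssumption K) (hA4 : ModelAssumption P X V s m σ f ν I ε κ) (hx : x ∈ I)
    (c : ℝ) :
    ∃ B : ℕ × Ω → ℝ, Tendsto B (whp P) (𝓝 0) ∧ ∀ᶠ p in whp P, ∀ j,
      |errorWeight K σ (h p.1) c x (fun k => X (s p.1 k) p.2) j| ≤ B p := by
  obtain ⟨M, L, hK⟩ := hA3.exists_localFun
  have hL0 := hK.radius_nonneg
  have hM0 := hK.bound_nonneg
  have hf := hA4.f_pos_at hx
  have hav := tendsto_kernel_average hs hA1 hA2 hA3 hA4 hx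
  obtain ⟨r, hr, hσ⟩ := Metric.eventually_nhds_iff.1
    (((hA4.contDiffAt_σ hx).continuousAt.pow 2).eventually
      (eventually_lt_nhds (show σ x ^ 2 < σ x ^ 2 + 1 by linarith)))
  have hsmall : Tendsto (fun n => L * h n) atTop (𝓝 0) := by
    simpa using hA2.h_tendsto.const_mul L
  have h1 := (((hA2.tendsto_inv_sqrt.comp (tendsto_fst_whp P)).mul
    (hav.inv₀ hf.ne').abs).const_mul |c|).mul_const (M * (σ x ^ 2 + 1))
  rw [zero_mul, mul_zero, zero_mul] at h1
  refine ⟨_, h1, ?_⟩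
  filter_upwards [(tendsto_fst_whp P).eventually (eventually_gt_atTop 0),
    (tendsto_fst_whp P).eventually (hsmall.eventually (eventually_lt_nhds hr))] with p hp0 hp1 j
  obtain ⟨n, ω⟩ := p
  simp only [Function.comp_apply] at hp0 hp1 j ⊢
  have hn0 : (0 : ℝ) < n := by exact_mod_cast hp0
  have hhn := hA2.h_pos n
  have hy : 0 < (n : ℝ) * h n := by positivity
  unfold errorWeight
  rw [mul_assoc c, ← mul_assoc √(n * h n), sqrt_mul_inv_eq hy, ← mul_assoc c, abs_mul, abs_mul,
    abs_mul (√(n * h n))⁻¹, abs_of_nonneg (by positivity : 0 ≤ (√(n * h n))⁻¹)]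
  refine mul_le_mul_of_nonneg_left ?_ (by positivity)
  rw [abs_mul]
  rcases lt_or_ge L |(x - X (s n j) ω) / h n| with hj | hj
  · rw [hK.support _ hj, abs_zero, zero_mul]
    positivity
  · refine mul_le_mul (hK.bound _) ?_ (abs_nonneg _) hM0
    rw [abs_of_nonneg (sq_nonneg _)]
    refine (hσ ?_).le
    rw [Real.dist_eq, abs_sub_comm]
    rw [abs_div, abs_of_pos hhn, div_le_iff₀ hhn] at hj
    exact hj.trans_lt hp1

/-- Once 2Lh < |x - x'| no observation lies in both kernel windows, so coordinates of the limit
decouple. -/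
theorem eventually_errorWeight_mul_eq_zero (P : Measure Ω) (X : Plane → Ω → ℝ)
    (hA2 : BandwidthAssumption s b h γ κ) (hA3 : KernelAssumption K) (σ : ℝ → ℝ) {x x' : ℝ}
    (hx : x ≠ x') (c c' : ℝ) :
    ∀ᶠ p in whp P, ∀ j, errorWeight K σ (h p.1) c x (fun k => X (s p.1 k) p.2) j *
      errorWeight K σ (h p.1) c' x' (fun k => X (s p.1 k) p.2) j = 0 := by
  obtain ⟨M, L, hK⟩ := hA3.exists_localFun
  have hsmall : Tendsto (fun n => L * h n + L * h n) atTop (𝓝 0) := by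
    simpa using (hA2.h_tendsto.const_mul L).add (hA2.h_tendsto.const_mul L)
  filter_upwards [(tendsto_fst_whp P).eventually
    (hsmall.eventually (eventually_lt_nhds (abs_pos.2 (sub_ne_zero.2 hx))))] with p hp j
  obtain ⟨n, ω⟩ := p
  simp only at hp j ⊢
  have hhn := hA2.h_pos n
  unfold errorWeight
  rcases lt_or_ge L |(x - X (s n j) ω) / h n| with hj | hj
  · rw [hK.support _ hj]; ring
  · rcases lt_or_ge L |(x' - X (s n j) ω) / h n| with hj' | hj'
    · rw [hK.support _ hj']; ring
    · rw [abs_div, abs_of_pos hhn, div_le_iff₀ hhn] at hj hj'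
      have := abs_sub_le x (X (s n j) ω) x'
      rw [abs_sub_comm (X (s n j) ω)] at this
      linarith

/-- Otherwise `K` would vanish almost everywhere and could not have integral one. -/
theorem KernelAssumption.integral_sq_pos (hK : KernelAssumption K) : 0 < ∫ z, K z ^ 2 := by
  obtain ⟨M, L, hL⟩ := hK.exists_localFun
  refine (integral_nonneg fun z => sq_nonneg (K z)).lt_of_ne fun h0 => ?_
  rw [eq_comm, integral_eq_zero_iff_of_nonneg (fun z => sq_nonneg (K z)) hL.sq.integrable] at h0
  have h1 : ∫ z, K z = 0 := integral_eq_zero_of_ae (h0.mono fun z hz => by simpa using hz)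
  exact one_ne_zero (hK.integral_one.symm.trans h1)

/-- Weights for a linear functional of the vector, as in the Cramér–Wold device; the cross terms
between design points vanish eventually. -/
theorem tendsto_sum_combination_sq [IsProbabilityMeasure P] (hs : DEISampling s)
    (hA1 : ProcessAssumption P X s h φ ψ γ κ) (hA2 : BandwidthAssumption s b h γ κ)
    (hA3 : KernelAssumption K) (hA4 : ModelAssumption P X V s m σ f ν I ε κ)
    {N : ℕ} {x : Fin N → ℝ} (hx : Function.Injective x) (hxI : ∀ i, x i ∈ I) (c t : Fin N → ℝ) :
    Tendsto (fun p : ℕ × Ω => ∑ j, (∑ i, t i *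
        errorWeight K σ (h p.1) (c i) (x i) (fun k => X (s p.1 k) p.2) j) ^ 2) (whp P)
      (𝓝 (∑ i, t i ^ 2 * (c i ^ 2 * ((∫ z, K z ^ 2) * σ (x i) ^ 4 / f (x i))))) := by
  have h1 := tendsto_finsetSum Finset.univ fun i _ =>
    (tendsto_sum_errorWeight_sq hs hA1 hA2 hA3 hA4 (hxI i) (c i)).const_mul (t i ^ 2)
  refine h1.congr' ?_
  have h2 : ∀ᶠ p in whp P, ∀ i i', i ≠ i' → ∀ j,
      errorWeight K σ (h p.1) (c i) (x i) (fun k => X (s p.1 k) p.2) j *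
      errorWeight K σ (h p.1) (c i') (x i') (fun k => X (s p.1 k) p.2) j = 0 := by
    refine eventually_all.2 fun i => eventually_all.2 fun i' => eventually_all.2 fun hii => ?_
    exact eventually_errorWeight_mul_eq_zero P X hA2 hA3 σ (hx.ne hii) _ _
  filter_upwards [h2] with p hp
  simp_rw [Finset.mul_sum]
  rw [Finset.sum_comm]
  refine Finset.sum_congr rfl fun j _ => ?_
  rw [sq, Finset.sum_mul_sum]
  refine Finset.sum_congr rfl fun i _ => ?_
  rw [Finset.sum_eq_single i (fun i' _ hi' => ?_) (by simp)]
  · ring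
  · rw [mul_mul_mul_comm, hp i i' hi'.symm j, mul_zero]

/-- The conditional characteristic function converges in probability to a constant and is bounded by
one, so its expectation converges to the same constant. -/
theorem tendsto_integral_exp_leading [IsProbabilityMeasure P] (hs : DEISampling s)
    (hA1 : ProcessAssumption P X s h φ ψ γ κ) (hA2 : BandwidthAssumption s b h γ κ)
    (hA3 : KernelAssumption K) (hA4 : ModelAssumption P X V s m σ f ν I ε κ)
    (hV : 1 < ∫ v, v ^ 4 ∂ν)
    {N : ℕ} {x : Fin N → ℝ} (hx : Function.Injective x) (hxI : ∀ i, x i ∈ I) (c t : Fin N → ℝ) :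
    Tendsto (fun n => ∫ ω, Complex.exp ((∑ j, (∑ i, t i *
        errorWeight K σ (h n) (c i) (x i) (fun k => X (s n k) ω) j) *
          (V (s n j) ω ^ 2 - 1) : ℝ) * Complex.I) ∂P) atTop
      (𝓝 (Complex.exp (-(((∫ v, v ^ 4 ∂ν) - 1) *
        (∑ i, t i ^ 2 * (c i ^ 2 * ((∫ z, K z ^ 2) * σ (x i) ^ 4 / f (x i)))) / 2 : ℝ)))) := by
  have hν := hA4.stdNoise hA1.kappa_pos
  have hK := hA3.measurable
  have hσ := hA4.σ_measurable
  have hXm := hA1.measurable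
  choose B hB hBle using fun i => exists_errorWeight_bound hs hA1 hA2 hA3 hA4 (hxI i) (c i)
  have hA : Tendsto (fun p => ∑ i, |t i| * B i p) (whp P) (𝓝 0) := by
    simpa using tendsto_finsetSum Finset.univ fun i _ => (hB i).const_mul |t i|
  have haA : ∀ᶠ p in whp P, ∀ j, |∑ i, t i *
      errorWeight K σ (h p.1) (c i) (x i) (fun k => X (s p.1 k) p.2) j| ≤
      ∑ i, |t i| * B i p := by
    filter_upwards [eventually_all.2 hBle] with p hp j
    refine (Finset.abs_sum_le_sum_abs _ _).trans (Finset.sum_le_sum fun i _ => ?_)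
    rw [abs_mul]
    exact mul_le_mul_of_nonneg_left (hp i j) (abs_nonneg _)
  have ha : ∀ n (j : Fin n), Measurable fun xs : Fin n → ℝ =>
      ∑ i, t i * errorWeight K σ (h n) (c i) (x i) xs j := fun n j =>
    Finset.measurable_fun_sum _ fun i _ => (measurable_errorWeight hK hσ _ _ _ j).const_mul _
  have hprod := tendsto_prod_sqCharFun hν rfl (sub_pos.2 hV) hA haA
    (tendsto_sum_combination_sq hs hA1 hA2 hA3 hA4 hx hxI c t)
  have hlim := tendsto_integral_of_whp (P := P) (C := 1)
    (Z := fun n ω => ∏ j, sqCharFun ν (∑ i, t i *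
      errorWeight K σ (h n) (c i) (x i) (fun k => X (s n k) ω) j))
    (fun n => by
      refine (Measurable.aestronglyMeasurable ?_)
      refine Finset.measurable_fun_prod _ fun j _ => (continuous_sqCharFun hν).measurable.comp ?_
      exact (ha n j).comp (measurable_pi_lambda _ fun k => hXm _))
    (fun n ω => by
      rw [norm_prod]
      exact Finset.prod_le_one (fun _ _ => norm_nonneg _) fun _ _ => norm_sqCharFun_le hν _) hprod
  rw [integral_const, probReal_univ, one_smul] at hlim
  refine hlim.congr fun n => ?_
  exact (hA4.integral_exp_weighted hXm hA1.kappa_pos n (ha n)).symm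

/-- The leading term is asymptotically standard normal. -/
theorem tendstoInDistribution_leading [IsProbabilityMeasure P] (hs : DEISampling s)
    (hA1 : ProcessAssumption P X s h φ ψ γ κ) (hA2 : BandwidthAssumption s b h γ κ)
    (hA3 : KernelAssumption K) (hA4 : ModelAssumption P X V s m σ f ν I ε κ)
    (hV : 1 < ∫ v, v ^ 4 ∂ν)
    {N : ℕ} {x : Fin N → ℝ} (hx : Function.Injective x) (hxI : ∀ i, x i ∈ I) {c : Fin N → ℝ}
    (hc : ∀ i, ((∫ v, v ^ 4 ∂ν) - 1) *
      (c i ^ 2 * ((∫ z, K z ^ 2) * σ (x i) ^ 4 / f (x i))) = 1) :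
    TendstoInDistribution
      (fun (n : ℕ) (ω : Ω) => (WithLp.toLp 2 fun i : Fin N => ∑ j,
        errorWeight K σ (h n) (c i) (x i) (fun k => X (s n k) ω) j * (V (s n j) ω ^ 2 - 1) :
        EuclideanSpace ℝ (Fin N)))
      atTop (id : EuclideanSpace ℝ (Fin N) → EuclideanSpace ℝ (Fin N)) (fun _ => P)
      (multivariateGaussian (0 : EuclideanSpace ℝ (Fin N)) (1 : Matrix (Fin N) (Fin N) ℝ)) := by
  have hK := hA3.measurable
  have hσ := hA4.σ_measurable
  have hXm := hA1.measurable
  have hVm := hA4.V_measurable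
  have hmeas : ∀ n, Measurable fun ω : Ω => (WithLp.toLp 2 fun i : Fin N => ∑ j,
      errorWeight K σ (h n) (c i) (x i) (fun k => X (s n k) ω) j * (V (s n j) ω ^ 2 - 1) :
      EuclideanSpace ℝ (Fin N)) := by
    intro n
    refine (PiLp.continuous_toLp 2 _).measurable.comp (measurable_pi_lambda _ fun i => ?_)
    refine Finset.measurable_fun_sum _ fun j _ => ?_
    exact ((measurable_errorWeight hK hσ _ _ _ j).comp (measurable_pi_lambda _ fun k => hXm _)).mul
      (((hVm _).pow_const 2).sub_const 1)
  refine ⟨fun n => (hmeas n).aemeasurable, aemeasurable_id, ?_⟩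
  refine ProbabilityMeasure.tendsto_iff_tendsto_charFun.2 fun t => ?_
  simp only [ProbabilityMeasure.coe_mk, Measure.map_id]
  -- The inner product with `t` is one weighted sum of centred squared errors, so the scalar result
  -- covers the vector.
  have h1 := tendsto_integral_exp_leading hs hA1 hA2 hA3 hA4 hV hx hxI c (fun i => t i)
  have e : ((∫ v, v ^ 4 ∂ν) - 1) *
      (∑ i, t i ^ 2 * (c i ^ 2 * ((∫ z, K z ^ 2) * σ (x i) ^ 4 / f (x i)))) = ∑ i, t i ^ 2 := by
    rw [Finset.mul_sum]
    exact Finset.sum_congr rfl fun i _ => by rw [mul_left_comm, hc, mul_one]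
  rw [e] at h1
  rw [charFun_multivariateGaussian Matrix.PosSemidef.one]
  have e2 : Complex.exp (-((∑ i, t i ^ 2) / 2 : ℝ)) = Complex.exp
      ((inner ℝ t (0 : EuclideanSpace ℝ (Fin N)) : ℝ) * Complex.I -
        ((t.ofLp ⬝ᵥ (1 : Matrix (Fin N) (Fin N) ℝ).mulVec t.ofLp : ℝ) : ℂ) / 2) := by
    rw [inner_zero_right, Matrix.one_mulVec, dotProduct]
    congr 1
    push_cast
    simp only [sq]
    ring
  rw [e2] at h1
  refine h1.congr fun n => ?_
  rw [charFun_apply, integral_map (hmeas n).aemeasurable (by fun_prop)]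
  refine integral_congr_ae (Eventually.of_forall fun ω => ?_)
  simp only
  congr 3
  rw [PiLp.inner_apply]
  simp_rw [Finset.sum_mul]
  rw [Finset.sum_comm]
  refine Finset.sum_congr rfl fun i _ => ?_
  simp only [RCLike.inner_apply, conj_trivial]
  rw [Finset.mul_sum]
  exact Finset.sum_congr rfl fun j _ => by ring

theorem measurable_varianceEst_response (hK : Measurable K) (hm : Measurable m)
    (hσ : Measurable σ) (hX : ∀ u, Measurable (X u)) (hV : ∀ u, Measurable (V u)) {n : ℕ}
    (t : Fin n → Plane) (b h x : ℝ) :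
    Measurable fun ω => varianceEst K (fun j => X (t j) ω)
      (fun j => response m σ X V (t j) ω) b h x := by
  unfold varianceEst jackknifeMeanEst meanEst densityEst response
  fun_prop

end Leading

end SpatialReg

/-! ### Assembly of the theorem. -/

theorem theorem3p4 {Ω : Type*} [MeasurableSpace Ω] (P : Measure Ω) [IsProbabilityMeasure P]
    (X V : SpatialReg.Plane → Ω → ℝ) (s : (n : ℕ) → Fin n → SpatialReg.Plane)
    (m σ f K : ℝ → ℝ) (ν : Measure ℝ) (b h : ℕ → ℝ) (φ : ℝ → ℝ) (ψ : ℕ → ℕ → ℝ)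
    (γ κ ε : ℝ) (I : Set ℝ)
    (hs : SpatialReg.DEISampling s)
    (hA1 : SpatialReg.ProcessAssumption P X s h φ ψ γ κ)
    (hA2 : SpatialReg.BandwidthAssumption s b h γ κ)
    (hA3 : SpatialReg.KernelAssumption K)
    (hA4 : SpatialReg.ModelAssumption P X V s m σ f ν I ε κ)
    (hV : 1 < ∫ v, v ^ 4 ∂ν)
    (N : ℕ) (x : Fin N → ℝ) (hx : StrictMono x) (hxI : ∀ i, x i ∈ I) :
    TendstoInDistribution
      (fun (n : ℕ) (ω : Ω) => (WithLp.toLp 2 fun i : Fin N =>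
        √(n * h n / (((∫ v, v ^ 4 ∂ν) - 1) * ∫ z, K z ^ 2)) *
          (√(f (x i)) *
            (SpatialReg.varianceEst K (fun j : Fin n => X (s n j) ω)
                (fun j : Fin n => SpatialReg.response m σ X V (s n j) ω) (b n) (h n) (x i)
              - σ (x i) ^ 2) / √(σ (x i) ^ 4)) : EuclideanSpace ℝ (Fin N)))
      atTop (id : EuclideanSpace ℝ (Fin N) → EuclideanSpace ℝ (Fin N)) (fun _ => P)
      (multivariateGaussian (0 : EuclideanSpace ℝ (Fin N)) (1 : Matrix (Fin N) (Fin N) ℝ)) := by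
  open SpatialReg in
  have hk2 := hA3.integral_sq_pos
  have hτ : 0 < (∫ v, v ^ 4 ∂ν) - 1 := sub_pos.2 hV
  set D := ((∫ v, v ^ 4 ∂ν) - 1) * ∫ z, K z ^ 2 with hD
  have hD0 : 0 < D := mul_pos hτ hk2
  -- The scale that makes the limiting variance (E[V⁴] - 1) c² ∫K² σ⁴/f equal to one.
  set c : Fin N → ℝ := fun i => √(f (x i)) / √(σ (x i) ^ 4) / √D with hc
  have hlead := tendstoInDistribution_leading hs hA1 hA2 hA3 hA4 hV hx.injective hxI (c := c)
    (fun i => by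
      have hf := hA4.f_pos_at (hxI i)
      have hσ := hA4.σ_pos_at (hxI i)
      rw [hc]
      simp only
      rw [div_pow, div_pow, Real.sq_sqrt hf.le, Real.sq_sqrt (by positivity), Real.sq_sqrt hD0.le,
        hD]
      field_simp)
  -- Slutsky: the estimator and its leading term differ by a quantity tending to zero in
  -- probability.
  refine tendstoInDistribution_of_tendstoInMeasure_sub _ _ hlead
    (tendstoInMeasure_of_whp ?_) fun n => Measurable.aemeasurable ?_
  · have h0 : Tendsto (fun p : ℕ × Ω => (WithLp.toLp 2 fun i : Fin N => c i * √(p.1 * h p.1) *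
        (varianceEst K (fun j : Fin p.1 => X (s p.1 j) p.2)
          (fun j : Fin p.1 => response m σ X V (s p.1 j) p.2) (b p.1) (h p.1) (x i) -
            σ (x i) ^ 2) - ∑ j, errorWeight K σ (h p.1) (c i) (x i)
              (fun k => X (s p.1 k) p.2) j * (V (s p.1 j) p.2 ^ 2 - 1) :
        EuclideanSpace ℝ (Fin N))) (whp P) (𝓝 (WithLp.toLp 2 fun _ => 0)) :=
      ((PiLp.continuous_toLp 2 fun _ : Fin N => ℝ).tendsto _).comp (tendsto_pi_nhds.2 fun i =>
        tendsto_varianceEst_sub_leading hs hA1 hA2 hA3 hA4 (hxI i) (c i))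
    refine h0.congr fun p => ?_
    ext i
    have := hA2.h_pos p.1
    simp only [Pi.sub_apply, PiLp.sub_apply]
    rw [Real.sqrt_div (by positivity)]
    congr 1
    rw [hc]
    ring
  · refine (PiLp.continuous_toLp 2 _).measurable.comp (measurable_pi_lambda _ fun i => ?_)
    have := measurable_varianceEst_response hA3.measurable hA4.m_measurable hA4.σ_measurable
      hA1.measurable hA4.V_measurable (s n) (b n) (h n) (x i)
    fun_prop
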